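/- Let $p$ be an odd prime, $F_0$ a finite extension of $\mathbb{Q}_p$ with residue field of cardinality $q$, and $F/F_0$ a ramified quadratic extension with Galois involution $a\mapsto\bar a$ and rings of integers $O_F$, $O_{F_0}$. Let $\pi$ be a uniformizer of $F$ with $\bar\pi=-\pi$, so that $\pi_0=\pi^2$ is a uniformizer of $F_0$. A hermitian $O_F$-lattice is a free $O_F$-module of finite rank with a nondegenerate $F$-valued hermitian form $h$ (linear in the first variable). It is integral if $h$ takes values in $\pi^{-1}O_F$. A lattice $L$ of rank $n$ is split if $L\otimes_{O_F}F$ is isometric to $F^n$ with the form $(v,w)\mapsto\sum_i v_i\overline{w_{n+1-i}}$, and nonsplit otherwise. Let $H$ be the rank $2$ lattice with moment matrix $\begin{pmatrix}0&\pi^{-1}\\-\pi^{-1}&0\end{pmatrix}$, let $I_1^{\epsilon}$ be the rank $1$ lattice $\langle x\rangle$ with $h(x,x)=\epsilon$, and put $M_n=H^{n/2}$ for $n$ even and $M_n=H^{(n-1)/2}\perp I_1^1$ for $n$ odd. For hermitian $O_F$-lattices $L$ and $M$ of ranks $n$ and $m$, with $n\le m$ and $M$ integral, and for $d\ge1$,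 let $\mathrm{Herm}_{L,M}(O_{F_0}/\pi_0^d)$ be the set of $O_F$-linear maps $L/\pi^{2d}L\to M/\pi^{2d}M$ that preserve the hermitian forms modulo $\pi^{2d-1}O_F$ (for all lifts; this set is empty if $L$ is not integral). Put $$\mathrm{Den}(M,L)=\lim_{d\to\infty}\frac{|\mathrm{Herm}_{L,M}(O_{F_0}/\pi_0^d)|}{q^{d\,n(2m-n)}},$$ and let $\mathrm{Den}(M,L,X)\in\mathbb{Q}[X]$ be the polynomial with $\mathrm{Den}(M,L,q^{-2k})=\mathrm{Den}(M\perp H^k,L)$ for all integers $k\ge 0$. For a nonsplit $L$ of rank $n$ put $$\partial\mathrm{Den}(L)=\frac{-2\,\frac{d}{dX}\big|_{X=1}\mathrm{Den}(M_n,L,X)}{\mathrm{Den}(M_n,M_n)}.$$ Proposition. Let $n+1\ge2$ be even, let $L$ be a hermitian $O_F$-lattice of rank $n$, and suppose that $L^{\#}=L\perp I_1^{-1}$ is nonsplit. Then the limits that define $\mathrm{Den}(M_n\perp H^k,L)$ and $\mathrm{Den}(M_{n+1}\perp H^k,L^{\#})$ for all $k\ge0$ exist, as do those that define $\mathrm{Den}(M_n,M_n)$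 and $\mathrm{Den}(M_{n+1},M_{n+1})$, and the last two are positive. The polynomials $\mathrm{Den}(M_n,L,X)$ and $\mathrm{Den}(M_{n+1},L^{\#},X)$ exist and are unique, and $$\mathrm{Den}(M_{n+1},L^{\#},X)=\mathrm{Den}(M_n,L,X)\,(1-q^{-1-n}X),\qquad \partial\mathrm{Den}(L)=\tfrac12\,\partial\mathrm{Den}(L^{\#}).$$ -/

import Mathlib

open scoped TensorProduct
open Filter Topology Polynomial

/-- The ring of integers of a `p`-adic field `K`: the integral closure of `ℤ_p` in `K`. -/
noncomputable abbrev padicIntegers (p : ℕ) [Fact p.Prime] (K : Type*) [Field K] [Algebra ℚ_[p] K] :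
    Subring K :=
  (integralClosure (PadicInt.subring p) K).toSubring

/-- A ramified quadratic extension `F / F₀` of `p`-adic fields (`p` odd), with its nontrivial Galois
involution `a ↦ conj a`, a uniformizer `π` of `F` such that `conj π = -π`, and the uniformizer
`π₀ = π ^ 2` of `F₀`. -/
structure RamifiedQuadratic (p : ℕ) [Fact p.Prime] (F₀ F : Type*) [Field F₀] [Field F]
    [Algebra ℚ_[p] F₀] [Algebra ℚ_[p] F] [Algebra F₀ F] where
  finrank_eq_two : Module.finrank F₀ F = 2
  conj : F ≃ₐ[F₀] F
  conj_ne_one : conj ≠ 1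
  π : padicIntegers p F
  irreducible_π : Irreducible π
  conj_π : conj (π : F) = -(π : F)
  π₀ : padicIntegers p F₀
  irreducible_π₀ : Irreducible π₀
  π_sq : (π : F) ^ 2 = algebraMap F₀ F (π₀ : F₀)

namespace RamifiedQuadratic

variable {p : ℕ} [Fact p.Prime] {F₀ F : Type*} [Field F₀] [Field F]
  [Algebra ℚ_[p] F₀] [Algebra ℚ_[p] F] [Algebra F₀ F]

/-- The residue cardinality `q` of `F₀`. -/
noncomputable def q (E : RamifiedQuadratic p F₀ F) : ℕ :=
  Nat.card (padicIntegers p F₀ ⧸ Ideal.span {E.π₀})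

theorem conj_conj (E : RamifiedQuadratic p F₀ F) (a : F) : E.conj (E.conj a) = a := by
  have hF := E.finrank_eq_two
  have hfd : FiniteDimensional F₀ F := Module.finite_of_finrank_pos (by omega)
  have hcard : Nat.card (F ≃ₐ[F₀] F) ≤ 2 := by
    have h := AlgEquiv.card_le (F := F₀) (K := F)
    rw [Nat.card_eq_fintype_card]
    omega
  have hle : orderOf E.conj ≤ 2 := (orderOf_le_card).trans hcard
  have hpos : 0 < orderOf E.conj := orderOf_pos E.conj
  have hone : orderOf E.conj ≠ 1 := fun h => E.conj_ne_one (orderOf_eq_one_iff.mp h)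
  have htwo : orderOf E.conj = 2 := by omega
  have hpow : E.conj ^ 2 = 1 := by
    rw [← htwo]
    exact pow_orderOf_eq_one E.conj
  have happ := DFunLike.congr_fun hpow a
  rwa [pow_two, AlgEquiv.mul_apply, AlgEquiv.one_apply] at happ

/-- An `F`-valued hermitian form on an `O_F`-module `L`, linear in the first variable and
conjugate-linear in the second one. -/
structure HermForm (E : RamifiedQuadratic p F₀ F) (L : Type*) [AddCommGroup L]
    [Module (padicIntegers p F) L] where
  form : L → L → F
  add_left : ∀ x x' y, form (x + x') y = form x y + form x' y
  smul_left : ∀ (a : padicIntegers p F) x y, form (a • x) y = (a : F) * form x y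
  conj_symm : ∀ x y, form y x = E.conj (form x y)

namespace HermForm

variable {E : RamifiedQuadratic p F₀ F}
variable {L : Type*} [AddCommGroup L] [Module (padicIntegers p F) L]
variable {M : Type*} [AddCommGroup M] [Module (padicIntegers p F) M]

/-- Nondegeneracy. For a finite free `L` this is nondegeneracy of the induced form on
`L ⊗ F`, since every element of `L ⊗ F` has a nonzero `O_F`-multiple in `L`. -/
def Nondegenerate (h : HermForm E L) : Prop :=
  ∀ x, (∀ y, h.form x y = 0) → x = 0

/-- `L` is split: the hermitian space `L ⊗ F` is isometric to the standard split space, which is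
`F ^ n` with the form `(v, w) ↦ ∑ i, v i * conj (w (n + 1 - i))`. By sesquilinearity it
suffices to compare the two forms on the image of `L`. -/
def IsSplit (h : HermForm E L) : Prop :=
  ∃ e : (F ⊗[padicIntegers p F] L) ≃ₗ[F] (Fin (Module.finrank (padicIntegers p F) L) → F),
    ∀ x y : L, h.form x y = ∑ i, e (1 ⊗ₜ x) i * E.conj (e (1 ⊗ₜ y) (Fin.rev i))

/-- The orthogonal direct sum of two hermitian modules. -/
def orthSum (h : HermForm E L) (h' : HermForm E M) : HermForm E (L × M) where
  form x y := h.form x.1 y.1 + h'.form x.2 y.2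
  add_left x x' y := by
    simp only [Prod.fst_add, Prod.snd_add, h.add_left, h'.add_left]
    ring
  smul_left a x y := by
    simp only [Prod.smul_fst, Prod.smul_snd, h.smul_left, h'.smul_left]
    ring
  conj_symm x y := by
    rw [h.conj_symm x.1 y.1, h'.conj_symm x.2 y.2, map_add]

/-- The orthogonal direct sum of `k` copies of a hermitian module. -/
def orthPow (h : HermForm E L) (k : ℕ) : HermForm E (Fin k → L) where
  form x y := ∑ i, h.form (x i) (y i)
  add_left x x' y := by
    simp only [Pi.add_apply, h.add_left, Finset.sum_add_distrib]
  smul_left a x y := by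
    simp only [Pi.smul_apply, h.smul_left, Finset.mul_sum]
  conj_symm x y := by
    rw [map_sum]
    exact Finset.sum_congr rfl fun i _ => h.conj_symm (x i) (y i)

end HermForm

/-- The rank one lattice `I_1^ε = ⟨x⟩` with `h (x, x) = ε`, where `ε ∈ F₀`. -/
noncomputable def rankOne (E : RamifiedQuadratic p F₀ F) (ε : F₀) : HermForm E (padicIntegers p F) where
  form x y := (x : F) * algebraMap F₀ F ε * E.conj (y : F)
  add_left x x' y := by
    push_cast
    ring
  smul_left a x y := by
    rw [smul_eq_mul]
    push_cast
    ring
  conj_symm x y := by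
    rw [map_mul, map_mul, conj_conj, AlgEquiv.commutes]
    ring

/-- The hyperbolic lattice `H` of rank two, with moment matrix `(0, π⁻¹; -π⁻¹, 0)`. -/
noncomputable def hyperbolic (E : RamifiedQuadratic p F₀ F) :
    HermForm E (padicIntegers p F × padicIntegers p F) where
  form x y := (x.1 : F) * (E.π : F)⁻¹ * E.conj (y.2 : F)
    - (x.2 : F) * (E.π : F)⁻¹ * E.conj (y.1 : F)
  add_left x x' y := by
    simp only [Prod.fst_add, Prod.snd_add]
    push_cast
    ring
  smul_left a x y := by
    simp only [Prod.smul_fst, Prod.smul_snd, smul_eq_mul]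
    push_cast
    ring
  conj_symm x y := by
    simp only [map_sub, map_mul, map_inv₀, conj_conj, E.conj_π, inv_neg]
    ring

/-- The hermitian lattice `M_n`, that is `H^{n/2}` for even `n` and `H^{(n-1)/2} ⊥ I_1^1` for
odd `n`; here `I_1^1` occurs `n % 2` times. -/
noncomputable def stdLattice (E : RamifiedQuadratic p F₀ F) (n : ℕ) :
    HermForm E ((Fin (n / 2) → padicIntegers p F × padicIntegers p F) ×
      (Fin (n % 2) → padicIntegers p F)) :=
  (E.hyperbolic.orthPow (n / 2)).orthSum ((E.rankOne 1).orthPow (n % 2))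

namespace HermForm

variable {E : RamifiedQuadratic p F₀ F}
variable {L : Type*} [AddCommGroup L] [Module (padicIntegers p F) L]
variable {M : Type*} [AddCommGroup M] [Module (padicIntegers p F) M]

/-- `L / π^{2d} L`. -/
abbrev Quot (E : RamifiedQuadratic p F₀ F) (L : Type*) [AddCommGroup L]
    [Module (padicIntegers p F) L] (d : ℕ) : Type _ :=
  L ⧸ (Ideal.span {E.π ^ (2 * d)} • (⊤ : Submodule (padicIntegers p F) L))

/-- `Herm_{L,M}(O_{F₀} / π₀^d)` for `d ≥ 1`: the `O_F`-linear maps `L / π^{2d} L → M / π^{2d} M`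
that preserve the hermitian forms modulo `π^{2d-1} O_F`. For integral `L` and `M` the
congruence does not depend on the chosen lifts. If `M` is integral and `L` is not, the set is
empty. -/
def hermHoms (hM : HermForm E M) (hL : HermForm E L) (d : ℕ) :
    Set (Quot E L d →ₗ[padicIntegers p F] Quot E M d) :=
  {φ | ∀ (x y : L) (x' y' : M),
    φ (Submodule.Quotient.mk x) = Submodule.Quotient.mk x' →
    φ (Submodule.Quotient.mk y) = Submodule.Quotient.mk y' →
    ∃ c : padicIntegers p F,
      hM.form x' y' - hL.form x y = (E.π : F) ^ (2 * d - 1) * (c : F)}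

/-- The sequence `d ↦ #Herm_{L,M}(O_{F₀} / π₀^d) / q^{d n (2m - n)}`, with `n` the rank of `L`
and `m` the rank of `M`; used for `n ≤ 2m`. -/
noncomputable def densitySeq (hM : HermForm E M) (hL : HermForm E L) (d : ℕ) : ℝ :=
  (Nat.card (hermHoms hM hL d) : ℝ) /
    (E.q : ℝ) ^ (d * (Module.finrank (padicIntegers p F) L *
      (2 * Module.finrank (padicIntegers p F) M - Module.finrank (padicIntegers p F) L)))

/-- The local density `Den(M, L)`. -/
noncomputable def density (hM : HermForm E M) (hL : HermForm E L) : ℝ :=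
  limUnder atTop (densitySeq hM hL)

/-- `P` is a local density polynomial of `(M, L)`: for every `k ≥ 0` the limit `Den(M ⊥ H^k, L)`
exists and equals `P(q^{-2k})`. -/
def IsDensityPoly (hM : HermForm E M) (hL : HermForm E L) (P : ℚ[X]) : Prop :=
  ∀ k : ℕ, Tendsto (densitySeq (hM.orthSum (E.hyperbolic.orthPow k)) hL) atTop
    (𝓝 ((P.eval (((E.q : ℚ) ^ (2 * k))⁻¹) : ℚ) : ℝ))

open Classical in
/-- The local density polynomial `Den(M, L, X)`. -/
noncomputable def densityPoly (hM : HermForm E M) (hL : HermForm E L) : ℚ[X] :=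
  if h : ∃ P, IsDensityPoly hM hL P then h.choose else 0

/-- The normalized derived local density
`∂Den(L) = -2 (d/dX)|_{X=1} Den(M_n, L, X) / Den(M_n, M_n)`, with `n` the rank of `L`. -/
noncomputable def derivedDensity (h : HermForm E L) : ℝ :=
  (-2 * (((densityPoly (E.stdLattice (Module.finrank (padicIntegers p F) L)) h).derivative.eval 1
      : ℚ) : ℝ)) /
    density (E.stdLattice (Module.finrank (padicIntegers p F) L))
      (E.stdLattice (Module.finrank (padicIntegers p F) L))

end HermForm

end RamifiedQuadratic

/-! Multiplication by π turns a hermitian form h with values in π⁻¹O_F into a skew-hermitian form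
with values in O_F, and preserving h modulo π^{2d-1} becomes preserving πh modulo π^{2d}
(`IsReduction.card_hermHoms`). For integral lattices everything is thus a count of isometric maps
over the finite ring R = O_F/π^{2d}, where H becomes the standard hyperbolic plane and I_1^{±1} the
line of value ±π.

The product formula: M_{n+1} ⊥ H^k is H^m with 2m = n+1+2k. An isometric map from L^# to it is a
vector v of value -π together with an isometric map from L to v^⊥. Such a v has a unit coordinate,
since otherwise π² would divide its value. By Witt's theorem (`exists_isIsometry_of_isUnimodular`) v
can be moved to (1, π/2) in one plane, whose complement in that plane is a line of value π. So v^⊥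
is the reduction of M_n ⊥ H^k, whatever v is (`card_isometricMaps_orthSum_line`). The values of
vectors with a unit coordinate are equidistributed among the skew elements of R
(`skewEquidistributed_hyp_orthPow`), so the number of v is q^{4dm}(1 - q^{-2m})/q^d, and 1 - q^{-2m}
is 1 - q^{-1-n}X at X = q^{-2k}. The identity holds at each finite level d ≥ 1
(`densitySeq_orthSum_rankOne`).

Existence of the polynomials: for integral L, Newton's method (`card_matrix_lift`) makes the density
sequence constant from a level that depends on L only. At that level, Fourier inversion writes the
number of isometric maps to M ⊥ H^k as a sum over characters of k-th powers of Gauss sums. Each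
Gauss sum is the sum of an alternating bicharacter on a finite module, so it equals a fixed constant
times q^{-2j} (`exists_sum_alternating_bicharacter`), and the densities are a polynomial in q^{-2k}.
Interpolation makes it rational.

The derivative: if Den(M_{n+1}, L^#, X) did not vanish at 1, compactness of O_F would give an
isometric embedding of L^# into M_{n+1}, which has the same rank and is split; but L^# is nonsplit.
Hence Den(M_n, L, X) vanishes at 1 too, and the two derivatives at 1 differ by the factor 1 -
q^{-1-n}. Splitting off hyperbolic planes gives Den(M_n, M_n) = 2∏_{i ≤ (n-1)/2}(1 - q^{-2i}), while
Den(M_{n+1}, M_{n+1}) lacks the 2 and has the additional factor 1 - q^{-1-n}; the quotient leaves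
1/2. -/

/-! ### Rings of integers of p-adic fields: norm, divisibility, compactness -/

section PadicIntegers

variable {p : ℕ} [Fact p.Prime] {K : Type*} [Field K] [Algebra ℚ_[p] K]

theorem mem_padicIntegers_iff_isIntegral {x : K} :
    x ∈ padicIntegers p K ↔ IsIntegral (PadicInt.subring p) x := Iff.rfl

variable [FiniteDimensional ℚ_[p] K]

/-- The spectral norm is at most 1 exactly when the minimal polynomial over ℚ_p has coefficients in
ℤ_p; since ℤ_p is integrally closed, this is integrality. -/
theorem mem_padicIntegers_iff_spectralNorm_le_one {x : K} :
    x ∈ padicIntegers p K ↔ spectralNorm ℚ_[p] K x ≤ 1 := by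
  have hx : IsIntegral ℚ_[p] x := Algebra.IsIntegral.isIntegral x
  rw [spectralNorm, spectralValue_le_one_iff (minpoly.monic hx), mem_padicIntegers_iff_isIntegral]
  constructor
  · intro h n
    have : IsIntegrallyClosed (PadicInt.subring p) :=
      inferInstanceAs (IsIntegrallyClosed ℤ_[p])
    have : IsDomain (PadicInt.subring p) := inferInstance
    have : IsFractionRing (PadicInt.subring p) ℚ_[p] :=
      inferInstanceAs (IsFractionRing ℤ_[p] ℚ_[p])
    rw [minpoly.isIntegrallyClosed_eq_field_fractions' ℚ_[p] h, coeff_map]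
    exact ((minpoly (PadicInt.subring p) x).coeff n).2
  · intro h
    have hs : (↑(minpoly ℚ_[p] x).coeffs : Set ℚ_[p]) ⊆ PadicInt.subring p := by
      intro c hc
      obtain ⟨n, -, rfl⟩ := mem_coeffs_iff.mp (Finset.mem_coe.mp hc)
      exact h n
    refine ⟨(minpoly ℚ_[p] x).toSubring _ hs, (monic_toSubring _ _ hs).mpr (minpoly.monic hx), ?_⟩
    have := minpoly.aeval ℚ_[p] x
    rw [← Polynomial.map_toSubring _ _ hs, aeval_def, eval₂_map] at this
    exact this

theorem isUnit_padicIntegers_iff {x : padicIntegers p K} :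
    IsUnit x ↔ spectralNorm ℚ_[p] K (x : K) = 1 := by
  let _ := spectralNorm.normedField ℚ_[p] K
  have hn : ∀ y : K, ‖y‖ = spectralNorm ℚ_[p] K y := fun _ => rfl
  constructor
  · rintro ⟨u, rfl⟩
    have h1 := mem_padicIntegers_iff_spectralNorm_le_one.mp (u : padicIntegers p K).2
    have h2 := mem_padicIntegers_iff_spectralNorm_le_one.mp ((u⁻¹ : (padicIntegers p K)ˣ) : padicIntegers p K).2
    have h3 : ((u : padicIntegers p K) : K) * ((u⁻¹ : (padicIntegers p K)ˣ) : padicIntegers p K) = 1 := by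
      exact_mod_cast congrArg Subtype.val u.mul_inv
    rw [← hn] at h1 h2 ⊢
    have h4 := congrArg norm h3
    rw [norm_mul, norm_one] at h4
    nlinarith [norm_nonneg ((u : padicIntegers p K) : K)]
  · intro h
    have hx : (x : K) ≠ 0 := by
      intro h0
      rw [h0, spectralNorm_zero] at h
      exact zero_ne_one h
    have hinv : (x : K)⁻¹ ∈ padicIntegers p K := by
      rw [mem_padicIntegers_iff_spectralNorm_le_one, ← hn, norm_inv, hn, h, inv_one]
    exact IsUnit.of_mul_eq_one ⟨_, hinv⟩ (Subtype.ext (mul_inv_cancel₀ hx))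

theorem padicIntegers_dvd_iff {x y : padicIntegers p K} :
    x ∣ y ↔ spectralNorm ℚ_[p] K (y : K) ≤ spectralNorm ℚ_[p] K (x : K) := by
  let _ := spectralNorm.normedField ℚ_[p] K
  have hn : ∀ y : K, ‖y‖ = spectralNorm ℚ_[p] K y := fun _ => rfl
  constructor
  · rintro ⟨c, rfl⟩
    have hc := mem_padicIntegers_iff_spectralNorm_le_one.mp c.2
    rw [← hn] at hc ⊢
    rw [← hn, Subring.coe_mul, norm_mul]
    exact mul_le_of_le_one_right (norm_nonneg _) hc
  · intro h
    rw [← hn, ← hn] at h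
    by_cases hx : (x : K) = 0
    · rw [hx, norm_zero] at h
      have hy : (y : K) = 0 := norm_le_zero_iff.mp h
      exact ⟨0, Subtype.ext (by simp [hy])⟩
    · have hc : (y : K) / x ∈ padicIntegers p K := by
        rw [mem_padicIntegers_iff_spectralNorm_le_one, ← hn, norm_div]
        exact div_le_one_of_le₀ h (norm_nonneg _)
      exact ⟨⟨_, hc⟩, Subtype.ext (mul_div_cancel₀ _ hx).symm⟩

/-- Divisibility is a total preorder because it compares norms. If ϖ does not divide x, then x
divides ϖ, and irreducibility leaves only the case that x is a unit. -/
theorem isUnit_or_irreducible_dvd {ϖ : padicIntegers p K} (hϖ : Irreducible ϖ)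
    (x : padicIntegers p K) : IsUnit x ∨ ϖ ∣ x := by
  by_cases h : ϖ ∣ x
  · exact Or.inr h
  · left
    have h1 : x ∣ ϖ := by
      rw [padicIntegers_dvd_iff] at h ⊢
      exact (not_le.mp h).le
    obtain ⟨c, hc⟩ := h1
    refine (hϖ.isUnit_or_isUnit hc).resolve_right fun hu => h ?_
    rw [hc]
    exact (hu.mul_right_dvd).mpr dvd_rfl

theorem exists_dvd_irreducible_pow {ϖ : padicIntegers p K} (hϖ : Irreducible ϖ)
    {x : padicIntegers p K} (hx : x ≠ 0) : ∃ k : ℕ, x ∣ ϖ ^ k := by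
  let _ := spectralNorm.normedField ℚ_[p] K
  have hn : ∀ y : K, ‖y‖ = spectralNorm ℚ_[p] K y := fun _ => rfl
  have h1 : ‖(ϖ : K)‖ < 1 := by
    have h := mem_padicIntegers_iff_spectralNorm_le_one.mp ϖ.2
    rw [hn]
    exact lt_of_le_of_ne h fun h => hϖ.not_isUnit (isUnit_padicIntegers_iff.mpr h)
  have hx' : 0 < ‖(x : K)‖ := norm_pos_iff.mpr fun h => hx (Subtype.ext h)
  obtain ⟨k, hk⟩ := exists_pow_lt_of_lt_one hx' h1
  refine ⟨k, ?_⟩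
  rw [padicIntegers_dvd_iff, ← hn, ← hn, Subring.coe_pow, norm_pow]
  exact hk.le

theorem isCompact_padicIntegers :
    letI := spectralNorm.normedField ℚ_[p] K
    IsCompact (padicIntegers p K : Set K) := by
  let _ := spectralNorm.normedField ℚ_[p] K
  let _ := spectralNorm.normedSpace ℚ_[p] K
  have : ProperSpace K := FiniteDimensional.proper ℚ_[p] K
  have : (padicIntegers p K : Set K) = Metric.closedBall 0 1 := by
    ext x
    rw [mem_closedBall_zero_iff]
    exact mem_padicIntegers_iff_spectralNorm_le_one
  rw [this]
  exact isCompact_closedBall _ _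

theorem isOpen_padicIntegers_ideal {ϖ : padicIntegers p K} (hϖ : ϖ ≠ 0) (a : K) :
    letI := spectralNorm.normedField ℚ_[p] K
    IsOpen {x : K | ∃ c : padicIntegers p K, x - a = ϖ * c} := by
  let _ := spectralNorm.normedField ℚ_[p] K
  have hn : ∀ y : K, ‖y‖ = spectralNorm ℚ_[p] K y := fun _ => rfl
  have h0 : (ϖ : K) ≠ 0 := fun h => hϖ (Subtype.ext h)
  have h0' : 0 < ‖(ϖ : K)‖ := norm_pos_iff.mpr h0
  rw [Metric.isOpen_iff]
  rintro x ⟨c, hc⟩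
  refine ⟨‖(ϖ : K)‖, h0', fun y hy => ?_⟩
  rw [Metric.mem_ball, dist_eq_norm] at hy
  have hmem : (y - x) / ϖ ∈ padicIntegers p K := by
    rw [mem_padicIntegers_iff_spectralNorm_le_one, ← hn, norm_div]
    exact div_le_one_of_le₀ hy.le h0'.le
  refine ⟨⟨_, hmem⟩ + c, ?_⟩
  rw [Subring.coe_add, mul_add, mul_div_cancel₀ _ h0, ← hc]
  ring

/-- The cosets of a nonzero principal ideal are open and cover the compact ring of integers. -/
theorem finite_padicIntegers_quotient {ϖ : padicIntegers p K} (hϖ : ϖ ≠ 0) :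
    Finite (padicIntegers p K ⧸ Ideal.span {ϖ}) := by
  let _ := spectralNorm.normedField ℚ_[p] K
  obtain ⟨t, ht⟩ := (isCompact_padicIntegers (p := p) (K := K)).elim_finite_subcover
    (fun a : padicIntegers p K => {x : K | ∃ c : padicIntegers p K, x - a = ϖ * c})
    (fun a => isOpen_padicIntegers_ideal hϖ a)
    (fun x hx => Set.mem_iUnion.mpr ⟨⟨x, hx⟩, 0, by simp⟩)
  refine Finite.of_surjective
    (fun a : t => Ideal.Quotient.mk (Ideal.span {ϖ}) (a : padicIntegers p K)) fun y => ?_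
  obtain ⟨x, rfl⟩ := Ideal.Quotient.mk_surjective y
  obtain ⟨a, ha⟩ := Set.mem_iUnion.mp (ht x.2)
  obtain ⟨hat, c, hc⟩ := Set.mem_iUnion.mp ha
  refine ⟨⟨a, hat⟩, ?_⟩
  rw [eq_comm, Ideal.Quotient.eq, Ideal.mem_span_singleton]
  exact ⟨c, Subtype.ext hc⟩

end PadicIntegers

/-! ### Skew-hermitian forms, isometries and Witt's theorem -/

/-- A skew-hermitian form on a module over a commutative ring with involution, linear in the first
variable. -/
structure SkewHermForm (R V : Type*) [CommRing R] [StarRing R] [AddCommGroup V] [Module R V] where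
  form : V → V → R
  add_left : ∀ x x' y, form (x + x') y = form x y + form x' y
  smul_left : ∀ (a : R) x y, form (a • x) y = a * form x y
  skew : ∀ x y, form y x = -star (form x y)

namespace SkewHermForm

variable {R : Type*} [CommRing R] [StarRing R]
variable {V : Type*} [AddCommGroup V] [Module R V]
variable {W : Type*} [AddCommGroup W] [Module R W]
variable {U : Type*} [AddCommGroup U] [Module R U]

theorem add_right (B : SkewHermForm R V) (x y y' : V) :
    B.form x (y + y') = B.form x y + B.form x y' := by
  rw [B.skew (y + y') x, B.skew y x, B.skew y' x, B.add_left, star_add, neg_add]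

theorem smul_right (B : SkewHermForm R V) (a : R) (x y : V) :
    B.form x (a • y) = star a * B.form x y := by
  rw [B.skew (a • y) x, B.skew y x, B.smul_left, star_mul', mul_neg]

theorem zero_left (B : SkewHermForm R V) (y : V) : B.form 0 y = 0 := by
  have := B.smul_left 0 0 y
  rwa [zero_smul, zero_mul] at this

theorem zero_right (B : SkewHermForm R V) (x : V) : B.form x 0 = 0 := by
  rw [B.skew 0 x, B.zero_left, star_zero, neg_zero]

theorem star_form_self (B : SkewHermForm R V) (x : V) : star (B.form x x) = -B.form x x :=
  neg_eq_iff_eq_neg.mp (B.skew x x).symm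

/-- The orthogonal direct sum. -/
def orthSum (B : SkewHermForm R V) (B' : SkewHermForm R W) : SkewHermForm R (V × W) where
  form x y := B.form x.1 y.1 + B'.form x.2 y.2
  add_left x x' y := by
    simp only [Prod.fst_add, Prod.snd_add, B.add_left, B'.add_left]
    ring
  smul_left a x y := by
    simp only [Prod.smul_fst, Prod.smul_snd, B.smul_left, B'.smul_left]
    ring
  skew x y := by
    rw [B.skew x.1 y.1, B'.skew x.2 y.2, star_add]
    ring

theorem orthSum_form (B : SkewHermForm R V) (B' : SkewHermForm R W) (x y : V × W) :
    (B.orthSum B').form x y = B.form x.1 y.1 + B'.form x.2 y.2 := rfl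

/-- The orthogonal direct sum of `k` copies. -/
def orthPow (B : SkewHermForm R V) (k : ℕ) : SkewHermForm R (Fin k → V) where
  form x y := ∑ i, B.form (x i) (y i)
  add_left x x' y := by
    simp only [Pi.add_apply, B.add_left, Finset.sum_add_distrib]
  smul_left a x y := by
    simp only [Pi.smul_apply, B.smul_left, Finset.mul_sum]
  skew x y := by
    rw [star_sum, ← Finset.sum_neg_distrib]
    exact Finset.sum_congr rfl fun i _ => B.skew (x i) (y i)

variable (R) in
/-- The hyperbolic plane. -/
def hyp : SkewHermForm R (R × R) where
  form x y := x.1 * star y.2 - x.2 * star y.1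
  add_left x x' y := by
    simp only [Prod.fst_add, Prod.snd_add]
    ring
  smul_left a x y := by
    simp only [Prod.smul_fst, Prod.smul_snd, smul_eq_mul]
    ring
  skew x y := by
    simp only [star_sub, star_mul', star_star]
    ring

theorem hyp_form (x y : R × R) : (hyp R).form x y = x.1 * star y.2 - x.2 * star y.1 := rfl

/-- The rank one form with a given skew value. -/
def line (s : R) (hs : star s = -s) : SkewHermForm R R where
  form x y := x * s * star y
  add_left x x' y := by ring
  smul_left a x y := by
    rw [smul_eq_mul]
    ring
  skew x y := by
    simp only [star_mul', star_star, hs]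
    ring

/-- The isometric linear maps from `(W, B')` to `(V, B)`. -/
def isometricMaps (B : SkewHermForm R V) (B' : SkewHermForm R W) : Set (W →ₗ[R] V) :=
  {T | ∀ x y, B.form (T x) (T y) = B'.form x y}

/-- The linear equivalence `e` is an isometry. -/
def IsIsometry (B : SkewHermForm R V) (B' : SkewHermForm R W) (e : V ≃ₗ[R] W) : Prop :=
  ∀ x y, B'.form (e x) (e y) = B.form x y

theorem IsIsometry.symm {B : SkewHermForm R V} {B' : SkewHermForm R W} {e : V ≃ₗ[R] W}
    (h : IsIsometry B B' e) : IsIsometry B' B e.symm := fun x y => by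
  rw [← h, e.apply_symm_apply, e.apply_symm_apply]

theorem IsIsometry.trans {B : SkewHermForm R V} {B' : SkewHermForm R W} {B'' : SkewHermForm R U}
    {e : V ≃ₗ[R] W} {e' : W ≃ₗ[R] U} (h : IsIsometry B B' e) (h' : IsIsometry B' B'' e') :
    IsIsometry B B'' (e.trans e') := fun x y => by
  rw [LinearEquiv.trans_apply, LinearEquiv.trans_apply, h', h]

theorem card_isometricMaps_congr_left {B : SkewHermForm R V} {B' : SkewHermForm R W}
    {e : V ≃ₗ[R] W} (h : IsIsometry B B' e) (C : SkewHermForm R U) :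
    Nat.card (isometricMaps B C) = Nat.card (isometricMaps B' C) :=
  Nat.card_congr
    { toFun := fun T => ⟨e.toLinearMap ∘ₗ T.1, fun _ _ => (h _ _).trans (T.2 _ _)⟩
      invFun := fun T => ⟨e.symm.toLinearMap ∘ₗ T.1, fun _ _ => (h.symm _ _).trans (T.2 _ _)⟩
      left_inv := fun T => by ext; simp
      right_inv := fun T => by ext; simp }

theorem card_isometricMaps_congr_right {B : SkewHermForm R V} {B' : SkewHermForm R W}
    {e : V ≃ₗ[R] W} (h : IsIsometry B B' e) (C : SkewHermForm R U) :
    Nat.card (isometricMaps C B) = Nat.card (isometricMaps C B') :=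
  Nat.card_congr
    { toFun := fun T => ⟨T.1 ∘ₗ e.symm.toLinearMap, fun _ _ => (T.2 _ _).trans (h.symm _ _)⟩
      invFun := fun T => ⟨T.1 ∘ₗ e.toLinearMap, fun _ _ => (T.2 _ _).trans (h _ _)⟩
      left_inv := fun T => by ext; simp
      right_inv := fun T => by ext; simp }

theorem IsIsometry.prodCongr {V' W' : Type*} [AddCommGroup V'] [Module R V'] [AddCommGroup W']
    [Module R W'] {B : SkewHermForm R V} {B' : SkewHermForm R W} {e : V ≃ₗ[R] W}
    {C : SkewHermForm R V'} {C' : SkewHermForm R W'} {e' : V' ≃ₗ[R] W'}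
    (h : IsIsometry B B' e) (h' : IsIsometry C C' e') :
    IsIsometry (B.orthSum C) (B'.orthSum C') (e.prodCongr e') := fun _ _ =>
  congrArg₂ (· + ·) (h _ _) (h' _ _)

theorem isIsometry_refl (B : SkewHermForm R V) : IsIsometry B B (LinearEquiv.refl R V) :=
  fun _ _ => rfl

theorem isIsometry_prodAssoc (B : SkewHermForm R V) (B' : SkewHermForm R W)
    (B'' : SkewHermForm R U) :
    IsIsometry ((B.orthSum B').orthSum B'') (B.orthSum (B'.orthSum B''))
      (LinearEquiv.prodAssoc R V W U) := fun _ _ => (add_assoc _ _ _).symm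

theorem isIsometry_prodComm (B : SkewHermForm R V) (B' : SkewHermForm R W) :
    IsIsometry (B.orthSum B') (B'.orthSum B) (LinearEquiv.prodComm R V W) :=
  fun _ _ => add_comm _ _

/-- Splitting off the `i`-th coordinate. -/
def removeNthEquiv (V : Type*) [AddCommGroup V] [Module R V] {m : ℕ} (i : Fin (m + 1)) :
    (Fin (m + 1) → V) ≃ₗ[R] V × (Fin m → V) where
  toFun f := (f i, i.removeNth f)
  invFun g := i.insertNth g.1 g.2
  map_add' _ _ := rfl
  map_smul' _ _ := rfl
  left_inv f := i.insertNth_self_removeNth f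
  right_inv g := by ext <;> simp

theorem isIsometry_removeNthEquiv (B : SkewHermForm R V) {m : ℕ} (i : Fin (m + 1)) :
    IsIsometry (B.orthPow (m + 1)) (B.orthSum (B.orthPow m)) (removeNthEquiv V i) :=
  fun x y => (Fin.sum_univ_succAbove (fun j => B.form (x j) (y j)) i).symm

theorem exists_isIsometry_append (B : SkewHermForm R V) (m k : ℕ) :
    ∃ e, IsIsometry ((B.orthPow m).orthSum (B.orthPow k)) (B.orthPow (m + k)) e := by
  refine ⟨((LinearEquiv.sumArrowLequivProdArrow (Fin m) (Fin k) R V).symm.trans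
    (LinearEquiv.funCongrLeft R V finSumFinEquiv.symm)), fun x y => ?_⟩
  simp [orthPow, orthSum, Fin.sum_univ_add, LinearEquiv.funCongrLeft_apply]
  rfl

/-- The isometry `(a, b) ↦ (b, -a)` of the hyperbolic plane. -/
def hypSwap : (R × R) ≃ₗ[R] (R × R) where
  toFun x := (x.2, -x.1)
  invFun x := (-x.2, x.1)
  map_add' x y := by ext <;> simp [add_comm]
  map_smul' a x := by ext <;> simp
  left_inv x := by simp
  right_inv x := by simp

theorem isIsometry_hypSwap : IsIsometry (hyp R) (hyp R) hypSwap := fun x y => by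
  simp only [hyp, hypSwap, LinearEquiv.coe_mk, LinearMap.coe_mk, AddHom.coe_mk, star_neg]
  ring

theorem star_invOf_two [Invertible (2 : R)] : star (⅟2 : R) = ⅟2 := by
  have h : (2 : R) * star (⅟2 : R) = 1 := by
    have := congrArg star (mul_invOf_self (2 : R))
    rwa [star_mul', star_ofNat, star_one] at this
  exact (invOf_eq_right_inv h).symm

/-- Witt's theorem for a vector of a space `H ⊥ V` whose first coordinate is a unit. -/
theorem exists_isIsometry_hyp_orthSum [Invertible (2 : R)] (B : SkewHermForm R V)
    (v : (R × R) × V) (hv : IsUnit v.1.1) :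
    ∃ e, IsIsometry ((hyp R).orthSum B) ((hyp R).orthSum B) e ∧
      e ((1, -⅟2 * ((hyp R).orthSum B).form v v), 0) = v ∧
        e ((0, star v.1.1), 0) = ((0, 1), 0) := by
  obtain ⟨⟨a, b⟩, u⟩ := v
  simp only at hv
  set a' : R := ↑(hv.unit⁻¹) with ha'
  have haa : a * a' = 1 := hv.mul_val_inv
  have hsaa : star a * star a' = 1 := by rw [← star_mul', haa, star_one]
  -- The vector (1, t) of the plane has value star t - t = -2t, which is thus the value of v.
  set t : R := -⅟2 * ((hyp R).orthSum B).form ((a, b), u) ((a, b), u) with ht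
  have h2 : (2 : R) * ⅟2 = 1 := mul_invOf_self 2
  have hst : star t = -t := by
    rw [ht, star_mul', star_form_self, star_neg, star_invOf_two]
    ring
  have h2t : 2 * t = -(a * star b - b * star a + B.form u u) := by
    have : ((hyp R).orthSum B).form ((a, b), u) ((a, b), u) =
      a * star b - b * star a + B.form u u := rfl
    rw [ht, this]
    linear_combination (-(a * star b - b * star a + B.form u u)) * h2
  clear_value t a'
  -- The second basis vector of the plane goes to its multiple by `star a'`, and the image of the
  -- first is chosen so that (1, t) goes to v. A vector w of V acquires the correction `star a' *
  -- B.form w u` in the second coordinate, which keeps its image orthogonal to that of the plane.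
  let e : ((R × R) × V) ≃ₗ[R] ((R × R) × V) :=
    { toFun := fun z => ((z.1.1 * a, z.1.1 * (b - t * star a') + z.1.2 * star a' +
        star a' * B.form z.2 u), z.1.1 • u + z.2)
      invFun := fun z => ((z.1.1 * a', star a * (z.1.2 - z.1.1 * a' * (b - t * star a')) -
        B.form (z.2 - (z.1.1 * a') • u) u), z.2 - (z.1.1 * a') • u)
      map_add' := fun x y => by
        ext
        · simp only [Prod.fst_add]; ring
        · simp only [Prod.fst_add, Prod.snd_add, B.add_left]; ring
        · simp only [Prod.fst_add, Prod.snd_add, add_smul]; abel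
      map_smul' := fun c x => by
        ext
        · simp only [Prod.smul_fst, smul_eq_mul, RingHom.id_apply]; ring
        · simp only [Prod.smul_fst, Prod.smul_snd, smul_eq_mul, RingHom.id_apply, B.smul_left]
          ring
        · simp only [Prod.smul_fst, Prod.smul_snd, smul_eq_mul, RingHom.id_apply, smul_add,
            mul_smul]
      left_inv := fun z => by
        have h : z.1.1 * a * a' = z.1.1 := by rw [mul_assoc, haa, mul_one]
        ext
        · exact h
        · simp only [h, add_sub_cancel_left]
          linear_combination (z.1.2 + B.form z.2 u) * hsaa
        · simp only [h, add_sub_cancel_left]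
      right_inv := fun z => by
        have h : z.1.1 * a' * a = z.1.1 := by rw [mul_assoc, mul_comm a', haa, mul_one]
        ext
        · exact h
        · simp only
          linear_combination (z.1.2 - z.1.1 * a' * (b - t * star a')) * hsaa
        · simp only [add_sub_cancel] }
  have he : ∀ z, e z = ((z.1.1 * a, z.1.1 * (b - t * star a') + z.1.2 * star a' +
        star a' * B.form z.2 u), z.1.1 • u + z.2) := fun _ => rfl
  refine ⟨e, fun x y => ?_, ?_, ?_⟩
  · obtain ⟨⟨x1, x2⟩, w⟩ := x
    obtain ⟨⟨y1, y2⟩, z⟩ := y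
    rw [he, he]
    simp only [orthSum, hyp, B.add_left, B.add_right, B.smul_left, B.smul_right, star_add,
      star_mul', star_sub, star_star, hst, B.skew z u]
    linear_combination (x1 * star y2 + x1 * star (B.form z u) + x1 * star y1 * t) * haa +
      (x1 * t * star y1 - x2 * star y1 - B.form w u * star y1) * hsaa + x1 * star y1 * h2t
  · rw [he]
    ext
    · simp
    · simp [B.zero_left]
    · simp
  · rw [he]
    ext
    · simp
    · simp [B.zero_left, hsaa]
    · simp

end SkewHermForm

/-! ### Equidistribution over the skew elements -/

section Equidistribution

variable {R : Type*} [CommRing R] [StarRing R]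
variable {X Y : Type*}

theorem Nat.card_set_prod_left [Fintype X] [Finite Y] (S : Set (X × Y)) :
    Nat.card S = ∑ x, Nat.card {y | (x, y) ∈ S} := by
  rw [← Nat.card_sigma]
  exact Nat.card_congr
    { toFun := fun z => ⟨z.1.1, z.1.2, z.2⟩
      invFun := fun z => ⟨(z.1, z.2.1), z.2.2⟩
      left_inv := fun _ => rfl
      right_inv := fun _ => rfl }

theorem Nat.card_set_prod_right [Finite X] [Fintype Y] (S : Set (X × Y)) :
    Nat.card S = ∑ y, Nat.card {x | (x, y) ∈ S} := by
  rw [← Nat.card_sigma]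
  exact Nat.card_congr
    { toFun := fun z => ⟨z.1.2, z.1.1, z.2⟩
      invFun := fun z => ⟨(z.2.1, z.1), z.2.2⟩
      left_inv := fun _ => rfl
      right_inv := fun _ => rfl }

/-- All fibres of `f` on `P` over skew elements have the same cardinality. -/
def SkewEquidistributed (P : Set X) (f : X → R) : Prop :=
  ∀ c c' : R, star c = -c → star c' = -c' →
    Nat.card {x | x ∈ P ∧ f x = c} = Nat.card {x | x ∈ P ∧ f x = c'}

namespace SkewEquidistributed

theorem union [Finite X] {P Q : Set X} {f : X → R} (hP : SkewEquidistributed P f)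
    (hQ : SkewEquidistributed Q f) (hPQ : Disjoint P Q) : SkewEquidistributed (P ∪ Q) f := by
  have key : ∀ c, Nat.card {x | x ∈ P ∪ Q ∧ f x = c} =
      Nat.card {x | x ∈ P ∧ f x = c} + Nat.card {x | x ∈ Q ∧ f x = c} := fun c => by
    rw [Nat.card_coe_set_eq, Nat.card_coe_set_eq, Nat.card_coe_set_eq, ← Set.ncard_union_eq]
    · congr 1
      ext x
      simp only [Set.mem_ofPred_eq, Set.mem_union]
      tauto
    · exact Set.disjoint_left.mpr fun x h h' => Set.disjoint_left.mp hPQ h.1 h'.1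
  intro c c' hc hc'
  rw [key, key, hP c c' hc hc', hQ c c' hc hc']

theorem prod_left [Finite X] [Finite Y] {S : Set (X × Y)} {f : X × Y → R}
    (h : ∀ x, SkewEquidistributed {y | (x, y) ∈ S} fun y => f (x, y)) :
    SkewEquidistributed S f := by
  have := Fintype.ofFinite X
  intro c c' hc hc'
  rw [Nat.card_set_prod_left, Nat.card_set_prod_left]
  exact Finset.sum_congr rfl fun x _ => h x c c' hc hc'

theorem prod_right [Finite X] [Finite Y] {S : Set (X × Y)} {f : X × Y → R}
    (h : ∀ y, SkewEquidistributed {x | (x, y) ∈ S} fun x => f (x, y)) :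
    SkewEquidistributed S f := by
  have := Fintype.ofFinite Y
  intro c c' hc hc'
  rw [Nat.card_set_prod_right, Nat.card_set_prod_right]
  exact Finset.sum_congr rfl fun x _ => h x c c' hc hc'

theorem add_const {P : Set X} {f : X → R} (h : SkewEquidistributed P f) {s : R}
    (hs : star s = -s) : SkewEquidistributed P fun x => f x + s := by
  intro c c' hc hc'
  have := h (c - s) (c' - s) (by rw [star_sub, hc, hs]; ring) (by rw [star_sub, hc', hs]; ring)
  simpa only [eq_sub_iff_add_eq] using this

theorem comp_equiv {P : Set Y} {f : Y → R} (h : SkewEquidistributed P f) (e : X ≃ Y) :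
    SkewEquidistributed {x | e x ∈ P} fun x => f (e x) := by
  have key : ∀ c, Nat.card {x | e x ∈ P ∧ f (e x) = c} = Nat.card {y | y ∈ P ∧ f y = c} :=
    fun c => Nat.card_congr (e.subtypeEquiv fun _ => Iff.rfl)
  intro c c' hc hc'
  exact (key c).trans ((h c c' hc hc').trans (key c').symm)

theorem empty (f : X → R) : SkewEquidistributed ∅ f := fun c c' _ _ => by simp

theorem card_eq_mul [Finite X] [Finite R] {P : Set X} {f : X → R} (h : SkewEquidistributed P f)
    (hf : ∀ x ∈ P, star (f x) = -f x) {c : R} (hc : star c = -c) :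
    Nat.card P = Nat.card {x : R | star x = -x} * Nat.card {x | x ∈ P ∧ f x = c} := by
  have := Fintype.ofFinite {x : R | star x = -x}
  have e : P ≃ Σ s : {x : R | star x = -x}, {x | x ∈ P ∧ f x = s} :=
    { toFun := fun x => ⟨⟨f x, hf x x.2⟩, x, x.2, rfl⟩
      invFun := fun z => ⟨z.2, z.2.2.1⟩
      left_inv := fun _ => rfl
      right_inv := by
        rintro ⟨⟨s, hs⟩, x, hx, hxs⟩
        obtain rfl : f x = s := hxs
        rfl }
  rw [Nat.card_congr e, Nat.card_sigma, Finset.sum_congr rfl fun s _ => h _ c s.2 hc,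
    Finset.sum_const, Finset.card_univ, ← Nat.card_eq_fintype_card, smul_eq_mul]

/-- Translation by the skew element (c' - c)/2 changes x - star x by c' - c, so it carries the fibre
over c to the fibre over c'. -/
theorem sub_star [Invertible (2 : R)] {P : Set R}
    (hP : ∀ x ∈ P, ∀ s, star s = -s → x + s ∈ P) :
    SkewEquidistributed P fun x => x - star x := by
  have h2 : (2 : R) * ⅟2 = 1 := mul_invOf_self 2
  have key : ∀ c c' : R, star c = -c → star c' = -c' → ∀ x, x ∈ P ∧ x - star x = c →
      x + ⅟2 * (c' - c) ∈ P ∧ (x + ⅟2 * (c' - c)) - star (x + ⅟2 * (c' - c)) = c' := by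
    rintro c c' hc hc' x ⟨hx, hxc⟩
    have hs : star (⅟2 * (c' - c)) = -(⅟2 * (c' - c)) := by
      rw [star_mul', SkewHermForm.star_invOf_two, star_sub, hc, hc']
      ring
    refine ⟨hP x hx _ hs, ?_⟩
    rw [star_add, hs]
    linear_combination hxc + (c' - c) * h2
  intro c c' hc hc'
  exact Nat.card_congr
    { toFun := fun x => ⟨_, key c c' hc hc' x x.2⟩
      invFun := fun x => ⟨_, key c' c hc' hc x x.2⟩
      left_inv := fun x => Subtype.ext (by simp only; ring)
      right_inv := fun x => Subtype.ext (by simp only; ring) }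

end SkewEquidistributed

end Equidistribution

/-! ### Ramified quotient rings -/

/-- A quotient by an even power of the uniformizer of the ring of integers of a ramified quadratic
extension, with its involution and the image `π` of the uniformizer. -/
structure IsRamifiedQuotient (R : Type*) [CommRing R] [StarRing R] (π : R) : Prop where
  nontrivial : Nontrivial R
  star_π : star π = -π
  isUnit_two : IsUnit (2 : R)
  isUnit_or_dvd : ∀ x, IsUnit x ∨ π ∣ x
  dvd_sub_star : ∀ x, π ∣ x - star x
  isNilpotent_π : IsNilpotent π
  -- This is where the even exponent enters: the annihilator of π in O_F/π^{2d} is generated by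
  -- π^{2d-1} and consists of skew elements, so it contains no nonzero fixed element.
  eq_zero_of_mul : ∀ y, star y = y → π * y = 0 → y = 0

namespace IsRamifiedQuotient

variable {R : Type*} [CommRing R] [StarRing R] {π : R}

theorem not_isUnit_π (h : IsRamifiedQuotient R π) : ¬ IsUnit π := fun hu => by
  have := h.nontrivial
  exact h.isNilpotent_π.not_isUnit hu

theorem not_isUnit_iff (h : IsRamifiedQuotient R π) {x : R} : ¬ IsUnit x ↔ π ∣ x :=
  ⟨(h.isUnit_or_dvd x).resolve_left, fun hd hu => h.not_isUnit_π (isUnit_of_dvd_unit hd hu)⟩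

theorem π_ne_zero (h : IsRamifiedQuotient R π) : π ≠ 0 := fun h0 => by
  have := h.nontrivial
  exact one_ne_zero (h.eq_zero_of_mul 1 (star_one R) (by rw [h0, zero_mul]))

theorem dvd_of_star_eq_neg (h : IsRamifiedQuotient R π) {x : R} (hx : star x = -x) : π ∣ x := by
  have := h.dvd_sub_star x
  rw [hx, sub_neg_eq_add, ← two_mul] at this
  exact (h.isUnit_two.dvd_mul_left).mp this

variable [Invertible (2 : R)]

/-- The map x ↦ x - star x has fibres of equal size over all skew elements, and its fibre over 0 is
the set of fixed elements. -/
theorem _root_.Nat.card_eq_skew_mul_symm [Finite R] :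
    Nat.card R = Nat.card {x : R | star x = -x} * Nat.card {x : R | star x = x} := by
  have := (SkewEquidistributed.sub_star (R := R) (P := Set.univ) fun _ _ _ _ => trivial).card_eq_mul
    (fun x _ => by rw [star_sub, star_star, neg_sub]) (c := 0) (by simp)
  have h0 : {x : R | x ∈ Set.univ ∧ x - star x = 0} = {x | star x = x} := by
    ext x
    simp only [Set.mem_univ, true_and, Set.mem_ofPred_eq, sub_eq_zero]
    exact eq_comm
  rwa [h0, Nat.card_congr (Equiv.Set.univ R)] at this

/-- Multiplication by π is a bijection from fixed to skew elements. Injectivity is `eq_zero_of_mul`;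
a skew element is πz, where z may be replaced by its fixed part (z + star z)/2. -/
theorem card_star_eq_self (h : IsRamifiedQuotient R π) :
    Nat.card {x : R | star x = x} = Nat.card {x : R | star x = -x} := by
  have h2 : (2 : R) * ⅟2 = 1 := mul_invOf_self 2
  refine Nat.card_eq_of_bijective (fun x => (⟨π * x, ?_⟩ : {x : R | star x = -x})) ⟨?_, ?_⟩
  · have := x.2
    simp only [Set.mem_ofPred_eq] at this ⊢
    rw [star_mul', h.star_π, this, neg_mul]
  · rintro ⟨x, hx⟩ ⟨y, hy⟩ hxy
    refine Subtype.ext (sub_eq_zero.mp (h.eq_zero_of_mul _ ?_ ?_))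
    · rw [star_sub, hx, hy]
    · rw [mul_sub, sub_eq_zero]
      exact congrArg Subtype.val hxy
  · rintro ⟨x, hx⟩
    simp only [Set.mem_ofPred_eq] at hx
    obtain ⟨z, rfl⟩ := h.dvd_of_star_eq_neg hx
    rw [star_mul', h.star_π] at hx
    refine ⟨⟨⅟2 * (z + star z), ?_⟩, Subtype.ext ?_⟩
    · simp only [Set.mem_ofPred_eq, star_mul', SkewHermForm.star_invOf_two, star_add, star_star]
      ring
    · simp only
      linear_combination π * z * h2 - ⅟2 * hx

end IsRamifiedQuotient

/-! ### Unimodular vectors: Witt's theorem and distribution of values -/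

namespace SkewHermForm

section IsUnimodular

variable {R : Type*} [CommRing R]

/-- Some coordinate of the vector is a unit. -/
def IsUnimodular {m : ℕ} (x : Fin m → R × R) : Prop := ∃ i, IsUnit (x i).1 ∨ IsUnit (x i).2

theorem isUnimodular_succ_iff {m : ℕ} (x : Fin (m + 1) → R × R) :
    IsUnimodular x ↔ (IsUnit (x 0).1 ∨ IsUnit (x 0).2) ∨ IsUnimodular ((0 : Fin (m + 1)).removeNth x) := by
  simp [IsUnimodular, Fin.exists_fin_succ, Fin.removeNth]

/-- The complement consists of the vectors all of whose 2m hyperbolic coordinates are nonunits. -/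
theorem card_isUnimodular [Finite R] {U : Type*} [Finite U] (m : ℕ) :
    Nat.card {x : (Fin m → R × R) × U | IsUnimodular x.1} +
      Nat.card {x : R | ¬ IsUnit x} ^ (2 * m) * Nat.card U =
      Nat.card R ^ (2 * m) * Nat.card U := by
  have h1 : Nat.card ({x : (Fin m → R × R) × U | IsUnimodular x.1}ᶜ : Set _) =
      Nat.card {x : R | ¬ IsUnit x} ^ (2 * m) * Nat.card U := by
    have e : ({x : (Fin m → R × R) × U | IsUnimodular x.1}ᶜ : Set _) ≃
        (Fin m → {x : R | ¬ IsUnit x} × {x : R | ¬ IsUnit x}) × U :=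
      { toFun := fun x => (fun i => (⟨(x.1.1 i).1, fun h => x.2 ⟨i, Or.inl h⟩⟩,
          ⟨(x.1.1 i).2, fun h => x.2 ⟨i, Or.inr h⟩⟩), x.1.2)
        invFun := fun y => ⟨(fun i => ((y.1 i).1, (y.1 i).2), y.2), by
          rintro ⟨i, h | h⟩
          exacts [(y.1 i).1.2 h, (y.1 i).2.2 h]⟩
        left_inv := fun _ => rfl
        right_inv := fun _ => rfl }
    rw [Nat.card_congr e, Nat.card_prod, Nat.card_fun, Nat.card_prod, Nat.card_fin, pow_mul, sq]
  have h2 : Nat.card ((Fin m → R × R) × U) = Nat.card R ^ (2 * m) * Nat.card U := by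
    rw [Nat.card_prod, Nat.card_fun, Nat.card_prod, Nat.card_fin, pow_mul, sq]
  rw [← h1, ← h2, Nat.card_coe_set_eq, Nat.card_coe_set_eq]
  exact Set.ncard_add_ncard_compl _

end IsUnimodular

variable {R : Type*} [CommRing R] [StarRing R]
variable {V : Type*} [AddCommGroup V] [Module R V]
variable {W : Type*} [AddCommGroup W] [Module R W]
variable {U : Type*} [AddCommGroup U] [Module R U]

/-- Witt's theorem for unimodular vectors in `H ^ (m + 1) ⊥ U`. -/
theorem exists_isIsometry_of_isUnimodular [Invertible (2 : R)] (C : SkewHermForm R U) {m : ℕ}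
    (v : (Fin (m + 1) → R × R) × U) (hv : IsUnimodular v.1) :
    ∃ e, IsIsometry (((hyp R).orthPow (m + 1)).orthSum C)
        ((hyp R).orthSum (((hyp R).orthPow m).orthSum C)) e ∧
      e v = ((1, -⅟2 * (((hyp R).orthPow (m + 1)).orthSum C).form v v), 0) := by
  obtain ⟨i, hi⟩ := hv
  let e₁ := ((removeNthEquiv (R := R) (R × R) i).prodCongr (LinearEquiv.refl R U)).trans
    (LinearEquiv.prodAssoc R (R × R) (Fin m → R × R) U)
  have h₁ : IsIsometry (((hyp R).orthPow (m + 1)).orthSum C)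
      ((hyp R).orthSum (((hyp R).orthPow m).orthSum C)) e₁ :=
    ((isIsometry_removeNthEquiv (hyp R) i).prodCongr (isIsometry_refl C)).trans
      (isIsometry_prodAssoc _ _ _)
  obtain ⟨e₂, h₂, hu⟩ : ∃ e₂, IsIsometry (((hyp R).orthPow (m + 1)).orthSum C)
      ((hyp R).orthSum (((hyp R).orthPow m).orthSum C)) e₂ ∧ IsUnit (e₂ v).1.1 := by
    rcases hi with hi | hi
    · exact ⟨e₁, h₁, hi⟩
    -- A unit in the second coordinate of the plane is brought to the first one by (a, b) ↦ (b, -a).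
    · exact ⟨_, h₁.trans (isIsometry_hypSwap.prodCongr (isIsometry_refl _)), hi⟩
  obtain ⟨e₃, h₃, h₄, -⟩ := exists_isIsometry_hyp_orthSum _ (e₂ v) hu
  refine ⟨_, h₂.trans h₃.symm, ?_⟩
  rw [LinearEquiv.trans_apply, LinearEquiv.symm_apply_eq, ← h₂, h₄]

/-- The substitution x = a · star b, a bijection because b is a unit, reduces this to
`SkewEquidistributed.sub_star`. -/
theorem skewEquidistributed_mul_star [Invertible (2 : R)] {P : Set R}
    (hP : ∀ x ∈ P, ∀ s, star s = -s → x + s ∈ P) (b : R) (hb : IsUnit b) :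
    SkewEquidistributed {a | a * star b ∈ P} fun a => a * star b - b * star a := by
  have hb' : IsUnit (star b) := hb.star
  have := (SkewEquidistributed.sub_star hP).comp_equiv (Units.mulRight hb'.unit)
  have h : ∀ a : R, (Units.mulRight hb'.unit : R ≃ R) a = a * star b := fun _ => rfl
  simp only [h, star_mul', star_star, mul_comm (star _) b] at this
  exact this

variable {π : R}

/-- If the first coordinate is a unit, it is fixed and the second one varies freely. Otherwise the
second coordinate is a unit and is fixed, while the first varies in (π), which is stable under skew
translations because skew elements lie in (π). -/
theorem skewEquidistributed_hyp [Invertible (2 : R)] [Finite R] (hR : IsRamifiedQuotient R π) :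
    SkewEquidistributed {x : R × R | IsUnit x.1 ∨ IsUnit x.2} fun x => (hyp R).form x x := by
  have h : {x : R × R | IsUnit x.1 ∨ IsUnit x.2} =
      {x : R × R | IsUnit x.1} ∪ {x : R × R | ¬ IsUnit x.1 ∧ IsUnit x.2} := by
    ext x
    simp only [Set.mem_ofPred_eq, Set.mem_union]
    tauto
  rw [h]
  refine .union (.prod_left fun a => ?_) (.prod_right fun b => ?_)
    (Set.disjoint_left.mpr fun x hx hx' => hx'.1 hx)
  · by_cases ha : IsUnit a
    · have := skewEquidistributed_mul_star (P := Set.univ) (fun _ _ _ _ => trivial) a ha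
      intro c c' hc hc'
      have key : ∀ c : R, Nat.card {y : R | y ∈ {y : R | (a, y) ∈ {x : R × R | IsUnit x.1}} ∧
          (hyp R).form (a, y) (a, y) = c} = Nat.card {x | x ∈ {y : R | y * star a ∈ Set.univ} ∧
            x * star a - a * star x = -c} := fun c => by
        congr 2
        ext y
        simp only [Set.mem_ofPred_eq, ha, Set.mem_univ, hyp, true_and]
        rw [← neg_sub, neg_eq_iff_eq_neg]
      rw [key, key]
      exact this _ _ (by rw [star_neg, hc]) (by rw [star_neg, hc'])
    · simpa [ha] using SkewEquidistributed.empty _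
  · by_cases hb : IsUnit b
    · have := skewEquidistributed_mul_star (P := {x : R | π ∣ x})
        (fun x hx s hs => dvd_add hx (hR.dvd_of_star_eq_neg hs)) b hb
      have h' : {a : R | a * star b ∈ {x : R | π ∣ x}} =
          {a | (a, b) ∈ {x : R × R | ¬ IsUnit x.1 ∧ IsUnit x.2}} := by
        ext a
        simp only [Set.mem_ofPred_eq, hb, and_true, hR.not_isUnit_iff, hb.star.dvd_mul_right]
      rw [h'] at this
      exact this
    · simpa [hb] using SkewEquidistributed.empty _

/-- By induction. If the first plane component is unimodular, the other components are fixed and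
shift the value by a skew constant; otherwise the first component is fixed and the remaining ones
are unimodular. -/
theorem skewEquidistributed_hyp_orthPow [Invertible (2 : R)] [Finite R]
    (hR : IsRamifiedQuotient R π) (m : ℕ) :
    SkewEquidistributed {x : Fin m → R × R | IsUnimodular x}
      fun x => ((hyp R).orthPow m).form x x := by
  induction m with
  | zero =>
    have h : {x : Fin 0 → R × R | IsUnimodular x} = ∅ := by
      ext x
      simp [IsUnimodular]
    rw [h]
    exact SkewEquidistributed.empty _
  | succ m ih =>
    have key : SkewEquidistributed
        ({x : (R × R) × (Fin m → R × R) | IsUnit x.1.1 ∨ IsUnit x.1.2} ∪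
          {x | ¬ (IsUnit x.1.1 ∨ IsUnit x.1.2) ∧ IsUnimodular x.2})
        fun x => ((hyp R).orthSum ((hyp R).orthPow m)).form x x := by
      refine .union (.prod_right fun y => ?_) (.prod_left fun x => ?_)
        (Set.disjoint_left.mpr fun x hx hx' => hx'.1 hx)
      · exact (skewEquidistributed_hyp hR).add_const (R := R) (star_form_self ((hyp R).orthPow m) y)
      · by_cases hx : IsUnit x.1 ∨ IsUnit x.2
        · simp only [Set.mem_ofPred_eq, hx, not_true, false_and]
          exact SkewEquidistributed.empty (R := R) _
        · have := ih.add_const (star_form_self (hyp R) x)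
          simp only [add_comm _ ((hyp R).form x x)] at this
          simp only [Set.mem_ofPred_eq, hx, not_false_iff, true_and]
          exact this
    have := key.comp_equiv (removeNthEquiv (R := R) (R × R) (0 : Fin (m + 1))).toEquiv
    have h : {x : Fin (m + 1) → R × R | IsUnimodular x} = {x | (removeNthEquiv (R := R) (R × R)
        (0 : Fin (m + 1))).toEquiv x ∈
        ({x : (R × R) × (Fin m → R × R) | IsUnit x.1.1 ∨ IsUnit x.1.2} ∪
          {x | ¬ (IsUnit x.1.1 ∨ IsUnit x.1.2) ∧ IsUnimodular x.2})} := by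
      ext x
      simp only [Set.mem_ofPred_eq, isUnimodular_succ_iff, Set.mem_union]
      change _ ↔ ((IsUnit (x 0).1 ∨ IsUnit (x 0).2) ∨ ¬ (IsUnit (x 0).1 ∨ IsUnit (x 0).2) ∧
        IsUnimodular ((0 : Fin (m + 1)).removeNth x))
      tauto
    rw [h]
    have h' : (fun x : Fin (m + 1) → R × R => ((hyp R).orthPow (m + 1)).form x x) = fun x =>
        ((hyp R).orthSum ((hyp R).orthPow m)).form ((removeNthEquiv (R := R) (R × R)
          (0 : Fin (m + 1))).toEquiv x) ((removeNthEquiv (R := R) (R × R)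
          (0 : Fin (m + 1))).toEquiv x) := by
      funext x
      exact (isIsometry_removeNthEquiv (hyp R) 0 x x).symm
    rw [h']
    exact this

theorem skewEquidistributed_hyp_orthPow_orthSum [Invertible (2 : R)] [Finite R] [Finite U]
    (hR : IsRamifiedQuotient R π) (m : ℕ) (C : SkewHermForm R U) :
    SkewEquidistributed {x : (Fin m → R × R) × U | IsUnimodular x.1}
      fun x => (((hyp R).orthPow m).orthSum C).form x x :=
  .prod_right fun u => (skewEquidistributed_hyp_orthPow hR m).add_const (star_form_self C u)

/-- If `j` is an isometric embedding, then isometric maps with values in its range are isometric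
maps to its source. -/
theorem card_isometricMaps_range {B : SkewHermForm R V} {B' : SkewHermForm R W}
    (j : W →ₗ[R] V) (hj : Function.Injective j) (hB : ∀ x y, B.form (j x) (j y) = B'.form x y)
    (C : SkewHermForm R U) :
    Nat.card {T : isometricMaps B C | ∀ x, T.1 x ∈ LinearMap.range j} =
      Nat.card (isometricMaps B' C) := by
  let e := LinearEquiv.ofInjective j hj
  have he : ∀ y, j (e.symm y) = y := fun y => congrArg Subtype.val (e.apply_symm_apply y)
  exact Nat.card_congr
    { toFun := fun T => ⟨e.symm.toLinearMap ∘ₗ T.1.1.codRestrict _ T.2, fun x y => by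
        rw [← hB]
        simp only [LinearMap.comp_apply, LinearEquiv.coe_coe, he]
        exact T.1.2 x y⟩
      invFun := fun T => ⟨⟨j ∘ₗ T.1, fun x y => (hB _ _).trans (T.2 x y)⟩,
        fun x => LinearMap.mem_range_self _ _⟩
      left_inv := fun T => by
        ext x
        simp [he]
      right_inv := fun T => by
        ext x
        apply hj
        simp [he] }

end SkewHermForm

/-! ### Splitting a line or a hyperbolic plane off the source -/

namespace SkewHermForm

variable {R : Type*} [CommRing R] [StarRing R]
variable {V : Type*} [AddCommGroup V] [Module R V]
variable {W : Type*} [AddCommGroup W] [Module R W]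
variable {U : Type*} [AddCommGroup U] [Module R U]

/-- Isometric maps from an orthogonal sum are pairs of isometric maps with orthogonal images. -/
theorem card_isometricMaps_orthSum {B : SkewHermForm R V} {B' : SkewHermForm R W}
    {B'' : SkewHermForm R U} [Finite V] [Finite W] [Finite U] {N : ℕ}
    (h : ∀ S ∈ isometricMaps B B'',
      Nat.card {T : isometricMaps B B' | ∀ x y, B.form (T.1 x) (S y) = 0} = N) :
    Nat.card (isometricMaps B (B'.orthSum B'')) = Nat.card (isometricMaps B B'') * N := by
  have : Finite (U →ₗ[R] V) := DFunLike.finite _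
  have : Finite (W →ₗ[R] V) := DFunLike.finite _
  have := Fintype.ofFinite (isometricMaps B B'')
  have e : isometricMaps B (B'.orthSum B'') ≃ Σ S : isometricMaps B B'',
      {T : isometricMaps B B' | ∀ x y, B.form (T.1 x) (S.1 y) = 0} :=
    { toFun := fun T => ⟨⟨T.1 ∘ₗ LinearMap.inr R W U, fun x y => by
          simpa [orthSum, B'.zero_left] using T.2 (0, x) (0, y)⟩,
        ⟨T.1 ∘ₗ LinearMap.inl R W U, fun x y => by
          simpa [orthSum, B''.zero_left] using T.2 (x, 0) (y, 0)⟩, fun x y => by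
          simpa [orthSum, B'.zero_right, B''.zero_left] using T.2 (x, 0) (0, y)⟩
      invFun := fun z => ⟨LinearMap.coprod z.2.1.1 z.1.1, fun x y => by
        have h1 : B.form (z.2.1.1 x.1) (z.1.1 y.2) = 0 := z.2.2 x.1 y.2
        have h2 : B.form (z.1.1 x.2) (z.2.1.1 y.1) = 0 := by
          rw [B.skew (z.2.1.1 y.1), z.2.2 y.1 x.2, star_zero, neg_zero]
        have h3 := z.2.1.2 x.1 y.1
        have h4 := z.1.2 x.2 y.2
        simp only [LinearMap.coprod_apply, B.add_left, B.add_right, orthSum, h1, h2, h3, h4,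
          add_zero, zero_add]⟩
      left_inv := fun T => Subtype.ext (LinearMap.coprod_comp_inl_inr T.1)
      right_inv := fun z =>
        Sigma.subtype_ext (Subtype.ext (LinearMap.coprod_inr _ _))
          (Subtype.ext (LinearMap.coprod_inl _ _)) }
  rw [Nat.card_congr e, Nat.card_sigma, Finset.sum_congr rfl fun S _ => h S.1 S.2,
    Finset.sum_const, Finset.card_univ, ← Nat.card_eq_fintype_card, smul_eq_mul]

theorem card_isometricMaps_line (B : SkewHermForm R V) {s : R} (hs : star s = -s) :
    Nat.card (isometricMaps B (line s hs)) = Nat.card {v | B.form v v = s} :=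
  Nat.card_congr
    { toFun := fun T => ⟨T.1 1, by
        have := T.2 1 1
        simpa [line] using this⟩
      invFun := fun v => ⟨LinearMap.toSpanSingleton R V v, fun x y => by
        have := v.2
        simp only [Set.mem_ofPred_eq] at this
        simp only [LinearMap.toSpanSingleton_apply, B.smul_left, B.smul_right, this, line]
        ring⟩
      left_inv := fun T => by
        ext
        simp
      right_inv := fun v => by
        ext
        simp }

theorem card_isometricMaps_hyp (B : SkewHermForm R V) :
    Nat.card (isometricMaps B (hyp R)) =
      Nat.card {z : V × V | B.form z.1 z.1 = 0 ∧ B.form z.2 z.2 = 0 ∧ B.form z.1 z.2 = 1} :=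
  Nat.card_congr
    { toFun := fun T => ⟨(T.1 (1, 0), T.1 (0, 1)), by
        refine ⟨?_, ?_, ?_⟩ <;> simp only [T.2 _ _] <;> simp [hyp]⟩
      invFun := fun z => ⟨LinearMap.coprod (LinearMap.toSpanSingleton R V z.1.1)
        (LinearMap.toSpanSingleton R V z.1.2), fun x y => by
        obtain ⟨h1, h2, h3⟩ := z.2
        have h4 : B.form z.1.2 z.1.1 = -1 := by rw [B.skew z.1.1, h3, star_one]
        simp only [LinearMap.coprod_apply, LinearMap.toSpanSingleton_apply, B.add_left,
          B.add_right, B.smul_left, B.smul_right, h1, h2, h3, h4, hyp]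
        ring⟩
      left_inv := fun T => by
        ext <;> simp
      right_inv := fun z => by
        ext <;> simp }

variable {π : R}

/-- The generator of the line goes to a vector of value -π, which Witt's theorem moves to (1, π/2)
in the first plane. Its orthogonal complement in that plane is spanned by (1, -π/2), of value π. So
the complement in the whole space is always H^m ⊥ C ⊥ ⟨π⟩, embedded by `j`, and the number of maps
on the other summand does not depend on the vector. -/
theorem card_isometricMaps_orthSum_line [Invertible (2 : R)] [Finite R] [Finite U] [Finite W]
    (C : SkewHermForm R U) (B' : SkewHermForm R W) (m : ℕ) (hπ : star π = -π)
    (hπ' : star (-π) = - -π)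
    (hprim : ∀ v, (((hyp R).orthPow (m + 1)).orthSum C).form v v = -π → IsUnimodular v.1) :
    Nat.card (isometricMaps (((hyp R).orthPow (m + 1)).orthSum C) (B'.orthSum (line (-π) hπ'))) =
      Nat.card {v | (((hyp R).orthPow (m + 1)).orthSum C).form v v = -π} *
      Nat.card (isometricMaps ((((hyp R).orthPow m).orthSum C).orthSum (line π hπ)) B') := by
  rw [← card_isometricMaps_line _ hπ']
  refine card_isometricMaps_orthSum fun S hS => ?_
  set B := ((hyp R).orthPow (m + 1)).orthSum C with hB
  set N := ((hyp R).orthPow m).orthSum C with hN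
  have h2 : (2 : R) * ⅟2 = 1 := mul_invOf_self 2
  have hv : B.form (S 1) (S 1) = -π := by
    rw [hS]
    simp [line]
  obtain ⟨e, he, hev⟩ := exists_isIsometry_of_isUnimodular C (S 1) (hprim _ hv)
  rw [← hB, hv] at hev
  replace he : IsIsometry B ((hyp R).orthSum N) e := he
  let j : (((Fin m → R × R) × U) × R) →ₗ[R] ((R × R) × ((Fin m → R × R) × U)) :=
    { toFun := fun z => ((z.2, -⅟2 * π * z.2), z.1)
      map_add' := fun x y => by
        ext1
        · ext1
          · rfl
          · exact mul_add _ _ _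
        · rfl
      map_smul' := fun a x => by
        ext1
        · ext1
          · rfl
          · simp only [Prod.smul_snd, smul_eq_mul, RingHom.id_apply, Prod.smul_fst]
            ring
        · rfl }
  have hj : ∀ z, j z = ((z.2, -⅟2 * π * z.2), z.1) := fun _ => rfl
  have hj' : Function.Injective (e.symm.toLinearMap ∘ₗ j) := by
    refine e.symm.injective.comp fun x y hxy => ?_
    rw [hj, hj] at hxy
    simp only [Prod.mk.injEq] at hxy
    exact Prod.ext hxy.2 hxy.1.1
  rw [← card_isometricMaps_range (B := B) (e.symm.toLinearMap ∘ₗ j) hj']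
  · congr 2
    ext T
    simp only [Set.mem_ofPred_eq]
    refine forall_congr' fun x => ?_
    have hS1 : ∀ y, S y = y • S 1 := fun y => by rw [← S.map_smul, smul_eq_mul, mul_one]
    have h1 : (∀ y, B.form (T.1 x) (S y) = 0) ↔ B.form (T.1 x) (S 1) = 0 := by
      refine ⟨fun h => h 1, fun h y => ?_⟩
      rw [hS1, B.smul_right, h, mul_zero]
    rw [h1, ← he, hev, LinearMap.mem_range]
    have h3 : ((hyp R).orthSum N).form (e (T.1 x)) ((1, -⅟2 * -π), 0) =
        -(⅟2 * π * (e (T.1 x)).1.1 + (e (T.1 x)).1.2) := by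
      simp only [orthSum_form, hyp_form, N.zero_right, star_mul', star_neg, hπ, star_invOf_two, star_one]
      ring
    rw [h3]
    constructor
    · intro h
      refine ⟨((e (T.1 x)).2, (e (T.1 x)).1.1), ?_⟩
      rw [LinearMap.comp_apply, LinearEquiv.coe_coe, LinearEquiv.symm_apply_eq, hj]
      ext1
      · ext1
        · rfl
        · simp only
          linear_combination h
      · rfl
    · rintro ⟨z, hz⟩
      rw [LinearMap.comp_apply, LinearEquiv.coe_coe, LinearEquiv.symm_apply_eq, hj] at hz
      rw [← hz]
      ring
  · intro x y
    rw [LinearMap.comp_apply, LinearMap.comp_apply, LinearEquiv.coe_coe, he.symm, hj, hj]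
    simp only [orthSum_form, hyp_form, line, star_mul', star_neg, hπ, star_invOf_two]
    linear_combination x.2 * π * star y.2 * h2

/-- A hyperbolic pair splits off with complement H^m ⊥ C. Its first vector is unimodular, since C
only takes values in (π) and the pair has value 1. Once it is moved to (1, 0), the second vector is
(x, 1) + w with x - star x equal to minus the value of w; here w is free, and by equidistribution
there are as many x as fixed elements. -/
theorem card_isometricMaps_hyp_orthSum [Invertible (2 : R)] [Finite R] [Finite U] [Finite W]
    (hR : IsRamifiedQuotient R π) (C : SkewHermForm R U) (hC : ∀ u u', π ∣ C.form u u')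
    (B' : SkewHermForm R W) (m : ℕ) :
    Nat.card (isometricMaps (((hyp R).orthPow (m + 1)).orthSum C) (B'.orthSum (hyp R))) =
      Nat.card (isometricMaps (((hyp R).orthPow (m + 1)).orthSum C) (hyp R)) *
      Nat.card (isometricMaps (((hyp R).orthPow m).orthSum C) B') ∧
    Nat.card (isometricMaps (((hyp R).orthPow (m + 1)).orthSum C) (hyp R)) =
      Nat.card {v | v ∈ {x : (Fin (m + 1) → R × R) × U | IsUnimodular x.1} ∧
        (((hyp R).orthPow (m + 1)).orthSum C).form v v = 0} *
      (Nat.card ((Fin m → R × R) × U) * Nat.card {x : R | star x = x}) := by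
  have := hR.nontrivial
  set B := ((hyp R).orthPow (m + 1)).orthSum C with hB
  set N := ((hyp R).orthPow m).orthSum C with hN
  have hprim : ∀ v f, B.form v f = 1 → IsUnimodular v.1 := by
    intro v f h
    by_contra hv
    simp only [IsUnimodular, not_exists, not_or, hR.not_isUnit_iff] at hv
    refine hR.not_isUnit_π (isUnit_of_dvd_one ?_)
    rw [← h]
    refine dvd_add (Finset.dvd_sum (s := Finset.univ) (f := fun i => (hyp R).form (v.1 i) (f.1 i))
      fun i _ => ?_) (hC _ _)
    exact dvd_sub (Dvd.dvd.mul_right (hv i).1 _) (Dvd.dvd.mul_right (hv i).2 _)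
  have hfst : ∀ v f, B.form v v = 0 → B.form v f = 1 → ∃ e : _ ≃ₗ[R] _,
      IsIsometry B ((hyp R).orthSum N) e ∧ e v = ((1, 0), 0) := by
    intro v f h0 h1
    obtain ⟨e, he, hev⟩ := exists_isIsometry_of_isUnimodular C v (hprim v f h1)
    rw [← hB, h0, mul_zero] at hev
    exact ⟨e, he, hev⟩
  constructor
  · refine card_isometricMaps_orthSum fun S hS => ?_
    have h11 : B.form (S (1, 0)) (S (1, 0)) = 0 := by simp only [hS _ _]; simp [hyp]
    have h12 : B.form (S (1, 0)) (S (0, 1)) = 1 := by simp only [hS _ _]; simp [hyp]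
    have h22 : B.form (S (0, 1)) (S (0, 1)) = 0 := by simp only [hS _ _]; simp [hyp]
    obtain ⟨e₁, he₁, hev⟩ := hfst _ _ h11 h12
    -- The second vector of the pair must be straightened without moving the first. After the swap
    -- it has first coordinate 1, the first vector is minus the second basis vector of the plane,
    -- and the isometry of `exists_isIsometry_hyp_orthSum` fixes the latter.
    let w := hypSwap.prodCongr (LinearEquiv.refl R ((Fin m → R × R) × U))
    have hw : IsIsometry ((hyp R).orthSum N) ((hyp R).orthSum N) w :=
      isIsometry_hypSwap.prodCongr (isIsometry_refl N)
    have hf1 : (w (e₁ (S (0, 1)))).1.1 = 1 := by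
      rw [← he₁, hev] at h12
      have h : star (e₁ (S (0, 1))).1.2 = 1 := by
        simpa [orthSum_form, hyp_form, N.zero_left] using h12
      have h' := congrArg star h
      rw [star_star, star_one] at h'
      exact h'
    obtain ⟨e₂, he₂, hef, hev₂⟩ := exists_isIsometry_hyp_orthSum N (w (e₁ (S (0, 1))))
      (by rw [hf1]; exact isUnit_one)
    rw [hf1, star_one] at hev₂
    rw [hw, he₁, h22, mul_zero] at hef
    let e := e₁.trans ((w.trans e₂.symm).trans w.symm)
    have he : IsIsometry B ((hyp R).orthSum N) e := he₁.trans ((hw.trans he₂.symm).trans hw.symm)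
    have e10 : e (S (1, 0)) = ((1, 0), 0) := by
      simp only [e, LinearEquiv.trans_apply, LinearEquiv.symm_apply_eq, hev]
      have : w ((1, 0), 0) = -((0, 1), 0) := by
        simp [w, hypSwap]
      rw [this, map_neg, hev₂]
    have e01 : e (S (0, 1)) = ((0, 1), 0) := by
      simp only [e, LinearEquiv.trans_apply, LinearEquiv.symm_apply_eq]
      have : w ((0, 1), 0) = ((1, 0), 0) := by
        simp [w, hypSwap]
      rw [this, hef]
    have hj' : Function.Injective (e.symm.toLinearMap ∘ₗ
        LinearMap.inr R (R × R) ((Fin m → R × R) × U)) :=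
      e.symm.injective.comp LinearMap.inr_injective
    rw [← card_isometricMaps_range (B := B) _ hj']
    · congr 2
      ext T
      simp only [Set.mem_ofPred_eq]
      refine forall_congr' fun x => ?_
      have hS1 : ∀ y, S y = y.1 • S (1, 0) + y.2 • S (0, 1) := fun y => by
        rw [← S.map_smul, ← S.map_smul, ← S.map_add]
        simp
      have h1 : (∀ y, B.form (T.1 x) (S y) = 0) ↔
          B.form (T.1 x) (S (1, 0)) = 0 ∧ B.form (T.1 x) (S (0, 1)) = 0 := by
        refine ⟨fun h => ⟨h _, h _⟩, fun h y => ?_⟩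
        rw [hS1, B.add_right, B.smul_right, B.smul_right, h.1, h.2, mul_zero, mul_zero, add_zero]
      rw [h1, ← he, ← he, e10, e01, LinearMap.mem_range]
      have h3 : ((hyp R).orthSum N).form (e (T.1 x)) ((1, 0), 0) = -(e (T.1 x)).1.2 := by
        simp [orthSum_form, hyp_form, N.zero_right]
      have h4 : ((hyp R).orthSum N).form (e (T.1 x)) ((0, 1), 0) = (e (T.1 x)).1.1 := by
        simp [orthSum_form, hyp_form, N.zero_right]
      rw [h3, h4, neg_eq_zero]
      constructor
      · intro h
        refine ⟨(e (T.1 x)).2, ?_⟩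
        rw [LinearMap.comp_apply, LinearEquiv.coe_coe, LinearEquiv.symm_apply_eq]
        ext1
        · ext1
          · exact h.2.symm
          · exact h.1.symm
        · rfl
      · rintro ⟨z, hz⟩
        rw [LinearMap.comp_apply, LinearEquiv.coe_coe, LinearEquiv.symm_apply_eq] at hz
        rw [← hz]
        exact ⟨rfl, rfl⟩
    · intro x y
      rw [LinearMap.comp_apply, LinearMap.comp_apply, LinearEquiv.coe_coe, he.symm]
      simp [orthSum, (hyp R).zero_left]
  · rw [card_isometricMaps_hyp]
    have := Fintype.ofFinite {v | v ∈ {x : (Fin (m + 1) → R × R) × U | IsUnimodular x.1} ∧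
        B.form v v = 0}
    have e : {z : ((Fin (m + 1) → R × R) × U) × ((Fin (m + 1) → R × R) × U) |
          B.form z.1 z.1 = 0 ∧ B.form z.2 z.2 = 0 ∧ B.form z.1 z.2 = 1} ≃
        Σ v : {v | v ∈ {x : (Fin (m + 1) → R × R) × U | IsUnimodular x.1} ∧ B.form v v = 0},
          {f | B.form f f = 0 ∧ B.form v f = 1} :=
      { toFun := fun z => ⟨⟨z.1.1, hprim _ _ z.2.2.2, z.2.1⟩, z.1.2, z.2.2⟩
        invFun := fun z => ⟨(z.1, z.2), z.1.2.2, z.2.2⟩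
        left_inv := fun _ => rfl
        right_inv := fun _ => rfl }
    rw [Nat.card_congr e, Nat.card_sigma]
    have hcard : ∀ v : {v | v ∈ {x : (Fin (m + 1) → R × R) × U | IsUnimodular x.1} ∧
        B.form v v = 0}, Nat.card {f | B.form f f = 0 ∧ B.form v f = 1} =
        Nat.card ((Fin m → R × R) × U) * Nat.card {x : R | star x = x} := by
      rintro ⟨v, hv, h0⟩
      obtain ⟨e, he, hev⟩ := exists_isIsometry_of_isUnimodular C v hv
      rw [← hB, h0, mul_zero] at hev
      replace he : IsIsometry B ((hyp R).orthSum N) e := he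
      have := Fintype.ofFinite ((Fin m → R × R) × U)
      have E : {f | B.form f f = 0 ∧ B.form v f = 1} ≃ Σ w : (Fin m → R × R) × U,
          {x : R | x ∈ Set.univ ∧ x - star x = -N.form w w} :=
        { toFun := fun f => ⟨(e f).2, (e f).1.1, trivial, by
            obtain ⟨f, h1, h2⟩ := f
            rw [← he, hev] at h2
            rw [← he] at h1
            have h : star (e f).1.2 = 1 := by
              simpa [orthSum_form, hyp_form, N.zero_left] using h2
            have h' := congrArg star h
            rw [star_star, star_one] at h'
            simp only [orthSum_form, hyp_form, h', star_one] at h1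
            simp only
            linear_combination h1⟩
          invFun := fun z => ⟨e.symm ((z.2, 1), z.1), by
            obtain ⟨w, x, -, hx⟩ := z
            refine ⟨?_, ?_⟩
            · rw [he.symm]
              simp only [orthSum_form, hyp_form, star_one]
              linear_combination hx
            · rw [← he, hev, LinearEquiv.apply_symm_apply]
              simp [orthSum_form, hyp_form, N.zero_left]⟩
          left_inv := fun f => by
            obtain ⟨f, h1, h2⟩ := f
            rw [← he, hev] at h2
            have h : star (e f).1.2 = 1 := by
              simpa [orthSum_form, hyp_form, N.zero_left] using h2
            have h' := congrArg star h
            rw [star_star, star_one] at h'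
            refine Subtype.ext ?_
            rw [LinearEquiv.symm_apply_eq]
            ext1
            · ext1
              · rfl
              · exact h'.symm
            · rfl
          right_inv := fun z => Sigma.subtype_ext (by simp) (by simp) }
      have hsub := SkewEquidistributed.sub_star (R := R) (P := Set.univ) fun _ _ _ _ => trivial
      have h0 : {x : R | x ∈ Set.univ ∧ x - star x = 0} = {x | star x = x} := by
        ext x
        simp only [Set.mem_univ, true_and, Set.mem_ofPred_eq, sub_eq_zero]
        exact eq_comm
      rw [Nat.card_congr E, Nat.card_sigma, Finset.sum_congr rfl fun w _ =>
        hsub (-N.form w w) 0 (by rw [star_neg, star_form_self]) (by simp), Finset.sum_const,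
        Finset.card_univ, ← Nat.card_eq_fintype_card, smul_eq_mul, h0]
    rw [Finset.sum_congr rfl fun v _ => hcard v, Finset.sum_const,
        Finset.card_univ, ← Nat.card_eq_fintype_card, smul_eq_mul]

end SkewHermForm

/-! ### Elements of norm one and isometries of a line -/

namespace IsRamifiedQuotient

variable {R : Type*} [CommRing R] [StarRing R] {π : R}

theorem isNilpotent_of_dvd (hR : IsRamifiedQuotient R π) {x : R} (h : π ∣ x) : IsNilpotent x := by
  obtain ⟨y, rfl⟩ := h
  exact (Commute.all π y).isNilpotent_mul_right hR.isNilpotent_π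

/-- Hensel's lemma at 1 gives a unique root r with 1 - r nilpotent, and uniqueness makes it fixed by
the involution. For any root a, the product (1 - a)(1 + a) = 1 - c is a nonunit, so a or -a is r;
the two differ because 2 is a unit. -/
theorem card_sq_eq (hR : IsRamifiedQuotient R π) {c : R} (hc : star c = c)
    (hc1 : IsNilpotent (1 - c)) : Nat.card {a : R | star a = a ∧ a ^ 2 = c} = 2 := by
  have := hR.nontrivial
  have hnu : ∀ {x : R}, ¬ IsUnit x ↔ IsNilpotent x := fun {x} =>
    ⟨fun h => hR.isNilpotent_of_dvd (hR.not_isUnit_iff.mp h), fun h => h.not_isUnit⟩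
  obtain ⟨r, ⟨hr1, hr2⟩, hr3⟩ := existsUnique_nilpotent_sub_and_aeval_eq_zero (R := R) (S := R)
    (P := X ^ 2 - C c) (x := 1) (by simpa using hc1) (by simpa [one_add_one_eq_two] using hR.isUnit_two)
  have hroot : ∀ a : R, aeval a (X ^ 2 - C c) = a ^ 2 - c := fun a => by simp
  simp only [hroot, sub_eq_zero] at hr2 hr3
  have hsr : star r = r := hr3 _ ⟨by
    have h := hr1
    obtain ⟨k, hk⟩ := h
    refine ⟨k, ?_⟩
    rw [← star_one R, ← star_sub, ← star_pow, hk, star_zero], by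
    rw [← star_pow, hr2, hc]⟩
  have hset : {a : R | star a = a ∧ a ^ 2 = c} = {r, -r} := by
    ext a
    simp only [Set.mem_ofPred_eq, Set.mem_insert_iff, Set.mem_singleton_iff]
    constructor
    · rintro ⟨ha, hac⟩
      have hprod : ¬ IsUnit ((1 - a) * (1 + a)) := by
        rw [hnu, show (1 - a) * (1 + a) = 1 - c by rw [← hac]; ring]
        exact hc1
      rw [IsUnit.mul_iff, not_and_or] at hprod
      rcases hprod with h | h
      · exact Or.inl (hr3 a ⟨hnu.mp h, hac⟩)
      · right
        rw [← hr3 (-a) ⟨by rw [sub_neg_eq_add]; exact hnu.mp h, by rw [neg_sq, hac]⟩, neg_neg]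
    · rintro (rfl | rfl)
      · exact ⟨hsr, hr2⟩
      · exact ⟨by rw [star_neg, hsr], by rw [neg_sq, hr2]⟩
  rw [hset, Nat.card_coe_set_eq, Set.ncard_pair]
  intro h
  have h2 : (2 : R) * r = 0 := by linear_combination h
  have h0 : r = 0 := (hR.isUnit_two.mul_right_eq_zero).mp h2
  rw [h0, sub_zero] at hr1
  exact hr1.not_isUnit isUnit_one

/-- For x = a + s with a fixed and s skew, x · star x = a² - s². Each skew s lies in (π), so a² = 1
+ s² has exactly two fixed solutions. -/
theorem card_norm_eq_one [Finite R] [Invertible (2 : R)] (hR : IsRamifiedQuotient R π) :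
    Nat.card {x : R | x * star x = 1} = Nat.card {x : R | star x = -x} * 2 := by
  have := Fintype.ofFinite {x : R | star x = -x}
  have h2 : (2 : R) * ⅟2 = 1 := mul_invOf_self 2
  have hi : star (⅟2 : R) = ⅟2 := SkewHermForm.star_invOf_two
  have e : {x : R | x * star x = 1} ≃ Σ s : {x : R | star x = -x},
      {a : R | star a = a ∧ a ^ 2 = 1 + s.1 ^ 2} :=
    { toFun := fun x => ⟨⟨⅟2 * (x.1 - star x.1), by
          simp only [Set.mem_ofPred_eq, star_mul', hi, star_sub, star_star]
          ring⟩, ⅟2 * (x.1 + star x.1), by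
          simp only [star_mul', hi, star_add, star_star]
          ring, by
          have := x.2
          simp only [Set.mem_ofPred_eq] at this
          simp only
          linear_combination 4 * ⅟2 ^ 2 * this + (2 * ⅟2 + 1) * h2⟩
      invFun := fun z => ⟨z.2.1 + z.1.1, by
        obtain ⟨⟨s, hs⟩, a, ha, hsq⟩ := z
        simp only [Set.mem_ofPred_eq] at hs hsq
        simp only [Set.mem_ofPred_eq, star_add, hs, ha]
        linear_combination hsq⟩
      left_inv := fun x => Subtype.ext (by
        simp only
        linear_combination x.1 * h2)
      right_inv := fun z => by
        obtain ⟨⟨s, hs⟩, a, ha, hsq⟩ := z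
        simp only [Set.mem_ofPred_eq] at hs hsq
        refine Sigma.subtype_ext (Subtype.ext ?_) ?_
        · simp only [star_add, hs, ha]
          linear_combination s * h2
        · simp only [star_add, hs, ha]
          linear_combination a * h2 }
  rw [Nat.card_congr e, Nat.card_sigma, Finset.sum_congr rfl fun s _ => hR.card_sq_eq ?_ ?_,
    Finset.sum_const, Finset.card_univ, ← Nat.card_eq_fintype_card, smul_eq_mul]
  · have hs : star s.1 = -s.1 := s.2
    rw [star_add, star_one, star_pow, hs, neg_sq]
  · exact hR.isNilpotent_of_dvd (by
      rw [sub_add_cancel_left, dvd_neg, sq]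
      exact Dvd.dvd.mul_right (hR.dvd_of_star_eq_neg s.2) _)

/-- The equation xπ · star x = π forces x · star x = 1, because x · star x - 1 is fixed and π kills
no nonzero fixed element. -/
theorem card_isometricMaps_line_self [Finite R] [Invertible (2 : R)]
    (hR : IsRamifiedQuotient R π) :
    Nat.card (SkewHermForm.isometricMaps (SkewHermForm.line π hR.star_π)
      (SkewHermForm.line π hR.star_π)) = Nat.card {x : R | star x = -x} * 2 := by
  rw [SkewHermForm.card_isometricMaps_line, ← hR.card_norm_eq_one]
  congr 2
  ext x
  simp only [Set.mem_ofPred_eq, SkewHermForm.line]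
  constructor
  · intro h
    refine sub_eq_zero.mp (hR.eq_zero_of_mul _ ?_ ?_)
    · rw [star_sub, star_mul', star_star, star_one, mul_comm]
    · linear_combination h
  · intro h
    linear_combination π * h

end IsRamifiedQuotient

/-! ### Isometric self-maps of the standard forms -/

namespace SkewHermForm

variable {R : Type*} [CommRing R] [StarRing R] {π : R}

theorem exists_isIsometry_orthPow_one {V : Type*} [AddCommGroup V] [Module R V]
    (B : SkewHermForm R V) : ∃ e, IsIsometry (B.orthPow 1) B e :=
  ⟨LinearEquiv.funUnique (Fin 1) R V, fun x y =>
    (Fin.sum_univ_one fun i => B.form (x i) (y i)).symm⟩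

theorem card_isometricMaps_self_zero [Finite R] [Invertible (2 : R)]
    (hR : IsRamifiedQuotient R π) :
    Nat.card (isometricMaps (((hyp R).orthPow 0).orthSum ((line π hR.star_π).orthPow 0))
      (((hyp R).orthPow 0).orthSum ((line π hR.star_π).orthPow 0))) = 1 := by
  refine Nat.card_eq_one_iff_unique.mpr ⟨⟨fun T T' => ?_⟩, ⟨⟨0, fun x y => ?_⟩⟩⟩
  · refine Subtype.ext (LinearMap.ext fun x => ?_)
    exact Subsingleton.elim _ _
  · simp [orthSum, orthPow]

theorem card_isometricMaps_self_one [Finite R] [Invertible (2 : R)]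
    (hR : IsRamifiedQuotient R π) :
    Nat.card (isometricMaps (((hyp R).orthPow 0).orthSum ((line π hR.star_π).orthPow 1))
      (((hyp R).orthPow 0).orthSum ((line π hR.star_π).orthPow 1))) =
      Nat.card {x : R | star x = -x} * 2 := by
  obtain ⟨e, he⟩ := exists_isIsometry_orthPow_one (line π hR.star_π)
  have h1 : IsIsometry (((hyp R).orthPow 0).orthSum ((line π hR.star_π).orthPow 1))
      ((line π hR.star_π).orthPow 1) LinearEquiv.uniqueProd := fun x y => by
    simp [orthSum, orthPow, LinearEquiv.uniqueProd]
  have h2 := h1.trans he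
  rw [card_isometricMaps_congr_left h2, card_isometricMaps_congr_right h2,
    hR.card_isometricMaps_line_self]

theorem dvd_orthPow_line_form {s : R} (hs : star s = -s) (r : ℕ) (u u' : Fin r → R) :
    s ∣ ((line s hs).orthPow r).form u u' :=
  Finset.dvd_sum (s := Finset.univ) (f := fun i => (line s hs).form (u i) (u' i))
    fun i _ => ⟨u i * star (u' i), by simp only [line]; ring⟩

theorem isIsometry_succ_comm {U : Type*} [AddCommGroup U] [Module R U] (C : SkewHermForm R U)
    (m : ℕ) : ∃ e, IsIsometry (((hyp R).orthPow (m + 1)).orthSum C)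
      ((((hyp R).orthPow m).orthSum C).orthSum (hyp R)) e :=
  ⟨_, (((isIsometry_removeNthEquiv (hyp R) (0 : Fin (m + 1))).prodCongr (isIsometry_refl C)).trans
    (isIsometry_prodAssoc _ _ _)).trans (isIsometry_prodComm _ _)⟩

/-- The unimodular vectors are shared equally among the skew values. The factor 1 - q^{-2m} arises
because nonunits are the fraction 1/q of R and a vector fails to be unimodular when all 2m
coordinates are nonunits. -/
theorem card_isUnimodular_form_eq [Finite R] [Invertible (2 : R)] {U : Type*} [AddCommGroup U]
    [Module R U] [Finite U] (hR : IsRamifiedQuotient R π) (m : ℕ) (C : SkewHermForm R U) {c : R}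
    (hc : star c = -c) {q : ℕ} (hq : 0 < q) (hcard : Nat.card {x : R | ¬ IsUnit x} * q = Nat.card R) :
    (Nat.card {v | v ∈ {x : (Fin m → R × R) × U | IsUnimodular x.1} ∧
      (((hyp R).orthPow m).orthSum C).form v v = c} : ℝ) * Nat.card {x : R | star x = -x} =
      (Nat.card R : ℝ) ^ (2 * m) * Nat.card U * (1 - ((q : ℝ) ^ (2 * m))⁻¹) := by
  have h1 := (skewEquidistributed_hyp_orthPow_orthSum hR m C).card_eq_mul
    (fun x _ => star_form_self _ x) hc
  have h2 := card_isUnimodular (R := R) (U := U) m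
  have hq' : (q : ℝ) ^ (2 * m) ≠ 0 := by positivity
  have h3 : (Nat.card {x : R | ¬ IsUnit x} : ℝ) ^ (2 * m) =
      (Nat.card R : ℝ) ^ (2 * m) * ((q : ℝ) ^ (2 * m))⁻¹ := by
    rw [eq_mul_inv_iff_mul_eq₀ hq', ← mul_pow]
    exact_mod_cast congrArg (fun x : ℕ => (x : ℝ) ^ (2 * m)) hcard
  rw [h1] at h2
  have h4 : (Nat.card {x : R | star x = -x} : ℝ) *
      Nat.card {v | v ∈ {x : (Fin m → R × R) × U | IsUnimodular x.1} ∧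
      (((hyp R).orthPow m).orthSum C).form v v = c} +
      (Nat.card {x : R | ¬ IsUnit x} : ℝ) ^ (2 * m) * Nat.card U =
      (Nat.card R : ℝ) ^ (2 * m) * Nat.card U := by exact_mod_cast h2
  rw [h3] at h4
  linear_combination h4

/-- Hyperbolic planes are split off one at a time, each with its factor 1 - q^{-2(i+1)}. The factor
r + 1 is the base case: one map on the zero module, and twice the number of skew elements on a line.
-/
theorem card_isometricMaps_self_div [Finite R] [Invertible (2 : R)] (hR : IsRamifiedQuotient R π)
    (m r : ℕ) (hr : r < 2) {q : ℕ} (hq : 0 < q)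
    (hcard : Nat.card {x : R | ¬ IsUnit x} * q = Nat.card R) :
    (Nat.card (isometricMaps (((hyp R).orthPow m).orthSum ((line π hR.star_π).orthPow r))
      (((hyp R).orthPow m).orthSum ((line π hR.star_π).orthPow r))) : ℝ) =
      (Nat.card {x : R | star x = -x} : ℝ) ^ (2 * m + r) ^ 2 *
      ((r + 1) * ∏ i ∈ Finset.range m, (1 - ((q : ℝ) ^ (2 * (i + 1)))⁻¹)) := by
  have hQ0 : (Nat.card {x : R | star x = -x} : ℝ) ≠ 0 := by
    have : Nonempty {x : R | star x = -x} := ⟨⟨0, by simp⟩⟩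
    exact_mod_cast Nat.card_pos.ne'
  have hRQ : (Nat.card R : ℝ) = (Nat.card {x : R | star x = -x} : ℝ) ^ 2 := by
    rw [Nat.card_eq_skew_mul_symm (R := R), hR.card_star_eq_self]
    push_cast
    ring
  induction m with
  | zero =>
    interval_cases r
    · rw [card_isometricMaps_self_zero hR]
      simp
    · rw [card_isometricMaps_self_one hR]
      push_cast
      norm_num
  | succ m ih =>
    obtain ⟨e, he⟩ := isIsometry_succ_comm ((line π hR.star_π).orthPow r) m
    rw [card_isometricMaps_congr_right he]
    obtain ⟨h1, h2⟩ := card_isometricMaps_hyp_orthSum hR ((line π hR.star_π).orthPow r)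
      (dvd_orthPow_line_form _ r) (((hyp R).orthPow m).orthSum ((line π hR.star_π).orthPow r)) m
    rw [h1, h2]
    have h3 := card_isUnimodular_form_eq hR (m + 1) ((line π hR.star_π).orthPow r) (c := 0)
      (by simp) hq hcard
    have h4 : (Nat.card ((Fin m → R × R) × (Fin r → R)) : ℝ) = (Nat.card R : ℝ) ^ (2 * m + r) := by
      rw [Nat.card_prod, Nat.card_fun, Nat.card_fun, Nat.card_prod, Nat.card_fin, Nat.card_fin]
      push_cast
      ring
    have h5 : (Nat.card (Fin r → R) : ℝ) = (Nat.card R : ℝ) ^ r := by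
      rw [Nat.card_fun, Nat.card_fin]
      push_cast
      ring
    rw [Nat.cast_mul, Nat.cast_mul, Nat.cast_mul, ih, h4, hR.card_star_eq_self,
      Finset.prod_range_succ]
    rw [h5, hRQ] at h3
    rw [hRQ]
    have h6 := congrArg (fun x : ℝ => x * (((Nat.card {x : R | star x = -x} : ℝ) ^ 2) ^ (2 * m + r) *
      ((Nat.card {x : R | star x = -x} : ℝ) ^ (2 * m + r) ^ 2 *
      ((r + 1) * ∏ i ∈ Finset.range m, (1 - ((q : ℝ) ^ (2 * (i + 1)))⁻¹))))) h3
    calc _ = _ := by ring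
      _ = _ := h6
      _ = _ := by ring

end SkewHermForm

/-! ### Gram matrices -/

namespace SkewHermForm

open Matrix

variable {R : Type*} [CommRing R] [StarRing R] {ι κ : Type*} [Fintype ι] [Fintype κ]

/-- The skew-hermitian form with a given Gram matrix. -/
def ofMatrix (G : Matrix κ κ R) (hG : Gᴴ = -G) : SkewHermForm R (κ → R) where
  form x y := x ⬝ᵥ G *ᵥ star y
  add_left x x' y := add_dotProduct _ _ _
  smul_left a x y := smul_dotProduct _ _ _
  skew x y := by
    rw [← star_dotProduct_star, star_mulVec, star_star, hG, vecMul_neg,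
      neg_dotProduct, neg_neg, dotProduct_mulVec]

theorem card_isometricMaps_ofMatrix [DecidableEq ι] {G : Matrix κ κ R} (hG : Gᴴ = -G)
    {S : Matrix ι ι R} (hS : Sᴴ = -S) :
    Nat.card (isometricMaps (ofMatrix G hG) (ofMatrix S hS)) =
      Nat.card {T : Matrix ι κ R | T * G * Tᴴ = S} := by
  refine (Nat.card_congr (Equiv.subtypeEquiv (Matrix.toLinearMapRight' (R := R)).toEquiv
    fun T => ?_)).symm
  have h : ∀ x y : ι → R, (x ᵥ* T) ⬝ᵥ G *ᵥ star (y ᵥ* T) = x ⬝ᵥ (T * G * Tᴴ) *ᵥ star y := by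
    intro x y
    rw [star_vecMul, ← dotProduct_mulVec, mulVec_mulVec, mulVec_mulVec]
  constructor
  · intro hT x y
    exact (h x y).trans (by rw [show T * G * Tᴴ = S from hT]; rfl)
  · intro hT
    ext i j
    have := (h (Pi.single i 1) (Pi.single j 1)).symm.trans (hT (Pi.single i 1) (Pi.single j 1))
    have hs : star (Pi.single j 1 : ι → R) = Pi.single j 1 := by
      rw [Pi.star_def]
      ext k
      by_cases hk : k = j
      · subst hk; simp
      · simp [hk]
    simpa [ofMatrix, hs] using this

end SkewHermForm

/-! ### Newton's method for matrix equations over residue rings -/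

section Stabilization

open Matrix

variable {R R' : Type*} [CommRing R] [CommRing R'] {ι κ : Type*} [Fintype ι] [Fintype κ]

theorem AddMonoidHom.card_eq_card_mul_card_ker {A B : Type*} [AddGroup A] [AddGroup B]
    (f : A →+ B) (hf : Function.Surjective f) : Nat.card A = Nat.card B * Nat.card f.ker := by
  rw [AddSubgroup.card_eq_card_quotient_mul_card_addSubgroup f.ker,
    Nat.card_congr (QuotientAddGroup.quotientKerEquivOfSurjective f hf).toEquiv]

theorem Nat.card_matrix_preimage (f : R' →+* R) (hf : Function.Surjective f)
    (X : Set (Matrix ι κ R)) :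
    Nat.card {T : Matrix ι κ R' | T.map f ∈ X} =
      Nat.card X * Nat.card (RingHom.ker f) ^ (Fintype.card ι * Fintype.card κ) := by
  choose s hs using hf
  have e : {T : Matrix ι κ R' | T.map f ∈ X} ≃ X × Matrix ι κ (RingHom.ker f) :=
    { toFun := fun T => (⟨T.1.map f, T.2⟩, Matrix.of fun i j => ⟨T.1 i j - s (f (T.1 i j)), by
        rw [RingHom.mem_ker, map_sub, hs, sub_self]⟩)
      invFun := fun z => ⟨Matrix.of fun i j => s (z.1.1 i j) + z.2 i j, by
        have : (Matrix.of fun i j => s (z.1.1 i j) + (z.2 i j : R')).map f = z.1.1 := by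
          ext i j
          have := RingHom.mem_ker.mp (z.2 i j).2
          simp [hs, this]
        rw [Set.mem_ofPred_eq, this]
        exact z.1.2⟩
      left_inv := fun T => by
        ext i j
        simp
      right_inv := fun z => by
        have h0 : ∀ i j, f (z.2 i j) = 0 := fun i j => RingHom.mem_ker.mp (z.2 i j).2
        ext i j
        · simp [hs, h0]
        · simp [hs, h0] }
  rw [Nat.card_congr e, Nat.card_prod]
  congr 1
  rw [show Matrix ι κ (RingHom.ker f) = (ι → κ → RingHom.ker f) from rfl, Nat.card_fun,
    Nat.card_fun, Nat.card_eq_fintype_card (α := ι), Nat.card_eq_fintype_card (α := κ), ← pow_mul,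
    mul_comm]

/-- Newton's method for the equation `T G T* = S`: solutions modulo a small ideal all lift, in the
same number of ways. -/
theorem card_matrix_lift [StarRing R] [StarRing R'] [DecidableEq ι] (f : R' →+* R)
    (hf : Function.Surjective f) (hstar : ∀ x, f (star x) = star (f x)) {G : Matrix κ κ R'}
    (hG : Gᴴ = -G) {S : Matrix ι ι R'} (hS : Sᴴ = -S)
    (hZ : ∀ W : Matrix ι ι R', Wᴴ = -W → W.map f = 0 → ∃ Z : Matrix ι ι R',
      Z * S + S * Zᴴ = W ∧ Z * Z = 0 ∧ Z * S * Zᴴ = 0 ∧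
      ∀ K : Matrix ι ι R', K.map f = 0 → Z * K = 0 ∧ K * Zᴴ = 0) :
    Nat.card {T : Matrix ι κ R' | T * G * Tᴴ = S} *
      Nat.card {W : Matrix ι ι R' | Wᴴ = -W ∧ W.map f = 0} =
    Nat.card {T : Matrix ι κ R | T * G.map f * Tᴴ = S.map f} *
      Nat.card (RingHom.ker f) ^ (Fintype.card ι * Fintype.card κ) := by
  rw [← Nat.card_matrix_preimage f hf, ← Nat.card_prod]
  choose Z hZ1 hZ2 hZ3 hZ4 using fun W : {W : Matrix ι ι R' | Wᴴ = -W ∧ W.map f = 0} =>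
    hZ W.1 W.2.1 W.2.2
  have hmap : ∀ T : Matrix ι κ R', (T * G * Tᴴ).map f = T.map f * G.map f * (T.map f)ᴴ := by
    intro T
    rw [Matrix.map_mul, Matrix.map_mul, conjTranspose_map _ hstar]
  have hone : ∀ W, (1 - Z W) * (1 + Z W) = 1 := fun W => by
    rw [mul_add, mul_one, sub_mul, one_mul, hZ2]
    abel
  have hone' : ∀ W, (1 + Z W) * (1 - Z W) = 1 := fun W => by
    rw [add_mul, one_mul, mul_sub, mul_one, hZ2]
    abel
  have key : ∀ W, ∀ T : Matrix ι κ R', T * G * Tᴴ = S →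
      ((1 + Z W) * T) * G * ((1 + Z W) * T)ᴴ = S + W.1 := by
    intro W T hT
    calc ((1 + Z W) * T) * G * ((1 + Z W) * T)ᴴ
        = (1 + Z W) * (T * G * Tᴴ) * (1 + (Z W)ᴴ) := by
          rw [conjTranspose_mul, conjTranspose_add, conjTranspose_one]
          simp only [Matrix.mul_assoc]
      _ = S + (Z W * S + S * (Z W)ᴴ) + Z W * S * (Z W)ᴴ := by
          rw [hT]
          noncomm_ring
      _ = S + W.1 := by rw [hZ1, hZ3, add_zero]
  have key' : ∀ W : {W : Matrix ι ι R' | Wᴴ = -W ∧ W.map f = 0}, ∀ T : Matrix ι κ R',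
      T * G * Tᴴ = S + W.1 → ((1 - Z W) * T) * G * ((1 - Z W) * T)ᴴ = S := by
    intro W T hT
    calc ((1 - Z W) * T) * G * ((1 - Z W) * T)ᴴ
        = (1 - Z W) * (T * G * Tᴴ) * (1 - (Z W)ᴴ) := by
          rw [conjTranspose_mul, conjTranspose_sub, conjTranspose_one]
          simp only [Matrix.mul_assoc]
      _ = S + W.1 - (Z W * S + S * (Z W)ᴴ) + Z W * S * (Z W)ᴴ - Z W * W.1 - W.1 * (Z W)ᴴ
          + Z W * W.1 * (Z W)ᴴ := by
          rw [hT]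
          noncomm_ring
      _ = S := by
          rw [hZ1, hZ3, (hZ4 W W.1 W.2.2).1, (hZ4 W W.1 W.2.2).2, Matrix.zero_mul]
          abel
  have hmem : ∀ T : Matrix ι κ R', T.map f ∈ {T : Matrix ι κ R | T * G.map f * Tᴴ = S.map f} ↔
      (T * G * Tᴴ - S).map f = 0 := by
    intro T
    rw [Matrix.map_sub _ (map_sub f), hmap, sub_eq_zero]
    rfl
  have hskew : ∀ T : Matrix ι κ R', (T * G * Tᴴ - S)ᴴ = -(T * G * Tᴴ - S) := fun T => by
    rw [conjTranspose_sub, hS, conjTranspose_mul, conjTranspose_mul, conjTranspose_conjTranspose,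
      hG, ← Matrix.mul_assoc, Matrix.mul_neg, Matrix.neg_mul]
    abel
  -- A pair (T, W) goes to (1 + Z_W)T, whose Gram matrix is S + W. Conversely W is the defect of the
  -- approximate solution, and T is recovered by the inverse 1 - Z_W of 1 + Z_W.
  refine Nat.card_congr
    { toFun := fun z => ⟨(1 + Z z.2) * z.1.1, by
        rw [Set.mem_ofPred_eq, hmem, key z.2 z.1.1 z.1.2, add_sub_cancel_left]
        exact z.2.2.2⟩
      invFun := fun T => (⟨(1 - Z ⟨T.1 * G * T.1ᴴ - S, hskew _, (hmem _).mp T.2⟩) * T.1, ?_⟩,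
        ⟨T.1 * G * T.1ᴴ - S, hskew _, (hmem _).mp T.2⟩)
      left_inv := ?_
      right_inv := ?_ }
  · exact key' _ _ (by rw [add_sub_cancel])
  · rintro ⟨⟨T, hT⟩, W⟩
    have h := key W T hT
    have hW : (⟨((1 + Z W) * T) * G * ((1 + Z W) * T)ᴴ - S, by
        rw [h, add_sub_cancel_left]; exact W.2⟩ :
          {W : Matrix ι ι R' | Wᴴ = -W ∧ W.map f = 0}) = W := by
      refine Subtype.ext ?_
      simp only [h, add_sub_cancel_left]
    refine Prod.ext (Subtype.ext ?_) hW
    simp only [hW]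
    rw [← Matrix.mul_assoc, hone, Matrix.one_mul]
  · rintro ⟨T, hT⟩
    refine Subtype.ext ?_
    simp only
    rw [← Matrix.mul_assoc, hone', Matrix.one_mul]

/-- The number of skew-hermitian matrices in the kernel of a map of ramified quotients. -/
theorem card_skewHermitian_ker [StarRing R] [StarRing R'] {π : R'} (f : R' →+* R)
    (hstar : ∀ x, f (star x) = star (f x)) [Invertible (2 : R')] (hR' : IsRamifiedQuotient R' π)
    (hR : IsRamifiedQuotient R (f π)) :
    Nat.card {W : Matrix ι ι R' | Wᴴ = -W ∧ W.map f = 0} =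
      Nat.card {x : R' | star x = -x ∧ f x = 0} ^ (Fintype.card ι * Fintype.card ι) := by
  have h2 : (2 : R') * ⅟2 = 1 := mul_invOf_self 2
  have hi : star (⅟2 : R') = ⅟2 := SkewHermForm.star_invOf_two
  -- A skew element of the kernel can be divided by π with a fixed quotient; this quotient stays in
  -- the kernel because its image is fixed and killed by the image of π.
  have hσ : ∀ x : R', star x = -x → f x = 0 → ∃ y, star y = y ∧ f y = 0 ∧ π * y = x := by
    intro x hx hfx
    obtain ⟨z, rfl⟩ := hR'.dvd_of_star_eq_neg hx
    rw [star_mul', hR'.star_π] at hx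
    have hs : star (⅟2 * (z + star z)) = ⅟2 * (z + star z) := by
      simp only [star_mul', hi, star_add, star_star]
      ring
    have hx' : π * (⅟2 * (z + star z)) = π * z := by
      linear_combination π * z * h2 - ⅟2 * hx
    refine ⟨⅟2 * (z + star z), hs, hR.eq_zero_of_mul _ (by rw [← hstar, hs]) ?_, hx'⟩
    rw [← map_mul, hx', hfx]
  have huniq : ∀ y y' : R', star y = y → star y' = y' → π * y = π * y' → y = y' := by
    intro y y' hy hy' h
    refine sub_eq_zero.mp (hR'.eq_zero_of_mul _ (by rw [star_sub, hy, hy']) ?_)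
    rw [mul_sub, h, sub_self]
  have hcard : Nat.card {x : R' | star x = -x ∧ f x = 0} ^ (Fintype.card ι * Fintype.card ι) =
      Nat.card (ι → ι → {x : R' | star x = -x ∧ f x = 0}) := by
    rw [Nat.card_fun, Nat.card_fun, Nat.card_eq_fintype_card (α := ι), ← pow_mul]
  rw [hcard]
  have hW : ∀ W : {W : Matrix ι ι R' | Wᴴ = -W ∧ W.map f = 0}, (∀ i j, star (W.1 j i) = -W.1 i j) ∧
      ∀ i j, f (W.1 i j) = 0 := fun W =>
    ⟨fun i j => congrFun (congrFun W.2.1 i) j, fun i j => congrFun (congrFun W.2.2 i) j⟩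
  -- Let s be the skew part and t the fixed part of the entry (i, j). Passing to (j, i) keeps s and
  -- changes the sign of t, so the two new entries s + πt and s - πt are skew and determine s and t.
  -- This turns W into an arbitrary matrix of skew elements of the kernel.
  refine Nat.card_eq_of_bijective (fun W i j => ⟨⅟2 * (W.1 i j - star (W.1 i j)) +
    π * (⅟2 * (W.1 i j + star (W.1 i j))), ?_, ?_⟩) ⟨?_, ?_⟩
  · simp only [star_add, star_mul', hi, star_sub, star_star, hR'.star_π]
    ring
  · simp only [map_add, map_mul, map_sub, hstar, (hW W).2 i j, star_zero]
    ring
  · intro W W' hWW'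
    obtain ⟨h1, -⟩ := hW W
    obtain ⟨h1', -⟩ := hW W'
    refine Subtype.ext (Matrix.ext fun i j => ?_)
    have e1 := congrArg Subtype.val (congrFun (congrFun hWW' i) j)
    have e2 := congrArg Subtype.val (congrFun (congrFun hWW' j) i)
    simp only at e1 e2
    have s1 := h1 i j
    have s2 := h1 j i
    have s1' := h1' i j
    have s2' := h1' j i
    rw [s1, show W.1 j i = -star (W.1 i j) by rw [s2, neg_neg], s1',
      show W'.1 j i = -star (W'.1 i j) by rw [s2', neg_neg]] at e2
    have hsum : W.1 i j + star (W.1 i j) = W'.1 i j + star (W'.1 i j) := by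
      refine huniq _ _ (by rw [star_add, star_star, add_comm])
        (by rw [star_add, star_star, add_comm]) ?_
      linear_combination e1 - e2 - π * (W.1 i j + star (W.1 i j) - W'.1 i j - star (W'.1 i j)) * h2
    have hdiff : W.1 i j - star (W.1 i j) = W'.1 i j - star (W'.1 i j) := by
      linear_combination e1 + e2 - (W.1 i j - star (W.1 i j) - W'.1 i j + star (W'.1 i j)) * h2
    linear_combination ⅟2 * (hsum + hdiff) - (W.1 i j - W'.1 i j) * h2
  · intro C
    choose σ hσ1 hσ2 hσ3 using fun x : {x : R' | star x = -x ∧ f x = 0} => hσ x.1 x.2.1 x.2.2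
    have hC1 : ∀ i j, star (C i j : R') = -C i j := fun i j => (C i j).2.1
    have hC2 : ∀ i j, f (C i j) = 0 := fun i j => (C i j).2.2
    refine ⟨⟨Matrix.of fun i j => ⅟2 * ((C i j : R') + C j i) +
      ⅟2 * (σ (C i j) - σ (C j i)), ?_, ?_⟩, ?_⟩
    · ext i j
      simp only [conjTranspose_apply, of_apply, Matrix.neg_apply, star_add, star_mul', hi, star_sub,
        hσ1, hC1]
      ring
    · ext i j
      simp [hσ2, hC2]
    · funext i j
      refine Subtype.ext ?_
      simp only [of_apply, star_add, star_mul', hi, star_sub, hσ1, hC1]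
      have e1 := hσ3 (C i j)
      have e2 := hσ3 (C j i)
      linear_combination ⅟2 * (e1 - e2) * (2 * ⅟2) + (⅟2 * ((C i j : R') + C j i) +
        ⅟2 * ((C i j : R') - C j i) + C i j) * h2

end Stabilization

/-! ### Alternating bicharacters on finite modules -/

theorem AddChar.map_sum_eq_prod {A M ι : Type*} [AddCommMonoid A] [CommMonoid M] (ψ : AddChar A M)
    (s : Finset ι) (f : ι → A) : ψ (∑ i ∈ s, f i) = ∏ i ∈ s, ψ (f i) := by
  classical
  induction s using Finset.induction_on with
  | empty => simp
  | insert a s ha ih => rw [Finset.sum_insert ha, Finset.prod_insert ha, ψ.map_add_eq_mul, ih]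

section FiniteModules

/-- Every factor of a composition series is some A/I with I maximal, hence has q elements. -/
theorem Module.exists_card_eq_pow {A : Type*} [CommRing A] {q : ℕ}
    (hq : ∀ I : Ideal A, I.IsMaximal → Nat.card (A ⧸ I) = q) (E : Type*) [AddCommGroup E]
    [Module A E] [Finite E] : ∃ j : ℕ, Nat.card E = q ^ j := by
  induction hn : Nat.card E using Nat.strong_induction_on generalizing E with
  | _ n ih =>
    subst hn
    rcases subsingleton_or_nontrivial E with hE | hE
    · exact ⟨0, by rw [pow_zero, Nat.card_eq_one_iff_unique]; exact ⟨hE, ⟨0⟩⟩⟩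
    · obtain ⟨S, hS, -⟩ := (eq_top_or_exists_le_coatom (⊥ : Submodule A E)).resolve_left bot_ne_top
      obtain ⟨I, hI, ⟨e⟩⟩ := isSimpleModule_iff_quot_maximal.mp (isSimpleModule_iff_isCoatom.mpr hS)
      have h1 := S.card_eq_card_quotient_mul_card
      have h2 : Nat.card (E ⧸ S) = q := (Nat.card_congr e.toEquiv).trans (hq I hI)
      have hlt : Nat.card S < Nat.card E := by
        have := Set.ncard_lt_card (s := (S : Set E)) fun h => hS.1 (by
          ext x; simp [← SetLike.mem_coe, h])
        exact this
      obtain ⟨j, hj⟩ := ih _ hlt S rfl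
      exact ⟨j + 1, by rw [h1, h2, hj]; ring⟩

/-- The sum of an alternating bicharacter over a finite module is the square of the cardinality of
a maximal isotropic submodule. -/
theorem exists_sum_alternating_bicharacter {A : Type*} [CommRing A] {q : ℕ}
    (hq : ∀ I : Ideal A, I.IsMaximal → Nat.card (A ⧸ I) = q) {E : Type*} [AddCommGroup E]
    [Module A E] [Fintype E] (β : E → E → ℂ)
    (hl : ∀ x x' y, β (x + x') y = β x y * β x' y) (hr : ∀ x y y', β x (y + y') = β x y * β x y')
    (hsmul : ∀ (a : A) x y, β (a • x) y = β x (a • y)) (halt : ∀ (a : A) x, β (a • x) x = 1) :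
    ∃ j : ℕ, (∑ x, ∑ y, β x y) * (q : ℂ) ^ (2 * j) = (Fintype.card E : ℂ) ^ 2 := by
  classical
  have hself : ∀ x, β x x = 1 := fun x => by simpa using halt 1 x
  have h0r : ∀ x, β x 0 = 1 := fun x => by
    have := halt 0 x
    rw [hsmul, zero_smul] at this
    exact this
  have h0l : ∀ y, β 0 y = 1 := fun y => by
    have := halt 0 y
    rwa [zero_smul] at this
  have hanti : ∀ x y, β x y * β y x = 1 := fun x y => by
    have := hself (x + y)
    rw [hl, hr, hr, hself, hself] at this
    simpa using this
  have hsymm : ∀ x y, β x y = 1 → β y x = 1 := fun x y h => by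
    have := hanti x y
    rwa [h, one_mul] at this
  let ψ : E → AddChar E ℂ := fun x =>
    { toFun := β x
      map_zero_eq_one' := h0r x
      map_add_eq_mul' := hr x }
  have hsum : ∀ x, ∑ y, β x y = if ∀ y, β x y = 1 then (Fintype.card E : ℂ) else 0 := fun x => by
    have h := AddChar.sum_eq_ite (ψ x)
    have h' : ψ x = 0 ↔ ∀ y, β x y = 1 := by
      constructor
      · intro h y
        exact DFunLike.congr_fun h y
      · intro h
        ext y
        exact h y
    simp only [h'] at h
    exact h
  let P : Submodule A E → Prop := fun W => ∀ x ∈ W, ∀ y ∈ W, β x y = 1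
  have hfin : {W | P W}.Finite := Set.toFinite _
  obtain ⟨W, hW⟩ := hfin.exists_maximal ⟨⊥, fun x hx y hy => by
    rw [(Submodule.mem_bot A).mp hx]
    exact h0l y⟩
  have hWP : P W := hW.1
  -- A maximal isotropic submodule is its own orthogonal complement: adjoining y keeps it isotropic
  -- because the bicharacter is alternating for all scalars of A.
  have hperp : ∀ y, (∀ x ∈ W, β x y = 1) → y ∈ W := by
    intro y hy
    have hP : P (W ⊔ Submodule.span A {y}) := by
      intro u hu v hv
      obtain ⟨w, hw, z, hz, rfl⟩ := Submodule.mem_sup.mp hu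
      obtain ⟨w', hw', z', hz', rfl⟩ := Submodule.mem_sup.mp hv
      obtain ⟨a, rfl⟩ := Submodule.mem_span_singleton.mp hz
      obtain ⟨a', rfl⟩ := Submodule.mem_span_singleton.mp hz'
      have e1 : β w (a' • y) = 1 := by rw [← hsmul]; exact hy _ (W.smul_mem _ hw)
      have e2 : β (a • y) w' = 1 := hsymm _ _ (by rw [← hsmul]; exact hy _ (W.smul_mem _ hw'))
      have e3 : β (a • y) (a' • y) = 1 := by
        rw [← hsmul, smul_smul]
        exact halt _ _
      rw [hl, hr, hr, hWP w hw w' hw', e1, e2, e3]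
      norm_num
    exact hW.2 hP le_sup_left (Submodule.mem_sup_right (Submodule.mem_span_singleton_self y))
  have hrad : ∀ x, (∀ y, β x y = 1) → x ∈ W := fun x hx => hperp x fun y _ => hsymm _ _ (hx y)
  -- The inner sum vanishes unless x is in the radical, which lies in W, so x may be restricted to
  -- W. Summing over x in W first then detects the y in W^⊥ = W.
  have hsq : ∑ x, ∑ y, β x y = (Nat.card W : ℂ) ^ 2 := by
    have e1 : ∑ x, ∑ y, β x y = ∑ x : W, ∑ y, β x y := by
      rw [← Finset.sum_subtype (Finset.univ.filter (· ∈ W)) (by simp) fun x => ∑ y, β x y]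
      refine (Finset.sum_subset (Finset.subset_univ _) fun x _ hx => ?_).symm
      rw [hsum, if_neg fun h => hx (by simpa using hrad x h)]
    have e2 : ∀ y, ∑ x : W, β x y = if y ∈ W then (Nat.card W : ℂ) else 0 := fun y => by
      let φ : AddChar W ℂ :=
        { toFun := fun x => β x y
          map_zero_eq_one' := h0l y
          map_add_eq_mul' := fun x x' => hl x x' y }
      have h := AddChar.sum_eq_ite φ
      have h' : φ = 0 ↔ y ∈ W := by
        constructor
        · intro h
          exact hperp y fun x hx => DFunLike.congr_fun h ⟨x, hx⟩
        · intro h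
          ext x
          exact hWP x x.2 y h
      simp only [h', ← Nat.card_eq_fintype_card] at h
      exact h
    rw [e1, Finset.sum_comm, Finset.sum_congr rfl fun y _ => e2 y, ← Finset.sum_filter,
      Finset.sum_const, nsmul_eq_mul, sq]
    congr 2
    rw [Nat.card_eq_fintype_card, Fintype.card_subtype]
  obtain ⟨j, hj⟩ := Module.exists_card_eq_pow hq (E ⧸ W)
  refine ⟨j, ?_⟩
  rw [hsq, ← Nat.card_eq_fintype_card, W.card_eq_card_quotient_mul_card, hj]
  push_cast
  ring

end FiniteModules

/-! ### The fixed subring and its residue field -/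

namespace IsRamifiedQuotient

variable {R : Type*} [CommRing R] [StarRing R] {π : R}

/-- The subring of elements fixed by the involution. -/
def fixedSubring (R : Type*) [CommRing R] [StarRing R] : Subring R where
  carrier := {x | star x = x}
  mul_mem' {x y} hx hy := by
    simp only [Set.mem_ofPred_eq] at hx hy ⊢
    rw [star_mul', hx, hy]
  one_mem' := star_one R
  add_mem' {x y} hx hy := by
    simp only [Set.mem_ofPred_eq] at hx hy ⊢
    rw [star_add, hx, hy]
  zero_mem' := star_zero R
  neg_mem' {x} hx := by
    simp only [Set.mem_ofPred_eq] at hx ⊢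
    rw [star_neg, hx]

theorem mem_fixedSubring {x : R} : x ∈ fixedSubring R ↔ star x = x := Iff.rfl

/-- The bicharacters in use are balanced for fixed scalars, so the modules are taken over the fixed
subring. It is local, since its elements outside (π) are units there and those in (π) are nilpotent.
Its residue field is R/(π), because (x + star x)/2 is congruent to x modulo π. -/
theorem card_quotient_maximal [Invertible (2 : R)] (hR : IsRamifiedQuotient R π)
    (I : Ideal (fixedSubring R)) (hI : I.IsMaximal) :
    Nat.card (fixedSubring R ⧸ I) = Nat.card (R ⧸ Ideal.span {π}) := by
  have h2 : (2 : R) * ⅟2 = 1 := mul_invOf_self 2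
  let f : fixedSubring R →+* R ⧸ Ideal.span {π} :=
    (Ideal.Quotient.mk _).comp (fixedSubring R).subtype
  have hker : ∀ x : fixedSubring R, x ∈ RingHom.ker f ↔ π ∣ (x : R) := fun x => by
    rw [RingHom.mem_ker, RingHom.comp_apply, Ideal.Quotient.eq_zero_iff_mem,
      Ideal.mem_span_singleton]
    rfl
  have hIf : I = RingHom.ker f := by
    apply le_antisymm
    · intro x hx
      rw [hker]
      by_contra h
      obtain ⟨y, hy⟩ := isUnit_iff_exists_inv.mp ((hR.isUnit_or_dvd x).resolve_right h)
      have hx' : star (x : R) = x := x.2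
      have hys : star y = y := by
        have h1 := congrArg star hy
        rw [star_mul', star_one, hx'] at h1
        calc star y = (x * y) * star y := by rw [hy, one_mul]
          _ = (x * star y) * y := by ring
          _ = y := by rw [h1, one_mul]
      have : (1 : fixedSubring R) ∈ I := by
        have h1 := I.mul_mem_right ⟨y, hys⟩ hx
        have h3 : x * ⟨y, hys⟩ = 1 := Subtype.ext hy
        rwa [h3] at h1
      exact hI.ne_top ((Ideal.eq_top_iff_one I).mpr this)
    · intro x hx
      obtain ⟨k, hk⟩ := hR.isNilpotent_of_dvd ((hker x).mp hx)
      refine hI.isPrime.mem_of_pow_mem k ?_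
      have : x ^ k = 0 := Subtype.ext (by simpa using hk)
      rw [this]
      exact I.zero_mem
  have hsurj : Function.Surjective f := by
    intro y
    obtain ⟨x, rfl⟩ := Ideal.Quotient.mk_surjective y
    refine ⟨⟨⅟2 * (x + star x), ?_⟩, ?_⟩
    · rw [mem_fixedSubring, star_mul', SkewHermForm.star_invOf_two, star_add, star_star, add_comm]
    · refine Ideal.Quotient.eq.mpr (Ideal.mem_span_singleton.mpr ?_)
      have h3 : ⅟2 * (x + star x) - x = -⅟2 * (x - star x) := by
        linear_combination x * h2
      change π ∣ ⅟2 * (x + star x) - x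
      rw [h3]
      exact Dvd.dvd.mul_left (hR.dvd_sub_star x) _
  rw [hIf]
  exact Nat.card_congr (RingHom.quotientKerEquivOfSurjective hsurj).toEquiv

end IsRamifiedQuotient

/-! ### Gauss sums and dependence on the number of hyperbolic planes -/

namespace SkewHermForm

variable {R : Type*} [CommRing R] [StarRing R] {π : R}
variable {V : Type*} [AddCommGroup V] [Module R V]
variable {W : Type*} [AddCommGroup W] [Module R W]

/-- The skew-hermitian form attached to two linear functionals. -/
def wedge (x y : W →ₗ[R] R) : W → W → R := fun l l' => (hyp R).form (x l, y l) (x l', y l')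

/-- The number of isometric maps to `V ⊥ H ^ k` is an exponential polynomial in `k`. -/
theorem exists_polynomial_card_isometricMaps [Finite R] [Invertible (2 : R)] [Finite V] [Finite W]
    (hR : IsRamifiedQuotient R π) (B : SkewHermForm R V) (S : SkewHermForm R W) :
    ∃ P : ℂ[X], ∀ k : ℕ, (Nat.card (isometricMaps (B.orthSum ((hyp R).orthPow k)) S) : ℂ) =
      P.eval (((Nat.card (R ⧸ Ideal.span {π}) : ℂ) ^ (2 * k))⁻¹) *
        ((Nat.card (W →ₗ[R] R) : ℂ) ^ 2) ^ k := by
  classical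
  have := Fintype.ofFinite R
  have := Fintype.ofFinite V
  have := Fintype.ofFinite W
  have hfE : Finite (W →ₗ[R] R) := DFunLike.finite _
  have hfV : Finite (W →ₗ[R] V) := DFunLike.finite _
  have := Fintype.ofFinite (W →ₗ[R] R)
  have := Fintype.ofFinite (W →ₗ[R] V)
  set q := Nat.card (R ⧸ Ideal.span {π}) with hq
  have hq0 : (q : ℂ) ≠ 0 := by
    have : 0 < q := Nat.card_pos
    exact_mod_cast this.ne'
  -- the Gauss sums
  have hg : ∀ χ : AddChar (W → W → R) ℂ, ∃ j : ℕ,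
      (∑ x : W →ₗ[R] R, ∑ y : W →ₗ[R] R, χ (wedge x y)) * (q : ℂ) ^ (2 * j) =
        (Fintype.card (W →ₗ[R] R) : ℂ) ^ 2 := by
    intro χ
    refine exists_sum_alternating_bicharacter (A := IsRamifiedQuotient.fixedSubring R)
      hR.card_quotient_maximal _ ?_ ?_ ?_ ?_
    · intro x x' y
      rw [← AddChar.map_add_eq_mul]
      congr 1
      funext l l'
      simp only [wedge, hyp_form, LinearMap.add_apply, Pi.add_apply, star_add]
      ring
    · intro x y y'
      rw [← AddChar.map_add_eq_mul]
      congr 1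
      funext l l'
      simp only [wedge, hyp_form, LinearMap.add_apply, Pi.add_apply, star_add]
      ring
    · rintro ⟨a, ha⟩ x y
      rw [IsRamifiedQuotient.mem_fixedSubring] at ha
      congr 1
      funext l l'
      have h1 : ∀ (x : W →ₗ[R] R) l, ((⟨a, ha⟩ : IsRamifiedQuotient.fixedSubring R) • x) l = a * x l :=
        fun _ _ => rfl
      simp only [wedge, hyp_form, h1, star_mul', ha]
      ring
    · rintro ⟨a, ha⟩ x
      rw [IsRamifiedQuotient.mem_fixedSubring] at ha
      rw [← AddChar.map_zero_eq_one χ]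
      congr 1
      funext l l'
      have h1 : ∀ (x : W →ₗ[R] R) l, ((⟨a, ha⟩ : IsRamifiedQuotient.fixedSubring R) • x) l = a * x l :=
        fun _ _ => rfl
      simp only [wedge, hyp_form, h1, star_mul', ha, Pi.zero_apply]
      ring
  choose j hj using hg
  -- The contribution of V to the χ-component of the Fourier expansion; it does not involve k.
  let c : AddChar (W → W → R) ℂ → ℂ := fun χ => (Fintype.card (W → W → R) : ℂ)⁻¹ *
    ∑ T : W →ₗ[R] V, χ ((fun l l' => B.form (T l) (T l')) - S.form)
  refine ⟨∑ χ, C (c χ) * X ^ j χ, fun k => ?_⟩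
  have hΓ : (Fintype.card (W → W → R) : ℂ) ≠ 0 := by exact_mod_cast Fintype.card_ne_zero
  -- parametrization of linear maps
  let e : ((W →ₗ[R] V) × (Fin k → (W →ₗ[R] R) × (W →ₗ[R] R))) ≃
      (W →ₗ[R] V × (Fin k → R × R)) :=
    { toFun := fun z => z.1.prod (LinearMap.pi fun i => (z.2 i).1.prod (z.2 i).2)
      invFun := fun T => (LinearMap.fst R _ _ ∘ₗ T, fun i =>
        (LinearMap.fst R R R ∘ₗ LinearMap.proj i ∘ₗ LinearMap.snd R _ _ ∘ₗ T,
          LinearMap.snd R R R ∘ₗ LinearMap.proj i ∘ₗ LinearMap.snd R _ _ ∘ₗ T))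
      left_inv := fun z => rfl
      right_inv := fun T => rfl }
  have hpull : ∀ z, (fun l l' => (B.orthSum ((hyp R).orthPow k)).form (e z l) (e z l')) - S.form =
      ((fun l l' => B.form (z.1 l) (z.1 l')) - S.form) + ∑ i, wedge (z.2 i).1 (z.2 i).2 := by
    intro z
    funext l l'
    simp only [Pi.sub_apply, Pi.add_apply, Finset.sum_apply, orthSum_form]
    have : ((hyp R).orthPow k).form (e z l).2 (e z l').2 =
      ∑ i, wedge (z.2 i).1 (z.2 i).2 l l' := rfl
    rw [this]
    have : B.form (e z l).1 (e z l').1 = B.form (z.1 l) (z.1 l') := rfl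
    rw [this]
    ring
  -- Orthogonality of characters detects the equality of the pulled-back form with S. Each χ splits
  -- as a product over V and the k planes, so the planes contribute the k-th power of one Gauss sum.
  have hcount : (Nat.card (isometricMaps (B.orthSum ((hyp R).orthPow k)) S) : ℂ) =
      ∑ z : (W →ₗ[R] V) × (Fin k → (W →ₗ[R] R) × (W →ₗ[R] R)),
        (Fintype.card (W → W → R) : ℂ)⁻¹ * ∑ χ : AddChar (W → W → R) ℂ,
          χ (((fun l l' => B.form (z.1 l) (z.1 l')) - S.form) +
            ∑ i, wedge (z.2 i).1 (z.2 i).2) := by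
    have h1 : ∀ z : (W →ₗ[R] V) × (Fin k → (W →ₗ[R] R) × (W →ₗ[R] R)),
        (Fintype.card (W → W → R) : ℂ)⁻¹ * ∑ χ : AddChar (W → W → R) ℂ,
          χ (((fun l l' => B.form (z.1 l) (z.1 l')) - S.form) +
            ∑ i, wedge (z.2 i).1 (z.2 i).2) =
        if e z ∈ isometricMaps (B.orthSum ((hyp R).orthPow k)) S then 1 else 0 := by
      intro z
      rw [AddChar.sum_apply_eq_ite, ← hpull, mul_ite, mul_zero, inv_mul_cancel₀ hΓ]
      congr 1
      rw [sub_eq_zero, eq_iff_iff]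
      exact ⟨fun h x y => congrFun (congrFun h x) y, fun h => funext fun x => funext fun y => h x y⟩
    rw [Finset.sum_congr rfl fun z _ => h1 z, Finset.sum_boole]
    congr 1
    rw [← Fintype.card_subtype, ← Nat.card_eq_fintype_card]
    exact (Nat.card_congr (e.subtypeEquiv fun z => Iff.rfl)).symm
  rw [hcount, ← Finset.mul_sum, Finset.sum_comm, Polynomial.eval_finsetSum, Finset.sum_mul,
    Finset.mul_sum]
  refine Finset.sum_congr rfl fun χ _ => ?_
  have hχ : ∑ z : (W →ₗ[R] V) × (Fin k → (W →ₗ[R] R) × (W →ₗ[R] R)),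
      χ (((fun l l' => B.form (z.1 l) (z.1 l')) - S.form) + ∑ i, wedge (z.2 i).1 (z.2 i).2) =
      (∑ T : W →ₗ[R] V, χ ((fun l l' => B.form (T l) (T l')) - S.form)) *
        (∑ x : W →ₗ[R] R, ∑ y : W →ₗ[R] R, χ (wedge x y)) ^ k := by
    rw [← Fintype.sum_prod_type', Fintype.sum_pow, Finset.sum_mul_sum, ← Fintype.sum_prod_type']
    refine Finset.sum_congr rfl fun z _ => ?_
    rw [AddChar.map_add_eq_mul, χ.map_sum_eq_prod]
  have hgk : (∑ x : W →ₗ[R] R, ∑ y : W →ₗ[R] R, χ (wedge x y)) ^ k =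
      (((q : ℂ) ^ (2 * k))⁻¹) ^ j χ * ((Nat.card (W →ₗ[R] R) : ℂ) ^ 2) ^ k := by
    rw [Nat.card_eq_fintype_card, ← hj χ, mul_pow, inv_pow, ← pow_mul, ← pow_mul]
    have : (q : ℂ) ^ (2 * k * j χ) ≠ 0 := pow_ne_zero _ hq0
    rw [show 2 * j χ * k = 2 * k * j χ by ring]
    field_simp
  rw [hχ, hgk]
  simp only [eval_mul, eval_C, eval_pow, eval_X, c]
  ring

end SkewHermForm

/-! ### Discrete valuation and residue counts -/

section PadicIntegers

variable {p : ℕ} [Fact p.Prime] {K : Type*} [Field K] [Algebra ℚ_[p] K] [FiniteDimensional ℚ_[p] K]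

theorem mem_padicIntegers_or_inv_mem (x : K) : x ∈ padicIntegers p K ∨ x⁻¹ ∈ padicIntegers p K := by
  let _ := spectralNorm.normedField ℚ_[p] K
  have hn : ∀ y : K, ‖y‖ = spectralNorm ℚ_[p] K y := fun _ => rfl
  rw [mem_padicIntegers_iff_spectralNorm_le_one, mem_padicIntegers_iff_spectralNorm_le_one, ← hn,
    ← hn, norm_inv]
  rcases le_total ‖x‖ 1 with h | h
  · exact Or.inl h
  · exact Or.inr (inv_le_one_of_one_le₀ h)

theorem isUnit_two_padicIntegers (hp : p ≠ 2) : IsUnit (2 : padicIntegers p K) := by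
  rw [isUnit_padicIntegers_iff]
  have h : ((2 : padicIntegers p K) : K) = algebraMap ℚ_[p] K 2 := by
    rw [map_ofNat]
    rfl
  rw [h, spectralNorm_extends]
  have h1 : p.Coprime 2 := (Nat.coprime_primes (Fact.out : p.Prime) Nat.prime_two).mpr hp
  exact_mod_cast (Padic.norm_natCast_eq_one_iff (p := p)).mpr h1

theorem isDiscreteValuationRing_padicIntegers {ϖ : padicIntegers p K} (hϖ : Irreducible ϖ) :
    IsDiscreteValuationRing (padicIntegers p K) := by
  refine IsDiscreteValuationRing.ofHasUnitMulPowIrreducibleFactorization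
    ⟨ϖ, hϖ, fun {x} hx => ?_⟩
  obtain ⟨k, hk⟩ := exists_dvd_irreducible_pow hϖ hx
  induction k generalizing x with
  | zero =>
    rw [pow_zero] at hk
    exact ⟨0, by rw [pow_zero]; exact (associated_one_iff_isUnit.mpr (isUnit_of_dvd_one hk)).symm⟩
  | succ k ih =>
    rcases isUnit_or_irreducible_dvd hϖ x with h | ⟨y, rfl⟩
    · exact ⟨0, by rw [pow_zero]; exact (associated_one_iff_isUnit.mpr h).symm⟩
    · rw [pow_succ', mul_dvd_mul_iff_left hϖ.ne_zero] at hk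
      obtain ⟨n, hn⟩ := ih (right_ne_zero_of_mul hx) hk
      exact ⟨n + 1, by rw [pow_succ']; exact hn.mul_left ϖ⟩

theorem card_padicIntegers_quotient_pow {ϖ : padicIntegers p K} (hϖ : Irreducible ϖ) (k : ℕ) :
    Nat.card (padicIntegers p K ⧸ Ideal.span {ϖ ^ k}) =
      Nat.card (padicIntegers p K ⧸ Ideal.span {ϖ}) ^ k := by
  have := isDiscreteValuationRing_padicIntegers hϖ
  have hprime : (Ideal.span {ϖ}).IsPrime :=
    (Ideal.span_singleton_prime hϖ.ne_zero).mpr hϖ.prime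
  have h := cardQuot_pow_of_prime (P := Ideal.span {ϖ}) (i := k)
    (by rw [Ne, Ideal.span_singleton_eq_bot]; exact hϖ.ne_zero)
  rw [Ideal.span_singleton_pow] at h
  exact h

end PadicIntegers

/-! ### The involution on the ring of integers -/

namespace RamifiedQuadratic

variable {p : ℕ} [Fact p.Prime] {F₀ F : Type*} [Field F₀] [Field F]
  [Algebra ℚ_[p] F₀] [Algebra ℚ_[p] F] [Algebra F₀ F]

theorem finiteDimensional [FiniteDimensional ℚ_[p] F₀] [IsScalarTower ℚ_[p] F₀ F]
    (E : RamifiedQuadratic p F₀ F) : FiniteDimensional ℚ_[p] F := by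
  have : FiniteDimensional F₀ F := Module.finite_of_finrank_pos (by rw [E.finrank_eq_two]; omega)
  exact Module.Finite.trans F₀ F

theorem π_ne_zero (E : RamifiedQuadratic p F₀ F) : (E.π : F) ≠ 0 := fun h =>
  E.irreducible_π.ne_zero (Subtype.ext h)

theorem exists_eq_add_mul_π (E : RamifiedQuadratic p F₀ F) (x : F) :
    ∃ a b : F₀, x = algebraMap F₀ F a + algebraMap F₀ F b * E.π := by
  have : FiniteDimensional F₀ F := Module.finite_of_finrank_pos (by rw [E.finrank_eq_two]; omega)
  have hchar : (2 : F) ≠ 0 := by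
    have : CharZero F := charZero_of_injective_algebraMap (algebraMap ℚ_[p] F).injective
    exact two_ne_zero
  have hli : LinearIndependent F₀ ![(1 : F), (E.π : F)] := by
    rw [LinearIndependent.pair_iff]
    intro s t h
    have h' := congrArg E.conj h
    rw [map_add, map_smul, map_smul, map_one, E.conj_π, map_zero, smul_neg] at h'
    have h1 : (2 : F) * (s • (1 : F)) = 0 := by linear_combination h + h'
    have h2 := (mul_eq_zero.mp h1).resolve_left hchar
    have hs : s = 0 := (smul_eq_zero.mp h2).resolve_right one_ne_zero
    rw [hs, zero_smul, zero_add] at h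
    exact ⟨hs, (smul_eq_zero.mp h).resolve_right E.π_ne_zero⟩
  have hspan := hli.span_eq_top_of_card_eq_finrank' (by rw [E.finrank_eq_two, Fintype.card_fin])
  have hx : x ∈ Submodule.span F₀ (Set.range ![(1 : F), (E.π : F)]) := by
    rw [hspan]
    trivial
  rw [Matrix.range_cons, Matrix.range_cons, Matrix.range_empty, Set.union_empty,
    Set.singleton_union, Submodule.mem_span_pair] at hx
  obtain ⟨a, b, rfl⟩ := hx
  exact ⟨a, b, by rw [Algebra.smul_def, Algebra.smul_def, mul_one]⟩

variable [IsScalarTower ℚ_[p] F₀ F]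

theorem algebraMap_mem_padicIntegers_iff {x : F₀} :
    algebraMap F₀ F x ∈ padicIntegers p F ↔ x ∈ padicIntegers p F₀ := by
  have : IsScalarTower (PadicInt.subring p) F₀ F := by
    refine IsScalarTower.of_algebraMap_eq fun x => ?_
    exact IsScalarTower.algebraMap_apply ℚ_[p] F₀ F (x : ℚ_[p])
  rw [mem_padicIntegers_iff_isIntegral, mem_padicIntegers_iff_isIntegral]
  exact isIntegral_algebraMap_iff (algebraMap F₀ F).injective

theorem conj_mem_padicIntegers (E : RamifiedQuadratic p F₀ F) {x : F}
    (hx : x ∈ padicIntegers p F) : E.conj x ∈ padicIntegers p F := by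
  rw [mem_padicIntegers_iff_isIntegral] at hx ⊢
  exact hx.map ((E.conj.toAlgHom.restrictScalars ℚ_[p]).restrictScalars (PadicInt.subring p))

/-- The involution of the ring of integers. -/
noncomputable def conjInt (E : RamifiedQuadratic p F₀ F) : padicIntegers p F →+* padicIntegers p F :=
  (E.conj.toAlgHom.toRingHom.comp (padicIntegers p F).subtype).codRestrict _
    fun x => E.conj_mem_padicIntegers x.2

@[simp]
theorem coe_conjInt (E : RamifiedQuadratic p F₀ F) (x : padicIntegers p F) :
    (E.conjInt x : F) = E.conj x := rfl

theorem conjInt_conjInt (E : RamifiedQuadratic p F₀ F) (x : padicIntegers p F) :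
    E.conjInt (E.conjInt x) = x := Subtype.ext (E.conj_conj _)

theorem conjInt_π (E : RamifiedQuadratic p F₀ F) : E.conjInt E.π = -E.π := Subtype.ext E.conj_π

/-- The inclusion of the rings of integers. -/
noncomputable def inclInt (_E : RamifiedQuadratic p F₀ F) : padicIntegers p F₀ →+* padicIntegers p F :=
  ((algebraMap F₀ F).comp (padicIntegers p F₀).subtype).codRestrict _
    fun x => algebraMap_mem_padicIntegers_iff.mpr x.2

@[simp]
theorem coe_inclInt (E : RamifiedQuadratic p F₀ F) (x : padicIntegers p F₀) :
    (E.inclInt x : F) = algebraMap F₀ F x := rfl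

theorem conjInt_inclInt (E : RamifiedQuadratic p F₀ F) (x : padicIntegers p F₀) :
    E.conjInt (E.inclInt x) = E.inclInt x := Subtype.ext (E.conj.commutes _)

theorem inclInt_π₀ (E : RamifiedQuadratic p F₀ F) : E.inclInt E.π₀ = E.π ^ 2 :=
  Subtype.ext E.π_sq.symm

theorem conj_ofInt_pow_two (E : RamifiedQuadratic p F₀ F) (d : ℕ) :
    E.conjInt (E.π ^ (2 * d)) = E.π ^ (2 * d) := by
  rw [map_pow, conjInt_π, pow_mul, neg_sq, ← pow_mul]

variable [FiniteDimensional ℚ_[p] F₀]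

/-- For x = a + bπ, a is half the trace, hence integral, and so is b²π₀ = (x - a)². If b were not
integral, its inverse would be integral and a nonunit, b⁻¹ = π₀c; but then b = (b²π₀)c is integral
after all. -/
theorem exists_eq_inclInt_add (E : RamifiedQuadratic p F₀ F) (hp : p ≠ 2) (x : padicIntegers p F) :
    ∃ a b : padicIntegers p F₀, x = E.inclInt a + E.inclInt b * E.π := by
  have := E.finiteDimensional
  obtain ⟨a, b, hab⟩ := E.exists_eq_add_mul_π (x : F)
  obtain ⟨u, hu⟩ := isUnit_iff_exists_inv.mp (isUnit_two_padicIntegers (K := F) hp)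
  have hu' : (2 : F) * u = 1 := congrArg Subtype.val hu
  have hconj : E.conj (x : F) = algebraMap F₀ F a - algebraMap F₀ F b * E.π := by
    rw [hab, map_add, map_mul, E.conj.commutes, E.conj.commutes, E.conj_π]
    ring
  have ha : a ∈ padicIntegers p F₀ := by
    rw [← algebraMap_mem_padicIntegers_iff (F := F)]
    have : algebraMap F₀ F a = (u * (x + E.conjInt x) : padicIntegers p F) := by
      push_cast
      rw [coe_conjInt, hconj]
      linear_combination (-algebraMap F₀ F a) * hu' - (u : F) * hab
    rw [this]
    exact Subtype.coe_prop _
  have hb2 : b ^ 2 * E.π₀ ∈ padicIntegers p F₀ := by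
    rw [← algebraMap_mem_padicIntegers_iff (F := F)]
    have : algebraMap F₀ F (b ^ 2 * E.π₀) = ((x - E.inclInt ⟨a, ha⟩) ^ 2 : padicIntegers p F) := by
      rw [Subring.coe_pow, AddSubgroupClass.coe_sub, coe_inclInt, hab, map_mul, map_pow, ← E.π_sq]
      ring
    rw [this]
    exact Subtype.coe_prop _
  have hb : b ∈ padicIntegers p F₀ := by
    rcases mem_padicIntegers_or_inv_mem (p := p) b with h | h
    · exact h
    · by_cases hb0 : b = 0
      · rw [hb0]
        exact zero_mem _
      rcases isUnit_or_irreducible_dvd E.irreducible_π₀ ⟨b⁻¹, h⟩ with h1 | ⟨c, hc⟩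
      · obtain ⟨v, hv⟩ := isUnit_iff_exists_inv.mp h1
        have hv' : b⁻¹ * (v : F₀) = 1 := congrArg Subtype.val hv
        have : b = v := by
          field_simp at hv'
          exact hv'.symm
        rw [this]
        exact v.2
      · have hc' : b⁻¹ = (E.π₀ : F₀) * c := congrArg Subtype.val hc
        have : b = (⟨_, hb2⟩ * c : padicIntegers p F₀) := by
          push_cast
          rw [mul_assoc, ← hc']
          field_simp
        rw [this]
        exact Subtype.coe_prop _
  exact ⟨⟨a, ha⟩, ⟨b, hb⟩, Subtype.ext hab⟩

end RamifiedQuadratic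

/-! ### Residue rings modulo even powers of the uniformizer -/

namespace RamifiedQuadratic

variable {p : ℕ} [Fact p.Prime] {F₀ F : Type*} [Field F₀] [Field F]
  [Algebra ℚ_[p] F₀] [Algebra ℚ_[p] F] [Algebra F₀ F]

/-- The quotient of the ring of integers by the `2d`-th power of the uniformizer. -/
abbrev Residue (E : RamifiedQuadratic p F₀ F) (d : ℕ) : Type _ :=
  padicIntegers p F ⧸ Ideal.span {E.π ^ (2 * d)}

/-- The reduction map. -/
noncomputable abbrev toResidue (E : RamifiedQuadratic p F₀ F) (d : ℕ) :
    padicIntegers p F →+* E.Residue d :=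
  Ideal.Quotient.mk (Ideal.span {E.π ^ (2 * d)})

theorem toResidue_eq_zero_iff (E : RamifiedQuadratic p F₀ F) (d : ℕ) {x : padicIntegers p F} :
    E.toResidue d x = 0 ↔ E.π ^ (2 * d) ∣ x := by
  rw [Ideal.Quotient.eq_zero_iff_mem, Ideal.mem_span_singleton]

theorem toResidue_surjective (E : RamifiedQuadratic p F₀ F) (d : ℕ) :
    Function.Surjective (E.toResidue d) := Ideal.Quotient.mk_surjective

theorem one_lt_q [FiniteDimensional ℚ_[p] F₀] (E : RamifiedQuadratic p F₀ F) : 1 < E.q := by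
  have := finite_padicIntegers_quotient (K := F₀) E.irreducible_π₀.ne_zero
  have : Nontrivial (padicIntegers p F₀ ⧸ Ideal.span {E.π₀}) := by
    rw [Ideal.Quotient.nontrivial_iff, Ne, Ideal.span_singleton_eq_top]
    exact E.irreducible_π₀.not_isUnit
  exact Finite.one_lt_card

variable [IsScalarTower ℚ_[p] F₀ F]

noncomputable instance (E : RamifiedQuadratic p F₀ F) (d : ℕ) : StarRing (E.Residue d) where
  star := Ideal.quotientMap _ E.conjInt (by
    rw [Ideal.span_le, Set.singleton_subset_iff]
    simp only [Ideal.coe_comap, Set.mem_preimage, SetLike.mem_coe]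
    rw [E.conj_ofInt_pow_two]
    exact Ideal.mem_span_singleton_self _)
  star_involutive x := by
    obtain ⟨x, rfl⟩ := E.toResidue_surjective d x
    simp only [Ideal.quotientMap_mk, E.conjInt_conjInt]
  star_mul x y := by
    rw [map_mul, mul_comm]
  star_add x y := map_add _ x y

theorem star_toResidue (E : RamifiedQuadratic p F₀ F) (d : ℕ) (x : padicIntegers p F) :
    star (E.toResidue d x) = E.toResidue d (E.conjInt x) := rfl

variable [FiniteDimensional ℚ_[p] F₀]

theorem π_dvd_sub_conjInt (E : RamifiedQuadratic p F₀ F) (hp : p ≠ 2) (x : padicIntegers p F) :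
    E.π ∣ x - E.conjInt x := by
  obtain ⟨a, b, rfl⟩ := E.exists_eq_inclInt_add hp x
  refine ⟨2 * E.inclInt b, ?_⟩
  rw [map_add, map_mul, conjInt_inclInt, conjInt_inclInt, conjInt_π]
  ring

theorem isRamifiedQuotient (E : RamifiedQuadratic p F₀ F) (hp : p ≠ 2) {d : ℕ} (hd : 1 ≤ d) :
    IsRamifiedQuotient (E.Residue d) (E.toResidue d E.π) := by
  have := E.finiteDimensional
  obtain ⟨u, hu⟩ := isUnit_iff_exists_inv.mp (isUnit_two_padicIntegers (K := F) hp)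
  refine ⟨?_, ?_, ?_, ?_, ?_, ?_, ?_⟩
  · rw [Ideal.Quotient.nontrivial_iff, Ne, Ideal.span_singleton_eq_top]
    exact fun h => E.irreducible_π.not_isUnit ((isUnit_pow_iff (by omega)).mp h)
  · rw [star_toResidue, conjInt_π, map_neg]
  · have h := (isUnit_two_padicIntegers (K := F) hp).map (E.toResidue d)
    rwa [map_ofNat] at h
  · intro x
    obtain ⟨x, rfl⟩ := E.toResidue_surjective d x
    rcases isUnit_or_irreducible_dvd E.irreducible_π x with h | h
    · exact Or.inl (h.map _)
    · exact Or.inr (map_dvd _ h)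
  · intro x
    obtain ⟨x, rfl⟩ := E.toResidue_surjective d x
    rw [star_toResidue, ← map_sub]
    exact map_dvd _ (E.π_dvd_sub_conjInt hp x)
  · exact ⟨2 * d, by rw [← map_pow, toResidue_eq_zero_iff]⟩
  · intro y hy h
    obtain ⟨x, rfl⟩ := E.toResidue_surjective d y
    rw [star_toResidue, ← sub_eq_zero, ← map_sub, toResidue_eq_zero_iff] at hy
    rw [← map_mul, toResidue_eq_zero_iff, show 2 * d = (2 * d - 1) + 1 by omega, pow_succ',
      mul_dvd_mul_iff_left E.irreducible_π.ne_zero] at h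
    rw [toResidue_eq_zero_iff]
    obtain ⟨c, hc⟩ := h
    have hodd : E.conjInt (E.π ^ (2 * d - 1)) = -E.π ^ (2 * d - 1) := by
      rw [map_pow, conjInt_π, Odd.neg_pow ⟨d - 1, by omega⟩]
    have h1 : E.conjInt x = -E.π ^ (2 * d - 1) * E.conjInt c := by
      rw [hc, map_mul, hodd]
    have h2 : E.π ^ (2 * d) ∣ x + E.conjInt x := by
      obtain ⟨e, he⟩ := E.π_dvd_sub_conjInt hp c
      refine ⟨e, ?_⟩
      rw [show 2 * d = (2 * d - 1) + 1 by omega, pow_succ, h1]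
      linear_combination hc + E.π ^ (2 * d - 1) * he
    have h3 := dvd_add h2 hy
    have h4 : x + E.conjInt x + (E.conjInt x - x) = 2 * E.conjInt x := by ring
    have h5 : x = u * (2 * x) := by linear_combination (-x) * hu
    have h6 : 2 * x = (x + E.conjInt x) - (E.conjInt x - x) := by ring
    rw [h5, h6]
    exact Dvd.dvd.mul_left (dvd_sub h2 hy) _

instance finite_residue (E : RamifiedQuadratic p F₀ F) (d : ℕ) : Finite (E.Residue d) := by
  have := E.finiteDimensional
  exact finite_padicIntegers_quotient (pow_ne_zero _ E.irreducible_π.ne_zero)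

/-- Ramification: a + bπ is congruent to a, so the two residue fields coincide. -/
theorem card_quotient_π (E : RamifiedQuadratic p F₀ F) (hp : p ≠ 2) :
    Nat.card (padicIntegers p F ⧸ Ideal.span {E.π}) = E.q := by
  have := E.finiteDimensional
  let f : padicIntegers p F₀ →+* padicIntegers p F ⧸ Ideal.span {E.π} :=
    (Ideal.Quotient.mk _).comp E.inclInt
  have hsurj : Function.Surjective f := by
    intro y
    obtain ⟨x, rfl⟩ := Ideal.Quotient.mk_surjective y
    obtain ⟨a, b, rfl⟩ := E.exists_eq_inclInt_add hp x
    refine ⟨a, Ideal.Quotient.eq.mpr (Ideal.mem_span_singleton.mpr ⟨-E.inclInt b, ?_⟩)⟩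
    ring
  have hker : RingHom.ker f = Ideal.span {E.π₀} := by
    ext x
    rw [RingHom.mem_ker, RingHom.comp_apply, Ideal.Quotient.eq_zero_iff_mem,
      Ideal.mem_span_singleton, Ideal.mem_span_singleton]
    constructor
    · intro h
      refine (isUnit_or_irreducible_dvd E.irreducible_π₀ x).resolve_left fun hu => ?_
      exact E.irreducible_π.not_isUnit (isUnit_of_dvd_unit h (hu.map E.inclInt))
    · rintro ⟨c, rfl⟩
      rw [map_mul, inclInt_π₀, sq, mul_assoc]
      exact dvd_mul_right _ _
  rw [← Nat.card_congr (RingHom.quotientKerEquivOfSurjective hsurj).toEquiv, hker]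
  rfl

theorem card_residue (E : RamifiedQuadratic p F₀ F) (hp : p ≠ 2) (d : ℕ) :
    Nat.card (E.Residue d) = E.q ^ (2 * d) := by
  have := E.finiteDimensional
  rw [card_padicIntegers_quotient_pow E.irreducible_π, E.card_quotient_π hp]

theorem card_residue_quotient (E : RamifiedQuadratic p F₀ F) (hp : p ≠ 2) {d : ℕ} (hd : 1 ≤ d) :
    Nat.card (E.Residue d ⧸ Ideal.span {E.toResidue d E.π}) = E.q := by
  rw [← E.card_quotient_π hp]
  let f : padicIntegers p F →+* E.Residue d ⧸ Ideal.span {E.toResidue d E.π} :=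
    (Ideal.Quotient.mk _).comp (E.toResidue d)
  have hsurj : Function.Surjective f :=
    Ideal.Quotient.mk_surjective.comp (E.toResidue_surjective d)
  have hker : RingHom.ker f = Ideal.span {E.π} := by
    ext x
    rw [RingHom.mem_ker, RingHom.comp_apply, Ideal.Quotient.eq_zero_iff_mem,
      Ideal.mem_span_singleton, Ideal.mem_span_singleton]
    constructor
    · rintro ⟨c, hc⟩
      obtain ⟨c, rfl⟩ := E.toResidue_surjective d c
      rw [← map_mul, ← sub_eq_zero, ← map_sub, toResidue_eq_zero_iff] at hc
      have h1 : E.π ∣ x - E.π * c := (dvd_pow_self _ (by omega)).trans hc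
      simpa using dvd_add h1 (dvd_mul_right E.π c)
    · exact fun h => map_dvd _ h
  rw [← Nat.card_congr (RingHom.quotientKerEquivOfSurjective hsurj).toEquiv, hker]

/-- Skew and fixed elements are equally many, and the product of their numbers is |R| = q^{2d}. -/
theorem card_skew_residue (E : RamifiedQuadratic p F₀ F) (hp : p ≠ 2) {d : ℕ} (hd : 1 ≤ d) :
    Nat.card {x : E.Residue d | star x = -x} = E.q ^ d := by
  have hR := E.isRamifiedQuotient hp hd
  have := hR.isUnit_two.invertible
  have h := Nat.card_eq_skew_mul_symm (R := E.Residue d)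
  rw [hR.card_star_eq_self, E.card_residue hp, ← sq] at h
  have h' : (E.q ^ d) ^ 2 = E.q ^ (2 * d) := by ring
  rw [← h'] at h
  exact (Nat.pow_left_injective two_ne_zero h).symm

theorem card_not_isUnit_residue (E : RamifiedQuadratic p F₀ F) (hp : p ≠ 2) {d : ℕ} (hd : 1 ≤ d) :
    Nat.card {x : E.Residue d | ¬ IsUnit x} * E.q = Nat.card (E.Residue d) := by
  have hR := E.isRamifiedQuotient hp hd
  rw [Submodule.card_eq_card_quotient_mul_card (Ideal.span {E.toResidue d E.π}),
    E.card_residue_quotient hp hd]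
  congr 1
  exact Nat.card_congr (Equiv.subtypeEquivRight fun x => by
    rw [Set.mem_ofPred_eq, hR.not_isUnit_iff, Ideal.mem_span_singleton])

end RamifiedQuadratic

/-! ### From hermitian lattices to skew-hermitian modules over residue rings -/

namespace RamifiedQuadratic

variable {p : ℕ} [Fact p.Prime] {F₀ F : Type*} [Field F₀] [Field F]
  [Algebra ℚ_[p] F₀] [Algebra ℚ_[p] F] [Algebra F₀ F]
variable {E : RamifiedQuadratic p F₀ F}
variable {L : Type*} [AddCommGroup L] [Module (padicIntegers p F) L]
variable {M : Type*} [AddCommGroup M] [Module (padicIntegers p F) M]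
variable {d : ℕ}

namespace HermForm

/-- The form takes values in `π⁻¹ O_F`. -/
def IsIntegral (h : HermForm E L) : Prop :=
  ∀ x y, ∃ c : padicIntegers p F, (E.π : F) * h.form x y = c

theorem sum_smul_left (h : HermForm E L) {ι : Type*} (s : Finset ι) (a : ι → padicIntegers p F)
    (x : ι → L) (y : L) : h.form (∑ i ∈ s, a i • x i) y = ∑ i ∈ s, (a i : F) * h.form (x i) y := by
  let f : L →ₗ[padicIntegers p F] F :=
    { toFun := fun x => h.form x y
      map_add' := fun x x' => h.add_left x x' y
      map_smul' := fun a x => h.smul_left a x y }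
  have : f (∑ i ∈ s, a i • x i) = _ := map_sum f _ _
  rw [show h.form (∑ i ∈ s, a i • x i) y = f (∑ i ∈ s, a i • x i) from rfl, this]
  exact Finset.sum_congr rfl fun i _ => h.smul_left _ _ _

theorem sum_smul_right (h : HermForm E L) {ι : Type*} (s : Finset ι) (a : ι → padicIntegers p F)
    (x : L) (y : ι → L) :
    h.form x (∑ i ∈ s, a i • y i) = ∑ i ∈ s, E.conj (a i : F) * h.form x (y i) := by
  rw [h.conj_symm _ x, sum_smul_left, map_sum]
  exact Finset.sum_congr rfl fun i _ => by rw [map_mul, ← h.conj_symm]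

/-- `G` is the Gram matrix of `π h` in the basis `b`. -/
def IsGram (h : HermForm E L) {κ : Type*} (b : Module.Basis κ (padicIntegers p F) L)
    (G : Matrix κ κ (padicIntegers p F)) : Prop :=
  ∀ i j, (E.π : F) * h.form (b i) (b j) = G i j

theorem IsIntegral.exists_isGram {h : HermForm E L} (hh : h.IsIntegral) {κ : Type*}
    (b : Module.Basis κ (padicIntegers p F) L) : ∃ G, h.IsGram b G := by
  choose G hG using fun i j => hh (b i) (b j)
  exact ⟨G, hG⟩

/-- A single map in the set would show that πh differs from integral values by multiples of π^{2d},
making L integral. -/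
theorem card_hermHoms_eq_zero {h : HermForm E L} {h' : HermForm E M} (hd : 1 ≤ d)
    (hh : ¬ h.IsIntegral) (hh' : h'.IsIntegral) : Nat.card (hermHoms h' h d) = 0 := by
  rw [Nat.card_eq_zero]
  refine Or.inl ⟨fun φ => hh fun x y => ?_⟩
  obtain ⟨x', hx'⟩ := Submodule.Quotient.mk_surjective _ (φ.1 (Submodule.Quotient.mk x))
  obtain ⟨y', hy'⟩ := Submodule.Quotient.mk_surjective _ (φ.1 (Submodule.Quotient.mk y))
  obtain ⟨c, hc⟩ := φ.2 x y x' y' hx'.symm hy'.symm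
  obtain ⟨c', hc'⟩ := hh' x' y'
  refine ⟨c' - E.π ^ (2 * d) * c, ?_⟩
  push_cast
  rw [← hc', show 2 * d = 2 * d - 1 + 1 by omega, pow_succ', mul_assoc, ← hc]
  ring

end HermForm

variable [IsScalarTower ℚ_[p] F₀ F]
variable {V : Type*} [AddCommGroup V] [Module (E.Residue d) V]
variable {W : Type*} [AddCommGroup W] [Module (E.Residue d) W]

/-- The map `ρ` identifies the skew-hermitian module `(V, B)` with the reduction of `(L, π h)`
modulo `π ^ (2 d)`. -/
structure IsReduction (h : HermForm E L) (B : SkewHermForm (E.Residue d) V)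
    (ρ : L →ₛₗ[E.toResidue d] V) : Prop where
  surjective : Function.Surjective ρ
  exists_eq_smul : ∀ x, ρ x = 0 → ∃ y, x = E.π ^ (2 * d) • y
  form : ∀ x y, ∃ c : padicIntegers p F, (E.π : F) * h.form x y = c ∧
    B.form (ρ x) (ρ y) = E.toResidue d c

namespace IsReduction

variable {h : HermForm E L} {B : SkewHermForm (E.Residue d) V} {ρ : L →ₛₗ[E.toResidue d] V}
variable {h' : HermForm E M} {B' : SkewHermForm (E.Residue d) W} {ρ' : M →ₛₗ[E.toResidue d] W}

theorem isIntegral (H : IsReduction h B ρ) : h.IsIntegral := fun x y =>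
  (H.form x y).imp fun _ hc => hc.1

theorem apply_eq_zero_iff (H : IsReduction h B ρ) {x : L} :
    ρ x = 0 ↔ x ∈ (Ideal.span {E.π ^ (2 * d)} • ⊤ : Submodule (padicIntegers p F) L) := by
  rw [Submodule.ideal_span_singleton_smul, Submodule.mem_smul_pointwise_iff_exists]
  constructor
  · intro hx
    obtain ⟨y, rfl⟩ := H.exists_eq_smul x hx
    exact ⟨y, trivial, rfl⟩
  · rintro ⟨y, -, rfl⟩
    rw [map_smulₛₗ, (E.toResidue_eq_zero_iff d).mpr dvd_rfl, zero_smul]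

theorem apply_eq_apply_iff (H : IsReduction h B ρ) {x y : L} :
    ρ x = ρ y ↔ (Submodule.Quotient.mk x : HermForm.Quot E L d) = Submodule.Quotient.mk y := by
  rw [Submodule.Quotient.eq, ← H.apply_eq_zero_iff, map_sub, sub_eq_zero]

theorem orthSum (H : IsReduction h B ρ) (H' : IsReduction h' B' ρ') :
    ∃ r : L × M →ₛₗ[E.toResidue d] V × W, IsReduction (h.orthSum h') (B.orthSum B') r := by
  refine ⟨{ toFun := fun x => (ρ x.1, ρ' x.2), map_add' := fun x y => ?_,
            map_smul' := fun a x => ?_ }, ⟨?_, ?_, ?_⟩⟩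
  · simp only [Prod.fst_add, Prod.snd_add, map_add, Prod.mk_add_mk]
  · simp only [Prod.smul_fst, Prod.smul_snd, map_smulₛₗ, Prod.smul_mk]
  · rintro ⟨v, w⟩
    obtain ⟨x, rfl⟩ := H.surjective v
    obtain ⟨y, rfl⟩ := H'.surjective w
    exact ⟨(x, y), rfl⟩
  · rintro ⟨x, y⟩ hxy
    obtain ⟨hx, hy⟩ := Prod.mk.inj hxy
    obtain ⟨x', rfl⟩ := H.exists_eq_smul x hx
    obtain ⟨y', rfl⟩ := H'.exists_eq_smul y hy
    exact ⟨(x', y'), rfl⟩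
  · intro x y
    obtain ⟨c, hc, hB⟩ := H.form x.1 y.1
    obtain ⟨c', hc', hB'⟩ := H'.form x.2 y.2
    refine ⟨c + c', ?_, ?_⟩
    · change (E.π : F) * (h.form x.1 y.1 + h'.form x.2 y.2) = _
      rw [mul_add, hc, hc']
      rfl
    · rw [map_add, ← hB, ← hB']
      rfl

theorem orthPow (H : IsReduction h B ρ) (k : ℕ) :
    ∃ r : (Fin k → L) →ₛₗ[E.toResidue d] (Fin k → V),
      IsReduction (h.orthPow k) (B.orthPow k) r := by
  refine ⟨{ toFun := fun x i => ρ (x i), map_add' := fun x y => ?_,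
            map_smul' := fun a x => ?_ }, ⟨?_, ?_, ?_⟩⟩
  · funext i
    exact map_add ρ _ _
  · funext i
    exact map_smulₛₗ ρ _ _
  · intro v
    choose x hx using fun i => H.surjective (v i)
    exact ⟨x, funext hx⟩
  · intro x hx
    choose y hy using fun i => H.exists_eq_smul (x i) (congrFun hx i)
    exact ⟨y, funext hy⟩
  · intro x y
    choose c hc hB using fun i => H.form (x i) (y i)
    refine ⟨∑ i, c i, ?_, ?_⟩
    · change (E.π : F) * ∑ i, h.form (x i) (y i) = _
      rw [Finset.mul_sum, AddSubmonoidClass.coe_finsetSum]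
      exact Finset.sum_congr rfl fun i _ => hc i
    · rw [map_sum]
      change ∑ i, B.form (ρ (x i)) (ρ (y i)) = _
      exact Finset.sum_congr rfl fun i _ => hB i

/-- The identification of the quotient with its model. -/
noncomputable def quotEquiv (H : IsReduction h B ρ) : HermForm.Quot E L d ≃+ V :=
  AddEquiv.ofBijective
    (QuotientAddGroup.lift (Ideal.span {E.π ^ (2 * d)} • ⊤ : Submodule (padicIntegers p F)
      L).toAddSubgroup ρ.toAddMonoidHom fun _ hx => H.apply_eq_zero_iff.mpr hx)
    ⟨fun x y => by
      obtain ⟨x, rfl⟩ := Submodule.Quotient.mk_surjective _ x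
      obtain ⟨y, rfl⟩ := Submodule.Quotient.mk_surjective _ y
      exact fun hxy => H.apply_eq_apply_iff.mp hxy,
    fun v => by
      obtain ⟨x, rfl⟩ := H.surjective v
      exact ⟨Submodule.Quotient.mk x, rfl⟩⟩

theorem quotEquiv_mk (H : IsReduction h B ρ) (x : L) :
    H.quotEquiv (Submodule.Quotient.mk x) = ρ x := rfl

theorem quotEquiv_smul (H : IsReduction h B ρ) (a : padicIntegers p F) (x : HermForm.Quot E L d) :
    H.quotEquiv (a • x) = E.toResidue d a • H.quotEquiv x := by
  obtain ⟨x, rfl⟩ := Submodule.Quotient.mk_surjective _ x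
  rw [← Submodule.Quotient.mk_smul, quotEquiv_mk, quotEquiv_mk, map_smulₛₗ]

theorem quotEquiv_symm_smul (H : IsReduction h B ρ) (a : padicIntegers p F) (v : V) :
    H.quotEquiv.symm (E.toResidue d a • v) = a • H.quotEquiv.symm v := by
  rw [AddEquiv.symm_apply_eq, quotEquiv_smul, AddEquiv.apply_symm_apply]

/-- Multiplication by π raises the modulus from π^{2d-1} to π^{2d}; with d ≥ 1 the natural
subtraction is not truncated. -/
theorem form_eq_form_iff (hd : 1 ≤ d) (H : IsReduction h B ρ) (H' : IsReduction h' B' ρ')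
    (x y : L) (x' y' : M) : B'.form (ρ' x') (ρ' y') = B.form (ρ x) (ρ y) ↔
      ∃ c : padicIntegers p F,
      h'.form x' y' - h.form x y = (E.π : F) ^ (2 * d - 1) * (c : F) := by
  have hπ : (E.π : F) ^ (2 * d) = E.π * (E.π : F) ^ (2 * d - 1) := by
    rw [← pow_succ']
    congr 1
    omega
  obtain ⟨c, hc, hB⟩ := H.form x y
  obtain ⟨c', hc', hB'⟩ := H'.form x' y'
  rw [hB, hB', ← sub_eq_zero, ← map_sub, toResidue_eq_zero_iff]
  refine exists_congr fun a => ?_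
  rw [Subtype.ext_iff, ← mul_right_inj' E.π_ne_zero (b := _ - _), mul_sub, hc, hc']
  push_cast
  rw [hπ, mul_assoc]

theorem mem_hermHoms_iff (hd : 1 ≤ d) (H : IsReduction h B ρ) (H' : IsReduction h' B' ρ')
    (φ : HermForm.Quot E L d →ₗ[padicIntegers p F] HermForm.Quot E M d) :
    φ ∈ HermForm.hermHoms h' h d ↔ ∀ x y, B'.form (H'.quotEquiv (φ x)) (H'.quotEquiv (φ y)) =
      B.form (H.quotEquiv x) (H.quotEquiv y) := by
  constructor
  · intro hφ x y
    obtain ⟨x, rfl⟩ := Submodule.Quotient.mk_surjective _ x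
    obtain ⟨y, rfl⟩ := Submodule.Quotient.mk_surjective _ y
    obtain ⟨x', hx'⟩ := Submodule.Quotient.mk_surjective _ (φ (Submodule.Quotient.mk x))
    obtain ⟨y', hy'⟩ := Submodule.Quotient.mk_surjective _ (φ (Submodule.Quotient.mk y))
    rw [← hx', ← hy']
    exact (form_eq_form_iff hd H H' x y x' y').mpr (hφ x y x' y' hx'.symm hy'.symm)
  · intro hφ x y x' y' hx hy
    refine (form_eq_form_iff hd H H' x y x' y').mp ?_
    have := hφ (Submodule.Quotient.mk x) (Submodule.Quotient.mk y)
    rwa [hx, hy] at this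

theorem card_hermHoms (hd : 1 ≤ d) (H : IsReduction h B ρ) (H' : IsReduction h' B' ρ') :
    Nat.card (HermForm.hermHoms h' h d) = Nat.card (SkewHermForm.isometricMaps B' B) := by
  have hmem := mem_hermHoms_iff hd H H'
  have h₁ := H.quotEquiv_symm_smul
  have h₁' := H'.quotEquiv_symm_smul
  have h₂ := H.quotEquiv_smul
  have h₂' := H'.quotEquiv_smul
  generalize H.quotEquiv = e at hmem h₁ h₂
  generalize H'.quotEquiv = e' at hmem h₁' h₂'
  refine Nat.card_congr
    { toFun := fun φ => ⟨
        { toFun := fun v => e' (φ.1 (e.symm v))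
          map_add' := fun v w => by simp only [map_add]
          map_smul' := fun a v => ?_ }, fun v w => ?_⟩
      invFun := fun T => ⟨
        { toFun := fun x => e'.symm (T.1 (e x))
          map_add' := fun v w => by simp only [map_add]
          map_smul' := fun a x => ?_ }, (hmem _).mpr fun x y => ?_⟩
      left_inv := fun φ => Subtype.ext (LinearMap.ext fun x => ?_)
      right_inv := fun T => Subtype.ext (LinearMap.ext fun x => ?_) }
  · obtain ⟨a, rfl⟩ := E.toResidue_surjective d a
    rw [h₁, map_smul, h₂']
    rfl
  · change B'.form (e' _) (e' _) = _
    rw [(hmem φ.1).mp φ.2, e.apply_symm_apply, e.apply_symm_apply]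
  · rw [h₂, map_smul, h₁']
    rfl
  · change B'.form (e' (e'.symm _)) (e' (e'.symm _)) = _
    rw [e'.apply_symm_apply, e'.apply_symm_apply, T.2]
  · change e'.symm (e' (φ.1 (e.symm (e x)))) = φ.1 x
    rw [e'.symm_apply_apply, e.symm_apply_apply]
  · change e' (e'.symm (T.1 (e (e.symm x)))) = T.1 x
    rw [e'.apply_symm_apply, e.apply_symm_apply]

theorem hyperbolic (E : RamifiedQuadratic p F₀ F) (d : ℕ) :
    ∃ r : padicIntegers p F × padicIntegers p F →ₛₗ[E.toResidue d] E.Residue d × E.Residue d,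
      IsReduction E.hyperbolic (SkewHermForm.hyp (E.Residue d)) r := by
  refine ⟨{ toFun := fun x => (E.toResidue d x.1, E.toResidue d x.2), map_add' := fun x y => ?_,
            map_smul' := fun a x => ?_ }, ⟨?_, ?_, ?_⟩⟩
  · simp only [Prod.fst_add, Prod.snd_add, map_add, Prod.mk_add_mk]
  · simp only [Prod.smul_fst, Prod.smul_snd, smul_eq_mul, map_mul, Prod.smul_mk]
  · rintro ⟨v, w⟩
    obtain ⟨x, rfl⟩ := E.toResidue_surjective d v
    obtain ⟨y, rfl⟩ := E.toResidue_surjective d w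
    exact ⟨(x, y), rfl⟩
  · rintro ⟨x, y⟩ hxy
    obtain ⟨hx, hy⟩ := Prod.mk.inj hxy
    obtain ⟨x', rfl⟩ := (E.toResidue_eq_zero_iff d).mp hx
    obtain ⟨y', rfl⟩ := (E.toResidue_eq_zero_iff d).mp hy
    exact ⟨(x', y'), rfl⟩
  · intro x y
    refine ⟨x.1 * E.conjInt y.2 - x.2 * E.conjInt y.1, ?_, ?_⟩
    · change (E.π : F) * (_ - _) = _
      have := E.π_ne_zero
      push_cast
      rw [coe_conjInt, coe_conjInt]
      field_simp
    · simp only [map_sub, map_mul, ← star_toResidue]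
      rfl

theorem rankOne (E : RamifiedQuadratic p F₀ F) (d : ℕ) {ε : F₀} {s : padicIntegers p F}
    (hs : (s : F) = E.π * algebraMap F₀ F ε) {t : E.Residue d} (ht : star t = -t)
    (hts : t = E.toResidue d s) :
    ∃ r : padicIntegers p F →ₛₗ[E.toResidue d] E.Residue d,
      IsReduction (E.rankOne ε) (SkewHermForm.line t ht) r := by
  refine ⟨{ toFun := fun x => E.toResidue d x, map_add' := fun x y => map_add _ x y,
            map_smul' := fun a x => ?_ }, ⟨E.toResidue_surjective d, ?_, ?_⟩⟩
  · rw [smul_eq_mul, smul_eq_mul, map_mul]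
  · exact fun x hx => (E.toResidue_eq_zero_iff d).mp hx
  · intro x y
    refine ⟨x * s * E.conjInt y, ?_, ?_⟩
    · change (E.π : F) * (_ * _ * _) = _
      push_cast
      rw [coe_conjInt, hs]
      ring
    · simp only [map_mul, ← star_toResidue, ← hts]
      rfl

end IsReduction

namespace HermForm

variable {κ : Type*} {b : Module.Basis κ (padicIntegers p F) L}
variable {G : Matrix κ κ (padicIntegers p F)} {h : HermForm E L}

theorem IsGram.conjInt (hG : h.IsGram b G) (i j : κ) : E.conjInt (G i j) = -G j i := by
  refine Subtype.ext ?_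
  rw [coe_conjInt, ← hG, map_mul, E.conj_π, ← h.conj_symm]
  push_cast
  rw [← hG, neg_mul]

theorem IsGram.conjTranspose_map (hG : h.IsGram b G) (d : ℕ) :
    (G.map (E.toResidue d)).conjTranspose = -G.map (E.toResidue d) := by
  ext i j
  rw [Matrix.conjTranspose_apply, Matrix.map_apply, star_toResidue, hG.conjInt, map_neg]
  rfl

theorem IsGram.form_eq_sum [Fintype κ] (hG : h.IsGram b G) (x y : L) :
    (E.π : F) * h.form x y =
      ((∑ i, ∑ j, b.repr x i * G i j * E.conjInt (b.repr y j) : padicIntegers p F) : F) := by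
  conv_lhs => rw [← b.sum_repr x, ← b.sum_repr y]
  rw [sum_smul_left, Finset.mul_sum, AddSubmonoidClass.coe_finsetSum]
  refine Finset.sum_congr rfl fun i _ => ?_
  rw [sum_smul_right, Finset.mul_sum, Finset.mul_sum, AddSubmonoidClass.coe_finsetSum]
  refine Finset.sum_congr rfl fun j _ => ?_
  push_cast
  rw [← hG i j, coe_conjInt]
  ring

theorem IsGram.isReduction [Fintype κ] (hG : h.IsGram b G) (d : ℕ) :
    ∃ r : L →ₛₗ[E.toResidue d] (κ → E.Residue d),
      IsReduction h (SkewHermForm.ofMatrix _ (hG.conjTranspose_map d)) r := by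
  refine ⟨{ toFun := fun x i => E.toResidue d (b.repr x i), map_add' := fun x y => ?_,
            map_smul' := fun a x => ?_ }, ⟨?_, ?_, ?_⟩⟩
  · funext i
    simp
  · funext i
    simp
  · intro v
    choose x hx using fun i => E.toResidue_surjective d (v i)
    refine ⟨b.equivFun.symm x, funext fun i => ?_⟩
    rw [← hx i]
    change E.toResidue d (b.equivFun (b.equivFun.symm x) i) = _
    rw [LinearEquiv.apply_symm_apply]
  · intro x hx
    choose y hy using fun i => (E.toResidue_eq_zero_iff d).mp (congrFun hx i)
    refine ⟨b.equivFun.symm y, b.equivFun.injective (funext fun i => ?_)⟩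
    rw [map_smul, LinearEquiv.apply_symm_apply]
    exact hy i
  · intro x y
    refine ⟨_, hG.form_eq_sum x y, ?_⟩
    simp only [map_sum, map_mul, ← star_toResidue]
    change _ ⬝ᵥ _ = _
    simp only [dotProduct, Matrix.mulVec, Finset.mul_sum, Matrix.map_apply, Pi.star_apply,
      LinearMap.coe_mk, AddHom.coe_mk, mul_assoc]

end HermForm
end RamifiedQuadratic

/-! ### Passage from level d to level d + 1 -/

/-- Solution of the linearized equation for a congruence modulo a high power of the
uniformizer. -/
theorem Matrix.exists_skewHermitian_correction {R : Type*} [CommRing R] [StarRing R]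
    [Invertible (2 : R)] {ι : Type*} [Fintype ι] [DecidableEq ι] {ϖ : R} (hϖ : star ϖ = -ϖ)
    {d e : ℕ} (hd : 2 * e + 1 ≤ d) (hpow : ∀ k, 2 * (d + 1) ≤ k → ϖ ^ k = 0)
    {T T' A : Matrix ι ι R} (hSS : T' * T = ϖ ^ (2 * e) • 1) (hS : T.conjTranspose = -T)
    (hW : (ϖ ^ (2 * d) • A).conjTranspose = -(ϖ ^ (2 * d) • A)) :
    ∃ Z : Matrix ι ι R, Z * T + T * Z.conjTranspose = ϖ ^ (2 * d) • A ∧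
      Z * Z = 0 ∧ Z * T * Z.conjTranspose = 0 ∧
      ∀ K : Matrix ι ι R, Z * (ϖ ^ (2 * d) • K) = 0 ∧ (ϖ ^ (2 * d) • K) * Z.conjTranspose = 0 := by
  have hi : star (⅟2 : R) = ⅟2 := SkewHermForm.star_invOf_two
  have hstar : ∀ k, star (ϖ ^ (2 * k)) = ϖ ^ (2 * k) := by
    intro k
    rw [star_pow, hϖ, Even.neg_pow (even_two_mul k)]
  have hZT : ((⅟2 * ϖ ^ (2 * (d - e))) • (A * T')) * T = (⅟2 : R) • ϖ ^ (2 * d) • A := by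
    rw [Matrix.smul_mul, mul_assoc, hSS, Matrix.mul_smul, mul_one, smul_smul, smul_smul, mul_assoc,
      ← pow_add]
    congr 3
    omega
  have hZH : ((⅟2 * ϖ ^ (2 * (d - e))) • (A * T')).conjTranspose =
      (⅟2 * ϖ ^ (2 * (d - e))) • (A * T').conjTranspose := by
    rw [Matrix.conjTranspose_smul, star_mul', hi, hstar]
  -- As T' inverts T up to ϖ^{2e}, this is half of W T⁻¹ for W = ϖ^{2d}A, and each of the two terms
  -- of the linearized equation is W/2. The quadratic terms vanish because 4(d - e) ≥ 2(d + 1),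
  -- which is the bound d ≥ 2e + 1.
  refine ⟨(⅟2 * ϖ ^ (2 * (d - e))) • (A * T'), ?_, ?_, ?_, ?_⟩
  · have : T * ((⅟2 * ϖ ^ (2 * (d - e))) • (A * T')).conjTranspose = (⅟2 : R) • ϖ ^ (2 * d) • A := by
      rw [← Matrix.conjTranspose_conjTranspose T, ← Matrix.conjTranspose_mul, hS, Matrix.mul_neg,
        hZT, Matrix.conjTranspose_neg, Matrix.conjTranspose_smul, hW, hi, smul_neg, neg_neg]
    rw [hZT, this, ← add_smul, invOf_two_add_invOf_two, one_smul]
  · rw [Matrix.smul_mul, Matrix.mul_smul, smul_smul,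
      show ⅟2 * ϖ ^ (2 * (d - e)) * (⅟2 * ϖ ^ (2 * (d - e))) =
        ⅟2 * ⅟2 * ϖ ^ (2 * (d - e) + 2 * (d - e)) by ring, hpow _ (by omega), mul_zero, zero_smul]
  · rw [hZT, hZH, Matrix.smul_mul, Matrix.smul_mul, Matrix.mul_smul, smul_smul, smul_smul,
      show ⅟2 * ϖ ^ (2 * d) * (⅟2 * ϖ ^ (2 * (d - e))) =
        ⅟2 * ⅟2 * ϖ ^ (2 * d + 2 * (d - e)) by ring, hpow _ (by omega), mul_zero, zero_smul]
  · intro K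
    rw [hZH, Matrix.smul_mul, Matrix.mul_smul, Matrix.smul_mul, Matrix.mul_smul, smul_smul,
      smul_smul, show ⅟2 * ϖ ^ (2 * (d - e)) * ϖ ^ (2 * d) =
        ⅟2 * ϖ ^ (2 * d + 2 * (d - e)) by ring, show ϖ ^ (2 * d) * (⅟2 * ϖ ^ (2 * (d - e))) =
        ⅟2 * ϖ ^ (2 * d + 2 * (d - e)) by ring, hpow _ (by omega), mul_zero, zero_smul, zero_smul]
    exact ⟨rfl, rfl⟩

namespace RamifiedQuadratic

variable {p : ℕ} [Fact p.Prime] {F₀ F : Type*} [Field F₀] [Field F]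
  [Algebra ℚ_[p] F₀] [Algebra ℚ_[p] F] [Algebra F₀ F]

/-- The transition map between consecutive residue rings. -/
noncomputable abbrev residueMap (E : RamifiedQuadratic p F₀ F) (d : ℕ) :
    E.Residue (d + 1) →+* E.Residue d :=
  Ideal.Quotient.factor (by
    rw [Ideal.span_singleton_le_span_singleton]
    exact pow_dvd_pow _ (by omega))

theorem residueMap_toResidue (E : RamifiedQuadratic p F₀ F) (d : ℕ) (x : padicIntegers p F) :
    E.residueMap d (E.toResidue (d + 1) x) = E.toResidue d x := rfl

theorem residueMap_surjective (E : RamifiedQuadratic p F₀ F) (d : ℕ) :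
    Function.Surjective (E.residueMap d) := fun y => by
  obtain ⟨x, rfl⟩ := E.toResidue_surjective d y
  exact ⟨E.toResidue (d + 1) x, rfl⟩

theorem exists_eq_mul_of_residueMap_eq_zero (E : RamifiedQuadratic p F₀ F) (d : ℕ)
    {x : E.Residue (d + 1)} (hx : E.residueMap d x = 0) :
    ∃ y, x = E.toResidue (d + 1) E.π ^ (2 * d) * y := by
  obtain ⟨x, rfl⟩ := E.toResidue_surjective _ x
  rw [residueMap_toResidue, toResidue_eq_zero_iff] at hx
  obtain ⟨y, rfl⟩ := hx
  exact ⟨E.toResidue _ y, by rw [map_mul, map_pow]⟩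

theorem toResidue_π_pow_eq_zero (E : RamifiedQuadratic p F₀ F) {d k : ℕ} (hk : 2 * d ≤ k) :
    E.toResidue d E.π ^ k = 0 := by
  rw [← map_pow, toResidue_eq_zero_iff]
  exact pow_dvd_pow _ hk

namespace HermForm

variable {E : RamifiedQuadratic p F₀ F}
variable {L : Type*} [AddCommGroup L] [Module (padicIntegers p F) L]
variable {M : Type*} [AddCommGroup M] [Module (padicIntegers p F) M]

theorem IsGram.det_ne_zero [IsScalarTower ℚ_[p] F₀ F] {κ : Type*} [Fintype κ] [DecidableEq κ]
    {b : Module.Basis κ (padicIntegers p F) L} {G : Matrix κ κ (padicIntegers p F)}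
    {h : HermForm E L} (hG : h.IsGram b G) (hh : h.Nondegenerate) : G.det ≠ 0 := by
  intro hdet
  obtain ⟨v, hv, hvG⟩ := Matrix.exists_vecMul_eq_zero_iff.mpr hdet
  refine hv (b.equivFun.symm.injective ?_)
  rw [map_zero]
  refine hh _ fun y => mul_left_cancel₀ E.π_ne_zero ?_
  rw [hG.form_eq_sum, mul_zero, Finset.sum_comm]
  have : ∀ i, b.repr (b.equivFun.symm v) i = v i := fun i =>
    congrFun (b.equivFun.apply_symm_apply v) i
  simp only [this, ← Finset.sum_mul]
  rw [Finset.sum_eq_zero, ZeroMemClass.coe_zero]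
  intro j _
  have : ∑ i, v i * G i j = 0 := congrFun hvG j
  rw [this, zero_mul]

/-- A nondegenerate Gram matrix divides a power of the uniformizer. -/
theorem IsGram.exists_mul_eq [IsScalarTower ℚ_[p] F₀ F] [FiniteDimensional ℚ_[p] F₀]
    {κ : Type*} [Fintype κ] [DecidableEq κ]
    {b : Module.Basis κ (padicIntegers p F) L} {G : Matrix κ κ (padicIntegers p F)}
    {h : HermForm E L} (hG : h.IsGram b G) (hh : h.Nondegenerate) :
    ∃ (e : ℕ) (G' : Matrix κ κ (padicIntegers p F)), G' * G = E.π ^ (2 * e) • 1 := by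
  have := E.finiteDimensional
  obtain ⟨e, c, hc⟩ := exists_dvd_irreducible_pow E.irreducible_π (hG.det_ne_zero hh)
  refine ⟨e, (E.π ^ e * c) • G.adjugate, ?_⟩
  rw [Matrix.smul_mul, Matrix.adjugate_mul, smul_smul]
  congr 1
  rw [two_mul, pow_add, mul_assoc, mul_comm c, ← hc]

end HermForm

variable [IsScalarTower ℚ_[p] F₀ F]

theorem residueMap_star (E : RamifiedQuadratic p F₀ F) (d : ℕ) (x : E.Residue (d + 1)) :
    E.residueMap d (star x) = star (E.residueMap d x) := by
  obtain ⟨x, rfl⟩ := E.toResidue_surjective _ x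
  rw [star_toResidue, residueMap_toResidue, residueMap_toResidue, star_toResidue]

variable [FiniteDimensional ℚ_[p] F₀]

theorem card_ker_residueMap (E : RamifiedQuadratic p F₀ F) (hp : p ≠ 2) (d : ℕ) :
    Nat.card (RingHom.ker (E.residueMap d)) = E.q ^ 2 := by
  have h : Nat.card (E.Residue (d + 1)) = Nat.card (E.Residue d) * Nat.card
      (RingHom.ker (E.residueMap d)) := by
    rw [Submodule.card_eq_card_quotient_mul_card (RingHom.ker (E.residueMap d)), mul_comm,
      Nat.card_congr
        (RingHom.quotientKerEquivOfSurjective (E.residueMap_surjective d)).toEquiv]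
  generalize Nat.card (RingHom.ker (E.residueMap d)) = k at h ⊢
  rw [E.card_residue hp, E.card_residue hp] at h
  refine Nat.eq_of_mul_eq_mul_left (pow_pos (by have := E.one_lt_q; omega) (2 * d)) (h.symm.trans ?_)
  ring

/-- Reduction is surjective on skew elements, since (x - star x)/2 lifts the image of x when that is
skew. The kernel thus has q^{d+1}/q^d elements. -/
theorem card_skew_ker_residueMap (E : RamifiedQuadratic p F₀ F) (hp : p ≠ 2) {d : ℕ} (hd : 1 ≤ d) :
    Nat.card {x : E.Residue (d + 1) | star x = -x ∧ E.residueMap d x = 0} = E.q := by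
  have hR := E.isRamifiedQuotient hp (d := d + 1) (by omega)
  have := hR.isUnit_two.invertible
  have hi : star (⅟2 : E.Residue (d + 1)) = ⅟2 := SkewHermForm.star_invOf_two
  let A : AddSubgroup (E.Residue (d + 1)) :=
    { carrier := {x | star x = -x}
      add_mem' := fun {x y} hx hy => by
        rw [Set.mem_ofPred_eq] at *
        rw [star_add, hx, hy, neg_add]
      zero_mem' := by
        rw [Set.mem_ofPred_eq, star_zero, neg_zero]
      neg_mem' := fun {x} hx => by
        rw [Set.mem_ofPred_eq] at *
        rw [star_neg, hx] }
  let A' : AddSubgroup (E.Residue d) :=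
    { carrier := {x | star x = -x}
      add_mem' := fun {x y} hx hy => by
        rw [Set.mem_ofPred_eq] at *
        rw [star_add, hx, hy, neg_add]
      zero_mem' := by
        rw [Set.mem_ofPred_eq, star_zero, neg_zero]
      neg_mem' := fun {x} hx => by
        rw [Set.mem_ofPred_eq] at *
        rw [star_neg, hx] }
  let f : A →+ A' := AddMonoidHom.mk' (fun x => ⟨E.residueMap d x.1, by
      have hx : star x.1 = -x.1 := x.2
      change star _ = -_
      rw [← residueMap_star, hx, map_neg]⟩) fun x y => Subtype.ext (map_add _ _ _)
  have hf : Function.Surjective f := by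
    rintro ⟨y, hy⟩
    obtain ⟨x, rfl⟩ := E.residueMap_surjective d y
    have hy' : star (E.residueMap d x) = -E.residueMap d x := hy
    refine ⟨⟨⅟2 * (x - star x), ?_⟩, Subtype.ext ?_⟩
    · change star _ = -_
      rw [star_mul', hi, star_sub, star_star]
      ring
    · change E.residueMap d (⅟2 * (x - star x)) = E.residueMap d x
      rw [map_mul, map_sub, residueMap_star, hy', sub_neg_eq_add, ← map_add, ← map_mul,
        ← two_mul, invOf_mul_cancel_left]
  have h := AddMonoidHom.card_eq_card_mul_card_ker f hf
  have h1 : Nat.card A = E.q ^ (d + 1) := E.card_skew_residue hp (by omega)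
  have h2 : Nat.card A' = E.q ^ d := E.card_skew_residue hp hd
  rw [h1, h2, pow_succ] at h
  rw [Nat.eq_of_mul_eq_mul_left (pow_pos (by have := E.one_lt_q; omega) _) h]
  exact Nat.card_congr
    { toFun := fun x => ⟨⟨x.1, x.2.1⟩, Subtype.ext x.2.2⟩
      invFun := fun x => ⟨x.1.1, x.1.2, congrArg Subtype.val x.2⟩
      left_inv := fun _ => rfl
      right_inv := fun _ => rfl }

theorem exists_lift_correction (E : RamifiedQuadratic p F₀ F) (hp : p ≠ 2) {ι : Type*} [Fintype ι]
    [DecidableEq ι] {S S' : Matrix ι ι (padicIntegers p F)} {d e : ℕ}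
    (hS' : S' * S = E.π ^ (2 * e) • 1) (hd : 2 * e + 1 ≤ d)
    (hS : (S.map (E.toResidue (d + 1))).conjTranspose = -S.map (E.toResidue (d + 1)))
    (W : Matrix ι ι (E.Residue (d + 1))) (hW : W.conjTranspose = -W)
    (hWf : W.map (E.residueMap d) = 0) :
    ∃ Z : Matrix ι ι (E.Residue (d + 1)),
      Z * S.map (E.toResidue (d + 1)) + S.map (E.toResidue (d + 1)) * Z.conjTranspose = W ∧
      Z * Z = 0 ∧ Z * S.map (E.toResidue (d + 1)) * Z.conjTranspose = 0 ∧
      ∀ K : Matrix ι ι (E.Residue (d + 1)), K.map (E.residueMap d) = 0 →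
        Z * K = 0 ∧ K * Z.conjTranspose = 0 := by
  have hR := E.isRamifiedQuotient hp (d := d + 1) (by omega)
  have := hR.isUnit_two.invertible
  have hker : ∀ K : Matrix ι ι (E.Residue (d + 1)), K.map (E.residueMap d) = 0 →
      ∃ A : Matrix ι ι (E.Residue (d + 1)), K = E.toResidue (d + 1) E.π ^ (2 * d) • A := by
    intro K hK
    choose A hA using fun i j => E.exists_eq_mul_of_residueMap_eq_zero d
      (show E.residueMap d (K i j) = 0 from congrFun (congrFun hK i) j)
    exact ⟨A, Matrix.ext hA⟩
  have hpow : ∀ k, 2 * (d + 1) ≤ k → E.toResidue (d + 1) E.π ^ k = 0 := fun k hk =>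
    E.toResidue_π_pow_eq_zero hk
  have hSS : S'.map (E.toResidue (d + 1)) * S.map (E.toResidue (d + 1)) =
      E.toResidue (d + 1) E.π ^ (2 * e) • 1 := by
    rw [← Matrix.map_mul, hS', Matrix.map_smul' _ _ _ (map_mul _), map_pow,
      Matrix.map_one _ (map_zero _) (map_one _)]
  obtain ⟨A, rfl⟩ := hker W hWf
  obtain ⟨Z, h1, h2, h3, h4⟩ :=
    Matrix.exists_skewHermitian_correction hR.star_π hd hpow hSS hS hW
  refine ⟨Z, h1, h2, h3, fun K hK => ?_⟩
  obtain ⟨K, rfl⟩ := hker K hK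
  exact h4 K

namespace HermForm

variable {E : RamifiedQuadratic p F₀ F}
variable {L : Type*} [AddCommGroup L] [Module (padicIntegers p F) L]
variable {M : Type*} [AddCommGroup M] [Module (padicIntegers p F) M]
variable {ι κ : Type*} [Fintype ι] [Fintype κ] [DecidableEq ι]

/-- With n and m the ranks, q^{n²} counts the skew-hermitian defects and q^{2nm} the lifts of a
matrix. Their quotient q^{n(2m-n)} is the ratio of consecutive normalizations of the density. -/
theorem IsGram.card_hermHoms_succ (hp : p ≠ 2) {h : HermForm E L} {h' : HermForm E M}
    {b : Module.Basis ι (padicIntegers p F) L} {S S' : Matrix ι ι (padicIntegers p F)}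
    {b' : Module.Basis κ (padicIntegers p F) M} {G : Matrix κ κ (padicIntegers p F)}
    (hS : h.IsGram b S) (hG : h'.IsGram b' G) {d e : ℕ} (hS' : S' * S = E.π ^ (2 * e) • 1)
    (hd : 2 * e + 1 ≤ d) :
    Nat.card (hermHoms h' h (d + 1)) * E.q ^ (Fintype.card ι * Fintype.card ι) =
      Nat.card (hermHoms h' h d) * (E.q ^ 2) ^ (Fintype.card ι * Fintype.card κ) := by
  obtain ⟨r₁, H₁⟩ := hS.isReduction (d + 1)
  obtain ⟨r₂, H₂⟩ := hG.isReduction (d + 1)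
  obtain ⟨r₃, H₃⟩ := hS.isReduction d
  obtain ⟨r₄, H₄⟩ := hG.isReduction d
  have hR := E.isRamifiedQuotient hp (d := d + 1) (by omega)
  have := hR.isUnit_two.invertible
  rw [H₁.card_hermHoms (by omega) H₂, H₃.card_hermHoms (by omega) H₄,
    SkewHermForm.card_isometricMaps_ofMatrix, SkewHermForm.card_isometricMaps_ofMatrix]
  have h1 := card_matrix_lift (E.residueMap d) (E.residueMap_surjective d) (E.residueMap_star d)
    (hG.conjTranspose_map (d + 1)) (hS.conjTranspose_map (d + 1))
    (E.exists_lift_correction hp hS' hd (hS.conjTranspose_map (d + 1)))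
  rw [card_skewHermitian_ker (E.residueMap d) (E.residueMap_star d) hR
    (E.isRamifiedQuotient hp (d := d) (by omega)), E.card_skew_ker_residueMap hp (by omega),
    E.card_ker_residueMap hp] at h1
  exact h1

end HermForm

end RamifiedQuadratic

/-! ### Existence and uniqueness of density polynomials -/

/-- A complex polynomial with rational values at infinitely many rational points agrees there
with a rational polynomial. -/
theorem Polynomial.exists_rat_eval_eq (P : ℂ[X]) {x y : ℕ → ℚ} (hx : Function.Injective x)
    (h : ∀ k, P.eval (x k : ℂ) = y k) : ∃ Q : ℚ[X], ∀ k, Q.eval (x k) = y k := by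
  let s := Finset.range (P.natDegree + 1)
  have hs : Set.InjOn x s := hx.injOn
  refine ⟨Lagrange.interpolate s x y, fun k => ?_⟩
  have hxc : Set.InjOn (fun i => ((x i : ℚ) : ℂ)) s := fun i _ j _ hij =>
    hx (Rat.cast_injective hij)
  -- The rational interpolant on deg P + 1 nodes agrees with P there, so it is P itself.
  have key : (Lagrange.interpolate s x y).map (algebraMap ℚ ℂ) = P := by
    refine eq_of_degrees_lt_of_eval_index_eq s hxc ?_ ?_ fun i hi => ?_
    · rw [degree_map]
      exact Lagrange.degree_interpolate_lt _ hs
    · rw [Finset.card_range]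
      exact degree_le_natDegree.trans_lt (by exact_mod_cast Nat.lt_succ_self _)
    · have : ((x i : ℚ) : ℂ) = algebraMap ℚ ℂ (x i) := rfl
      rw [h, this, eval_map_apply, Lagrange.eval_interpolate_at_node _ hs hi]
      rfl
  have h1 := h k
  have : ((x k : ℚ) : ℂ) = algebraMap ℚ ℂ (x k) := rfl
  rw [← key, this, eval_map_apply] at h1
  exact (algebraMap ℚ ℂ).injective h1

namespace RamifiedQuadratic

variable {p : ℕ} [Fact p.Prime] {F₀ F : Type*} [Field F₀] [Field F]
  [Algebra ℚ_[p] F₀] [Algebra ℚ_[p] F] [Algebra F₀ F]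

theorem injective_inv_q_pow [FiniteDimensional ℚ_[p] F₀] (E : RamifiedQuadratic p F₀ F) :
    Function.Injective fun k : ℕ => ((E.q : ℚ) ^ (2 * k))⁻¹ := by
  intro i j hij
  have hq : (1 : ℚ) < E.q := by exact_mod_cast E.one_lt_q
  have := pow_right_injective₀ (by linarith) hq.ne' (inv_injective hij)
  simpa using this

variable {E : RamifiedQuadratic p F₀ F}
variable {L : Type*} [AddCommGroup L] [Module (padicIntegers p F) L]
variable {M : Type*} [AddCommGroup M] [Module (padicIntegers p F) M]

namespace HermForm

theorem IsDensityPoly.eq [FiniteDimensional ℚ_[p] F₀] {h : HermForm E L} {h' : HermForm E M} {P Q : ℚ[X]}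
    (hP : IsDensityPoly h' h P) (hQ : IsDensityPoly h' h Q) : P = Q := by
  refine Polynomial.eq_of_infinite_eval_eq P Q
    ((Set.infinite_range_of_injective E.injective_inv_q_pow).mono ?_)
  rintro _ ⟨k, rfl⟩
  exact Rat.cast_injective (tendsto_nhds_unique (hP k) (hQ k))

theorem IsDensityPoly.densityPoly_eq [FiniteDimensional ℚ_[p] F₀] {h : HermForm E L} {h' : HermForm E M} {P : ℚ[X]}
    (hP : IsDensityPoly h' h P) : densityPoly h' h = P := by
  have hex : ∃ P, IsDensityPoly h' h P := ⟨P, hP⟩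
  rw [densityPoly, dif_pos hex]
  exact hex.choose_spec.eq hP

end HermForm

variable [IsScalarTower ℚ_[p] F₀ F]

theorem isReduction_orthSum_hyperbolic {d : ℕ} {V : Type*} [AddCommGroup V]
    [Module (E.Residue d) V] {h : HermForm E L} {B : SkewHermForm (E.Residue d) V}
    {ρ : L →ₛₗ[E.toResidue d] V} (H : IsReduction h B ρ) (k : ℕ) :
    ∃ r : L × (Fin k → padicIntegers p F × padicIntegers p F) →ₛₗ[E.toResidue d]
        V × (Fin k → E.Residue d × E.Residue d),
      IsReduction (h.orthSum (E.hyperbolic.orthPow k))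
        (B.orthSum ((SkewHermForm.hyp (E.Residue d)).orthPow k)) r := by
  obtain ⟨r₁, H₁⟩ := IsReduction.hyperbolic E d
  obtain ⟨r₂, H₂⟩ := H₁.orthPow k
  exact H.orthSum H₂

namespace HermForm

theorem IsIntegral.orthSum_hyperbolic {h : HermForm E L} (hh : h.IsIntegral) (k : ℕ) :
    (h.orthSum (E.hyperbolic.orthPow k)).IsIntegral := by
  obtain ⟨r₁, H₁⟩ := IsReduction.hyperbolic E 0
  obtain ⟨r₂, H₂⟩ := H₁.orthPow k
  intro x y
  obtain ⟨c, hc⟩ := hh x.1 y.1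
  obtain ⟨c', hc'⟩ := H₂.isIntegral x.2 y.2
  refine ⟨c + c', ?_⟩
  change (E.π : F) * (_ + _) = _
  rw [mul_add, hc, hc']
  rfl

variable [FiniteDimensional ℚ_[p] F₀]
variable [Module.Free (padicIntegers p F) L] [Module.Finite (padicIntegers p F) L]
variable [Module.Free (padicIntegers p F) M] [Module.Finite (padicIntegers p F) M]

theorem finrank_orthSum_hyperbolic (k : ℕ) :
    Module.finrank (padicIntegers p F) (M × (Fin k → padicIntegers p F × padicIntegers p F)) =
      Module.finrank (padicIntegers p F) M + 2 * k := by
  rw [Module.finrank_prod, Module.finrank_pi_fintype, Finset.sum_const, Module.finrank_prod,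
    Module.finrank_self, Finset.card_univ, Fintype.card_fin, smul_eq_mul]
  ring

/-- The density sequence is eventually constant, from a rank that depends only on the source. -/
theorem exists_densitySeq_eq {h : HermForm E L} (hp : p ≠ 2) (hh : h.IsIntegral)
    (hnd : h.Nondegenerate) : ∃ d₀ : ℕ, 1 ≤ d₀ ∧ ∀ {M : Type*} [AddCommGroup M]
      [Module (padicIntegers p F) M] [Module.Free (padicIntegers p F) M]
      [Module.Finite (padicIntegers p F) M] {h' : HermForm E M}, h'.IsIntegral →
      Module.finrank (padicIntegers p F) L ≤ 2 * Module.finrank (padicIntegers p F) M →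
      ∀ d, d₀ ≤ d → densitySeq h' h d = densitySeq h' h d₀ := by
  classical
  obtain ⟨S, hS⟩ := hh.exists_isGram (Module.Free.chooseBasis (padicIntegers p F) L)
  obtain ⟨e, S', hS'⟩ := hS.exists_mul_eq hnd
  -- Here π^{2e} clears the denominators of the inverse Gram matrix of L. The target does not enter,
  -- so one level serves M ⊥ H^k for all k.
  refine ⟨2 * e + 1, by omega, ?_⟩
  intro M _ _ _ _ h' hh' hnm d hd
  obtain ⟨G, hG⟩ := hh'.exists_isGram (Module.Free.chooseBasis (padicIntegers p F) M)
  induction d, hd using Nat.le_induction with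
  | base => rfl
  | succ d hd ih =>
    rw [← ih]
    have hstep := hS.card_hermHoms_succ hp hG hS' hd
    rw [← Module.finrank_eq_card_chooseBasisIndex, ← Module.finrank_eq_card_chooseBasisIndex]
      at hstep
    have hq : (0 : ℝ) < E.q := by
      have := E.one_lt_q
      exact_mod_cast (by omega : 0 < E.q)
    unfold densitySeq
    generalize Module.finrank (padicIntegers p F) L = n at *
    generalize Module.finrank (padicIntegers p F) M = m at *
    obtain ⟨c, hc⟩ := Nat.exists_eq_add_of_le hnm
    have hsub : 2 * m - n = c := by omega
    rw [hsub, div_eq_div_iff (pow_pos hq _).ne' (pow_pos hq _).ne']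
    have hexp : 2 * (n * m) = n * n + n * c := by
      rw [← mul_add, ← hc]
      ring
    rw [← pow_mul, hexp, pow_add, mul_comm (E.q ^ _) (E.q ^ _), ← mul_assoc] at hstep
    have h2 := Nat.eq_of_mul_eq_mul_right (pow_pos (by exact_mod_cast hq) _) hstep
    have h3 : (Nat.card (hermHoms h' h (d + 1)) : ℝ) = Nat.card (hermHoms h' h d) *
      (E.q : ℝ) ^ (n * c) := by exact_mod_cast h2
    rw [h3, add_mul, one_mul, pow_add]
    ring

/-- At the common stable level d, the number of maps is a polynomial in q^{-2k} times
|Hom(L/π^{2d}L, R)|^{2k} = q^{4dnk}, which is exactly the growth of the normalization with k. A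
nonintegral L has the zero polynomial. -/
theorem exists_isDensityPoly {h : HermForm E L} {h' : HermForm E M} (hp : p ≠ 2)
    (hnd : h.Nondegenerate) (hh' : h'.IsIntegral)
    (hnm : Module.finrank (padicIntegers p F) L ≤ 2 * Module.finrank (padicIntegers p F) M) :
    ∃ P : ℚ[X], IsDensityPoly h' h P := by
  by_cases hh : h.IsIntegral
  swap
  · refine ⟨0, fun k => ?_⟩
    rw [eval_zero, Rat.cast_zero]
    refine tendsto_const_nhds.congr' (eventually_atTop.mpr ⟨1, fun d hd => ?_⟩)
    rw [densitySeq, card_hermHoms_eq_zero hd hh (hh'.orthSum_hyperbolic k), Nat.cast_zero, zero_div]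
  obtain ⟨d, hd, hconst⟩ := exists_densitySeq_eq hp hh hnd
  obtain ⟨S, hS⟩ := hh.exists_isGram (Module.Free.chooseBasis (padicIntegers p F) L)
  obtain ⟨G, hG⟩ := hh'.exists_isGram (Module.Free.chooseBasis (padicIntegers p F) M)
  obtain ⟨r, H⟩ := hS.isReduction d
  obtain ⟨r', H'⟩ := hG.isReduction d
  have hR := E.isRamifiedQuotient hp hd
  have := hR.isUnit_two.invertible
  have hq : (0 : ℝ) < E.q := by
    have := E.one_lt_q
    exact_mod_cast (by omega : 0 < E.q)
  obtain ⟨P, hP⟩ := SkewHermForm.exists_polynomial_card_isometricMaps hR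
    (SkewHermForm.ofMatrix _ (hG.conjTranspose_map d))
    (SkewHermForm.ofMatrix _ (hS.conjTranspose_map d))
  set n := Module.finrank (padicIntegers p F) L with hn
  set m := Module.finrank (padicIntegers p F) M with hm
  have hdual : Nat.card ((Module.Free.ChooseBasisIndex (padicIntegers p F) L → E.Residue d)
      →ₗ[E.Residue d] E.Residue d) = E.q ^ (2 * d * n) := by
    rw [← Nat.card_congr (Module.piEquiv _ (E.Residue d) (E.Residue d)).toEquiv, Nat.card_fun,
      E.card_residue hp, Nat.card_eq_fintype_card, ← Module.finrank_eq_card_chooseBasisIndex,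
      ← pow_mul]
  have hval : ∀ k, (densitySeq (h'.orthSum (E.hyperbolic.orthPow k)) h d : ℂ) =
      (C (((E.q : ℂ) ^ (d * (n * (2 * m - n))))⁻¹) * P).eval (((E.q : ℂ) ^ (2 * k))⁻¹) := by
    intro k
    obtain ⟨r'', H''⟩ := isReduction_orthSum_hyperbolic H' k
    rw [densitySeq, H.card_hermHoms hd H'', eval_mul, eval_C, finrank_orthSum_hyperbolic]
    push_cast
    rw [hP, E.card_residue_quotient hp hd, hdual, ← hn, ← hm,
      show 2 * (m + 2 * k) - n = 2 * m - n + 4 * k by omega,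
      show d * (n * (2 * m - n + 4 * k)) = d * (n * (2 * m - n)) + 2 * d * n * (2 * k) by ring,
      pow_add]
    have hqc : (E.q : ℂ) ≠ 0 := by exact_mod_cast hq.ne'
    push_cast
    rw [← pow_mul, ← pow_mul]
    field_simp
  obtain ⟨Q, hQ⟩ := Polynomial.exists_rat_eval_eq _ E.injective_inv_q_pow
    (y := fun k => (Nat.card (hermHoms (h'.orthSum (E.hyperbolic.orthPow k)) h d) : ℚ) /
      (E.q : ℚ) ^ (d * (n * (2 * (m + 2 * k) - n)))) fun k => by
      have := hval k
      push_cast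
      rw [← this, densitySeq, finrank_orthSum_hyperbolic]
      push_cast
      rfl
  refine ⟨Q, fun k => ?_⟩
  refine tendsto_const_nhds.congr' (eventually_atTop.mpr ⟨d, fun d' hd' => ?_⟩)
  rw [hconst (hh'.orthSum_hyperbolic k) (by rw [finrank_orthSum_hyperbolic]; omega) d' hd', hQ,
    densitySeq, finrank_orthSum_hyperbolic]
  push_cast
  rfl

end HermForm

end RamifiedQuadratic

/-! ### Splitting the line of value -π off maps to hyperbolic spaces -/

namespace SkewHermForm

variable {R : Type*} [CommRing R] [StarRing R] {π : R}
variable {V : Type*} [AddCommGroup V] [Module R V]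
variable {W : Type*} [AddCommGroup W] [Module R W]
variable {U : Type*} [AddCommGroup U] [Module R U]

/-- If π divided all coordinates, π² would divide the value, so π = π²z; as π is nilpotent, 1 - πz
is a unit and π = 0, a contradiction. -/
theorem isUnimodular_of_form_self_eq (hR : IsRamifiedQuotient R π) [Subsingleton U] {m : ℕ}
    (C : SkewHermForm R U) {v : (Fin m → R × R) × U}
    (hv : (((hyp R).orthPow m).orthSum C).form v v = -π) : IsUnimodular v.1 := by
  by_contra hnot
  have hdvd : ∀ i, π ∣ (v.1 i).1 ∧ π ∣ (v.1 i).2 := by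
    intro i
    rw [← hR.not_isUnit_iff, ← hR.not_isUnit_iff]
    exact not_or.mp fun h => hnot ⟨i, h⟩
  have h3 : π * π ∣ (((hyp R).orthPow m).orthSum C).form v v := by
    rw [orthSum_form, show v.2 = 0 from Subsingleton.elim _ _, C.zero_left, add_zero]
    change π * π ∣ ∑ i, (hyp R).form (v.1 i) (v.1 i)
    refine Finset.dvd_sum fun i _ => ?_
    obtain ⟨⟨a, ha⟩, b, hb⟩ := hdvd i
    refine ⟨b * star a - a * star b, ?_⟩
    rw [hyp_form, ha, hb, star_mul', star_mul', hR.star_π]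
    ring
  rw [hv, dvd_neg] at h3
  obtain ⟨z, hz⟩ := h3
  obtain ⟨n, hn⟩ := hR.isNilpotent_π
  have hu : IsUnit (1 - π * z) :=
    IsNilpotent.isUnit_one_sub (Commute.isNilpotent_mul_right (Commute.all _ _) ⟨n, hn⟩)
  refine hR.π_ne_zero (hu.mul_left_eq_zero.mp ?_)
  linear_combination hz

theorem exists_isIsometry_orthPow_absorb (B : SkewHermForm R V) (C : SkewHermForm R U) (s k : ℕ) :
    ∃ e, IsIsometry (((B.orthPow s).orthSum C).orthSum (B.orthPow k))
      ((B.orthPow (s + k)).orthSum C) e := by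
  obtain ⟨e, he⟩ := exists_isIsometry_append B s k
  exact ⟨_, ((((isIsometry_prodAssoc _ _ _).trans
    ((isIsometry_refl _).prodCongr (isIsometry_prodComm C (B.orthPow k)))).trans
    (isIsometry_prodAssoc _ _ _).symm)).trans (he.prodCongr (isIsometry_refl C))⟩

theorem exists_isIsometry_orthPow_zero (B : SkewHermForm R V) (C : SkewHermForm R U) :
    ∃ e, IsIsometry (B.orthSum (C.orthPow 0)) B e :=
  ⟨LinearEquiv.prodUnique, fun x y => by
    rw [orthSum_form]
    have : (C.orthPow 0).form x.2 y.2 = 0 :=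
      Fin.sum_univ_zero fun i => C.form (x.2 i) (y.2 i)
    rw [this, add_zero]
    rfl⟩

/-- The numbers of planes and lines are variables tied by equations because they are later `n / 2`,
`n % 2` and their analogues for `n + 1`, on which the types depend. -/
theorem card_isometricMaps_std_orthSum_line [Finite R] [Invertible (2 : R)] [Finite W]
    (hR : IsRamifiedQuotient R π) (B' : SkewHermForm R W) {s r s' r' k : ℕ} (hr : r = 0)
    (hs : s = s' + 1) (hr' : r' = 1) {q : ℕ} (hq : 0 < q)
    (hcard : Nat.card {x : R | ¬ IsUnit x} * q = Nat.card R) (hπ' : star (-π) = - -π) :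
    (Nat.card (isometricMaps
      ((((hyp R).orthPow s).orthSum ((line π hR.star_π).orthPow r)).orthSum ((hyp R).orthPow k))
      (B'.orthSum (line (-π) hπ'))) : ℝ) * Nat.card {x : R | star x = -x} =
    Nat.card (isometricMaps
      ((((hyp R).orthPow s').orthSum ((line π hR.star_π).orthPow r')).orthSum ((hyp R).orthPow k))
      B') * ((Nat.card R : ℝ) ^ (2 * (s + k)) * (1 - ((q : ℝ) ^ (2 * (s + k)))⁻¹)) := by
  subst hr hs hr'
  obtain ⟨e₁, h₁⟩ := exists_isIsometry_orthPow_absorb (hyp R) ((line π hR.star_π).orthPow 0)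
    (s' + 1) k
  obtain ⟨e₂, h₂⟩ := exists_isIsometry_orthPow_absorb (hyp R) ((line π hR.star_π).orthPow 1) s' k
  obtain ⟨e₃, h₃⟩ := exists_isIsometry_orthPow_one (line π hR.star_π)
  obtain ⟨e₄, h₄⟩ := exists_isIsometry_orthPow_zero ((hyp R).orthPow (s' + k)) (line π hR.star_π)
  rw [card_isometricMaps_congr_left h₁, card_isometricMaps_congr_left
    ((h₂.trans ((isIsometry_refl _).prodCongr h₃)).trans (h₄.symm.prodCongr (isIsometry_refl _))),
    show s' + 1 + k = s' + k + 1 by ring]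
  have hprim := fun v => isUnimodular_of_form_self_eq hR (m := s' + k + 1)
    ((line π hR.star_π).orthPow 0) (v := v)
  rw [card_isometricMaps_orthSum_line _ _ _ hR.star_π hπ' hprim]
  have h := card_isUnimodular_form_eq hR (s' + k + 1) ((line π hR.star_π).orthPow 0) hπ' hq hcard
  rw [Set.ext fun v => (and_iff_right_of_imp (hprim v) : v ∈ {v | v ∈ {x | IsUnimodular x.1} ∧
    (((hyp R).orthPow (s' + k + 1)).orthSum ((line π hR.star_π).orthPow 0)).form v v = -π} ↔
    v ∈ {v | (((hyp R).orthPow (s' + k + 1)).orthSum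
      ((line π hR.star_π).orthPow 0)).form v v = -π})] at h
  rw [Nat.card_unique (α := Fin 0 → R), Nat.cast_one, mul_one] at h
  push_cast
  rw [← h]
  ring

end SkewHermForm

/-! ### Density sequences of the standard lattices and the product formula at finite level -/

namespace RamifiedQuadratic

variable {p : ℕ} [Fact p.Prime] {F₀ F : Type*} [Field F₀] [Field F]
  [Algebra ℚ_[p] F₀] [Algebra ℚ_[p] F] [Algebra F₀ F]

theorem finrank_stdLattice_carrier (n : ℕ) :
    Module.finrank (padicIntegers p F) ((Fin (n / 2) → padicIntegers p F × padicIntegers p F) ×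
      (Fin (n % 2) → padicIntegers p F)) = n := by
  rw [Module.finrank_prod, Module.finrank_pi_fintype, Finset.sum_const, Module.finrank_prod,
    Module.finrank_self, Finset.card_univ, Fintype.card_fin, smul_eq_mul,
    Module.finrank_fin_fun]
  omega

variable [IsScalarTower ℚ_[p] F₀ F] {E : RamifiedQuadratic p F₀ F}

theorem isReduction_stdLattice (n : ℕ) {d : ℕ} (hπ : star (E.toResidue d E.π) = -E.toResidue d E.π) :
    ∃ r, IsReduction (E.stdLattice n)
      (((SkewHermForm.hyp (E.Residue d)).orthPow (n / 2)).orthSum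
        ((SkewHermForm.line (E.toResidue d E.π) hπ).orthPow (n % 2))) r := by
  obtain ⟨r₁, H₁⟩ := IsReduction.hyperbolic E d
  obtain ⟨r₂, H₂⟩ := IsReduction.rankOne E d (ε := 1) (s := E.π)
    (by rw [map_one, mul_one]) hπ rfl
  obtain ⟨r₃, H₃⟩ := H₁.orthPow (n / 2)
  obtain ⟨r₄, H₄⟩ := H₂.orthPow (n % 2)
  exact H₃.orthSum H₄

theorem isReduction_orthSum_rankOne {L : Type*} [AddCommGroup L] [Module (padicIntegers p F) L]
    {d : ℕ} {V : Type*} [AddCommGroup V] [Module (E.Residue d) V] {h : HermForm E L}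
    {B : SkewHermForm (E.Residue d) V} {ρ : L →ₛₗ[E.toResidue d] V} (H : IsReduction h B ρ)
    (hπ : star (-E.toResidue d E.π) = - -E.toResidue d E.π) :
    ∃ r, IsReduction (h.orthSum (E.rankOne (-1)))
      (B.orthSum (SkewHermForm.line (-E.toResidue d E.π) hπ)) r := by
  obtain ⟨r₂, H₂⟩ := IsReduction.rankOne E d (ε := -1) (s := -E.π)
    (by rw [map_neg, map_one, mul_neg, mul_one]; rfl) hπ (map_neg _ _).symm
  exact H.orthSum H₂

theorem isIntegral_stdLattice (n : ℕ) : (E.stdLattice n).IsIntegral := by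
  have hπ : star (E.toResidue 0 E.π) = -E.toResidue 0 E.π := by
    rw [star_toResidue, conjInt_π, map_neg]
  obtain ⟨r, H⟩ := isReduction_stdLattice n hπ
  exact H.isIntegral

variable [FiniteDimensional ℚ_[p] F₀]

theorem densitySeq_stdLattice_self (hp : p ≠ 2) (n : ℕ) {d : ℕ} (hd : 1 ≤ d) :
    HermForm.densitySeq (E.stdLattice n) (E.stdLattice n) d =
      ((n % 2 : ℕ) + 1) * ∏ i ∈ Finset.range (n / 2), (1 - ((E.q : ℝ) ^ (2 * (i + 1)))⁻¹) := by
  have hR := E.isRamifiedQuotient hp hd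
  have := hR.isUnit_two.invertible
  have hq : 0 < E.q := by have := E.one_lt_q; omega
  have hqr : (0 : ℝ) < E.q := by exact_mod_cast hq
  obtain ⟨r, H⟩ := isReduction_stdLattice n hR.star_π
  rw [HermForm.densitySeq, H.card_hermHoms hd H, SkewHermForm.card_isometricMaps_self_div hR _ _
    (Nat.mod_lt _ two_pos) hq (E.card_not_isUnit_residue hp hd), E.card_skew_residue hp hd,
    finrank_stdLattice_carrier, Nat.div_add_mod, Nat.cast_pow, ← pow_mul,
    show 2 * n - n = n by omega, ← sq, mul_div_cancel_left₀ _ (pow_pos hqr _).ne']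

theorem densitySeq_orthSum_rankOne (hp : p ≠ 2) {n : ℕ} (hn : Even (n + 1)) {L : Type*}
    [AddCommGroup L] [Module (padicIntegers p F) L]
    [Module.Free (padicIntegers p F) L] [Module.Finite (padicIntegers p F) L]
    (hrank : Module.finrank (padicIntegers p F) L = n) {h : HermForm E L} (hh : h.IsIntegral)
    {d : ℕ} (hd : 1 ≤ d) (k : ℕ) :
    HermForm.densitySeq ((E.stdLattice (n + 1)).orthSum (E.hyperbolic.orthPow k))
      (h.orthSum (E.rankOne (-1))) d =
    HermForm.densitySeq ((E.stdLattice n).orthSum (E.hyperbolic.orthPow k)) h d *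
      (1 - ((E.q : ℝ) ^ (n + 1 + 2 * k))⁻¹) := by
  have hR := E.isRamifiedQuotient hp hd
  have := hR.isUnit_two.invertible
  have hq : 0 < E.q := by have := E.one_lt_q; omega
  have hqr : (0 : ℝ) < E.q := by exact_mod_cast hq
  have hπ' : star (-E.toResidue d E.π) = - -E.toResidue d E.π := by rw [star_neg, hR.star_π]
  obtain ⟨S, hS⟩ := hh.exists_isGram (Module.Free.chooseBasis (padicIntegers p F) L)
  obtain ⟨r₁, H₁⟩ := hS.isReduction d
  obtain ⟨r₂, H₂⟩ := isReduction_orthSum_rankOne H₁ hπ'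
  obtain ⟨r₃, H₃⟩ := isReduction_stdLattice (n + 1) hR.star_π
  obtain ⟨r₄, H₄⟩ := isReduction_stdLattice n hR.star_π
  obtain ⟨r₅, H₅⟩ := isReduction_orthSum_hyperbolic H₃ k
  obtain ⟨r₆, H₆⟩ := isReduction_orthSum_hyperbolic H₄ k
  obtain ⟨a, ha⟩ := hn
  have hrel := SkewHermForm.card_isometricMaps_std_orthSum_line hR
    (SkewHermForm.ofMatrix _ (hS.conjTranspose_map d)) (s := (n + 1) / 2) (r := (n + 1) % 2)
    (s' := n / 2) (r' := n % 2) (k := k) (by omega) (by omega) (by omega) hq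
    (E.card_not_isUnit_residue hp hd) hπ'
  rw [E.card_skew_residue hp hd, E.card_residue hp,
    show 2 * ((n + 1) / 2 + k) = n + 1 + 2 * k by omega] at hrel
  rw [HermForm.densitySeq, HermForm.densitySeq, H₂.card_hermHoms hd H₅, H₁.card_hermHoms hd H₆,
    HermForm.finrank_orthSum_hyperbolic, HermForm.finrank_orthSum_hyperbolic,
    finrank_stdLattice_carrier, finrank_stdLattice_carrier, Module.finrank_prod,
    Module.finrank_self, hrank, div_mul_eq_mul_div, div_eq_div_iff (pow_pos hqr _).ne'
    (pow_pos hqr _).ne']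
  rw [← mul_left_inj' (pow_pos hqr d).ne']
  push_cast at hrel
  -- The two normalizations differ by q^{2d(n+1+2k)}/q^d, the number of all vectors of the target
  -- divided by the number of skew values.
  have hexp : d * ((n + 1) * (2 * (n + 1 + 2 * k) - (n + 1))) + d =
      2 * d * (n + 1 + 2 * k) + d * (n * (2 * (n + 2 * k) - n)) := by
    rw [show 2 * (n + 1 + 2 * k) - (n + 1) = n + 1 + 4 * k by omega,
      show 2 * (n + 2 * k) - n = n + 4 * k by omega]
    ring
  rw [mul_right_comm, hrel, mul_assoc _ (_ ^ _) (_ ^ d), ← pow_add, hexp, pow_add, ← pow_mul]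
  ring

end RamifiedQuadratic

/-! ### Compactness and the split criterion -/

section

variable {p : ℕ} [Fact p.Prime] {K : Type*} [Field K] [Algebra ℚ_[p] K]

/-- Compactness of the ring of integers: a sequence of vectors of integers has a limit point. -/
theorem exists_frequently_dvd_sub [FiniteDimensional ℚ_[p] K] {ϖ : padicIntegers p K}
    (hϖ : Irreducible ϖ) {ι : Type*} [Finite ι] (T : ℕ → ι → padicIntegers p K) :
    ∃ x : ι → padicIntegers p K, ∀ e : ℕ, ∃ᶠ d in atTop, ∀ i, ϖ ^ e ∣ T d i - x i := by
  let _ := spectralNorm.normedField ℚ_[p] K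
  have hc : IsCompact (Set.univ.pi fun _ : ι => (padicIntegers p K : Set K)) :=
    isCompact_univ_pi fun _ => isCompact_padicIntegers
  have hle : map (fun d i => (T d i : K)) atTop ≤
      𝓟 (Set.univ.pi fun _ : ι => (padicIntegers p K : Set K)) := by
    rw [le_principal_iff]
    exact mem_map.mpr (Eventually.of_forall fun d i _ => (T d i).2)
  obtain ⟨x, hx, hcl⟩ := hc hle
  refine ⟨fun i => ⟨x i, hx i trivial⟩, fun e => ?_⟩
  have hop : ∀ᶠ y in 𝓝 x, ∀ i, ∃ c : padicIntegers p K,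
      y i - x i = (ϖ ^ e : padicIntegers p K) * c := by
    rw [eventually_all]
    intro i
    have hU := isOpen_padicIntegers_ideal (pow_ne_zero e hϖ.ne_zero) (x i)
    have hcont : Continuous fun y : ι → K => y i := continuous_apply i
    refine (hU.preimage hcont).mem_nhds ⟨0, ?_⟩
    rw [sub_self, ZeroMemClass.coe_zero, mul_zero]
  refine (MapClusterPt.frequently hcl hop).mono fun d hd i => ?_
  obtain ⟨c, hc⟩ := hd i
  exact ⟨c, Subtype.ext hc⟩

/-- Every element of the base change of a lattice becomes integral after scaling. -/
theorem exists_smul_eq_one_tmul [FiniteDimensional ℚ_[p] K] {L : Type*} [AddCommGroup L] [Module (padicIntegers p K) L]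
    (z : K ⊗[padicIntegers p K] L) :
    ∃ a : padicIntegers p K, a ≠ 0 ∧ ∃ x : L, a • z = 1 ⊗ₜ x := by
  induction z using TensorProduct.induction_on with
  | zero => exact ⟨1, one_ne_zero, 0, by rw [smul_zero, TensorProduct.tmul_zero]⟩
  | tmul c x =>
    obtain ⟨a, ha, b, hb⟩ : ∃ a : padicIntegers p K, a ≠ 0 ∧ ∃ b : padicIntegers p K,
        (a : K) * c = b := by
      by_cases hc : c = 0
      · exact ⟨1, one_ne_zero, 0, by simp [hc]⟩
      rcases mem_padicIntegers_or_inv_mem (p := p) c with h | h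
      · exact ⟨1, one_ne_zero, ⟨c, h⟩, one_mul c⟩
      · exact ⟨⟨c⁻¹, h⟩, fun h0 => inv_ne_zero hc (congrArg Subtype.val h0), 1,
          inv_mul_cancel₀ hc⟩
    refine ⟨a, ha, b • x, ?_⟩
    rw [TensorProduct.smul_tmul', ← TensorProduct.smul_tmul]
    congr 1
    change (a : K) * c = b * 1
    rw [hb, mul_one]
  | add z w hz hw =>
    obtain ⟨a, ha, x, hx⟩ := hz
    obtain ⟨b, hb, y, hy⟩ := hw
    refine ⟨a * b, mul_ne_zero ha hb, b • x + a • y, ?_⟩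
    rw [smul_add, TensorProduct.tmul_add, mul_smul a b w, hy, mul_comm, mul_smul b a z, hx,
      TensorProduct.tmul_smul, TensorProduct.tmul_smul]

end

namespace RamifiedQuadratic

variable {p : ℕ} [Fact p.Prime] {F₀ F : Type*} [Field F₀] [Field F]
  [Algebra ℚ_[p] F₀] [Algebra ℚ_[p] F] [Algebra F₀ F]
variable {E : RamifiedQuadratic p F₀ F}
variable {L : Type*} [AddCommGroup L] [Module (padicIntegers p F) L]
variable {M : Type*} [AddCommGroup M] [Module (padicIntegers p F) M]

namespace HermForm

theorem Nondegenerate.orthSum_rankOne {h : HermForm E L} (hnd : h.Nondegenerate) {ε : F₀}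
    (hε : ε ≠ 0) : (h.orthSum (E.rankOne ε)).Nondegenerate := by
  rintro ⟨x, a⟩ hx
  have h1 : ∀ y, h.form x y = 0 := fun y => by
    have := hx (y, 0)
    change h.form x y + (a : F) * _ * E.conj ((0 : padicIntegers p F) : F) = 0 at this
    rwa [ZeroMemClass.coe_zero, map_zero, mul_zero, add_zero] at this
  have h2 : (a : F) * algebraMap F₀ F ε * E.conj ((1 : padicIntegers p F) : F) = 0 := by
    have := hx (0, 1)
    change h.form x 0 + _ = 0 at this
    rwa [h1, zero_add] at this
  rw [OneMemClass.coe_one, map_one, mul_one, mul_eq_zero, map_eq_zero, or_iff_left hε] at h2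
  have ha : a = 0 := Subtype.ext h2
  rw [hnd x h1, ha]
  rfl

theorem not_isIntegral_orthSum {h : HermForm E L} {h' : HermForm E M} (hh : ¬ h.IsIntegral) :
    ¬ (h.orthSum h').IsIntegral := fun H => hh fun x y => by
  obtain ⟨c, hc⟩ := H (x, 0) (y, 0)
  obtain ⟨c', hc'⟩ := H (0, 0) (y, 0)
  refine ⟨c - c', ?_⟩
  push_cast
  rw [← hc, ← hc']
  have : h.form 0 y = 0 := by
    have := h.smul_left 0 0 y
    rwa [zero_smul, ZeroMemClass.coe_zero, zero_mul] at this
  change _ = _ * (h.form x y + _) - _ * (h.form 0 y + _)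
  rw [this]
  ring

/-- A multiple of any element of the kernel of the base change comes from L and is orthogonal to L,
hence vanishes. So the base change is injective, and equality of dimensions makes it an equivalence.
-/
theorem isSplit_of_linearMap [FiniteDimensional ℚ_[p] F] [Module.Free (padicIntegers p F) L]
    [Module.Finite (padicIntegers p F) L] {h : HermForm E L} (hnd : h.Nondegenerate) {N : ℕ}
    (hN : Module.finrank (padicIntegers p F) L = N) (ψ : L →ₗ[padicIntegers p F] (Fin N → F))
    (hψ : ∀ x y, h.form x y = ∑ i, ψ x i * E.conj (ψ y (Fin.rev i))) : h.IsSplit := by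
  subst hN
  have hinj : Function.Injective (LinearMap.liftBaseChange F ψ) := by
    rw [injective_iff_map_eq_zero]
    intro z hz
    obtain ⟨a, ha, x, hx⟩ := exists_smul_eq_one_tmul z
    have hψx : ψ x = 0 := by
      have h1 : LinearMap.liftBaseChange F ψ (1 ⊗ₜ x) = ψ x := by
        rw [LinearMap.liftBaseChange_tmul, one_smul]
      rw [← h1, ← hx]
      have h2 : a • z = (a : F) • z := rfl
      rw [h2, map_smul, hz, smul_zero]
    have hx0 : x = 0 := hnd x fun y => by
      rw [hψ, hψx]
      simp
    rw [hx0, TensorProduct.tmul_zero] at hx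
    have h2 : a • z = (a : F) • z := rfl
    rw [h2] at hx
    exact (smul_eq_zero.mp hx).resolve_left fun h0 => ha (Subtype.ext h0)
  refine ⟨LinearMap.linearEquivOfInjective (LinearMap.liftBaseChange F ψ) hinj ?_, fun x y => ?_⟩
  · rw [Module.finrank_baseChange, Module.finrank_fin_fun]
  · simp only [LinearMap.linearEquivOfInjective_apply, LinearMap.liftBaseChange_tmul, one_smul, hψ]

end HermForm

/-- The first coordinates of the planes fill the first half of F^N; the second ones, in reverse
order and scaled by -π⁻¹, fill the second half. The empty summand H^0 is present because X = 1 is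
the case k = 0 of the density polynomial. -/
theorem exists_linearMap_stdLattice (E : RamifiedQuadratic p F₀ F) {N : ℕ} (hN : Even N) :
    ∃ c : (((Fin (N / 2) → padicIntegers p F × padicIntegers p F) ×
      (Fin (N % 2) → padicIntegers p F)) × (Fin 0 → padicIntegers p F × padicIntegers p F))
      →ₗ[padicIntegers p F] (Fin N → F), ∀ z w,
      ((E.stdLattice N).orthSum (E.hyperbolic.orthPow 0)).form z w =
        ∑ i, c z i * E.conj (c w (Fin.rev i)) := by
  suffices H : ∀ s r : ℕ, r = 0 → N = s + s → ∃ c : (((Fin s → padicIntegers p F × padicIntegers p F) ×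
      (Fin r → padicIntegers p F)) × (Fin 0 → padicIntegers p F × padicIntegers p F))
      →ₗ[padicIntegers p F] (Fin N → F), ∀ z w,
      (((E.hyperbolic.orthPow s).orthSum ((E.rankOne 1).orthPow r)).orthSum
        (E.hyperbolic.orthPow 0)).form z w =
        ∑ i, c z i * E.conj (c w (Fin.rev i)) by
    obtain ⟨a, ha⟩ := hN
    exact H _ _ (by omega) (by omega)
  rintro s r rfl rfl
  refine ⟨
    { toFun := fun z => Fin.append (fun i => ((z.1.1 i).1 : F))
        (fun i => -(E.π : F)⁻¹ * ((z.1.1 i.rev).2 : F))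
      map_add' := fun z w => ?_
      map_smul' := fun a z => ?_ }, fun z w => ?_⟩
  · funext i
    refine Fin.addCases (fun i => ?_) (fun i => ?_) i
    · simp only [Pi.add_apply, Fin.append_left, Prod.fst_add]
      rfl
    · simp only [Pi.add_apply, Fin.append_right, Prod.fst_add, Prod.snd_add]
      push_cast
      ring
  · funext i
    refine Fin.addCases (fun i => ?_) (fun i => ?_) i
    · simp only [Fin.append_left, Pi.smul_apply]
      rfl
    · simp only [Fin.append_right, Pi.smul_apply, RingHom.id_apply]
      change _ * ((a : F) * _) = (a : F) * (_ * _)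
      ring
  · have hl : ∀ i : Fin s, Fin.rev (Fin.castAdd s i) = Fin.natAdd s i.rev := fun i => by
      ext
      simp only [Fin.val_rev, Fin.val_castAdd, Fin.val_natAdd]
      omega
    have hr : ∀ i : Fin s, Fin.rev (Fin.natAdd s i) = Fin.castAdd s i.rev := fun i => by
      ext
      simp only [Fin.val_rev, Fin.val_castAdd, Fin.val_natAdd]
      omega
    change (∑ i, E.hyperbolic.form (z.1.1 i) (w.1.1 i) + ∑ i : Fin 0, (E.rankOne 1).form (z.1.2 i)
      (w.1.2 i)) + ∑ i : Fin 0, E.hyperbolic.form (z.2 i) (w.2 i) = _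
    rw [Fin.sum_univ_zero, Fin.sum_univ_zero, add_zero, add_zero, Fin.sum_univ_add]
    simp only [LinearMap.coe_mk, AddHom.coe_mk, hl, hr, Fin.append_left, Fin.append_right,
      Fin.rev_rev]
    rw [← Equiv.sum_comp Fin.revPerm (fun i => -(E.π : F)⁻¹ * ((z.1.1 (Fin.rev i)).2 : F) * _),
      ← Finset.sum_add_distrib]
    refine Finset.sum_congr rfl fun i _ => ?_
    simp only [Fin.revPerm_apply, Fin.rev_rev, map_mul, map_neg, map_inv₀, E.conj_π, inv_neg]
    change _ * _ * _ - _ * _ * _ = _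
    ring

variable [IsScalarTower ℚ_[p] F₀ F] [FiniteDimensional ℚ_[p] F₀]

namespace HermForm

variable [Module.Free (padicIntegers p F) L] [Module.Finite (padicIntegers p F) L]
variable [Module.Free (padicIntegers p F) M] [Module.Finite (padicIntegers p F) M]

/-- If the sets of isometries modulo high powers of the uniformizer are nonempty, then there is
an isometric embedding. -/
theorem exists_isometric_linearMap {h : HermForm E L} {h' : HermForm E M}
    (hh : h.IsIntegral) (hh' : h'.IsIntegral)
    (hne : ∀ᶠ d in atTop, Nat.card (hermHoms h' h d) ≠ 0) :
    ∃ T : L →ₗ[padicIntegers p F] M, ∀ x y, h'.form (T x) (T y) = h.form x y := by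
  classical
  have := E.finiteDimensional
  let b := Module.Free.chooseBasis (padicIntegers p F) L
  let b' := Module.Free.chooseBasis (padicIntegers p F) M
  obtain ⟨S, hS⟩ := hh.exists_isGram b
  obtain ⟨G, hG⟩ := hh'.exists_isGram b'
  have hex : ∀ d, ∃ T : Matrix (Module.Free.ChooseBasisIndex (padicIntegers p F) L)
      (Module.Free.ChooseBasisIndex (padicIntegers p F) M) (padicIntegers p F), 1 ≤ d →
      Nat.card (hermHoms h' h d) ≠ 0 →
      T.map (E.toResidue d) * G.map (E.toResidue d) * (T.map (E.toResidue d)).conjTranspose =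
        S.map (E.toResidue d) := by
    intro d
    by_cases hd : 1 ≤ d ∧ Nat.card (hermHoms h' h d) ≠ 0
    swap
    · exact ⟨0, fun h1 h2 => absurd ⟨h1, h2⟩ hd⟩
    obtain ⟨r, H⟩ := hS.isReduction d
    obtain ⟨r', H'⟩ := hG.isReduction d
    have hc := hd.2
    rw [H.card_hermHoms hd.1 H', SkewHermForm.card_isometricMaps_ofMatrix] at hc
    obtain ⟨⟨T, hT⟩⟩ := (Nat.card_ne_zero.mp hc).1
    choose T' hT' using fun i j => E.toResidue_surjective d (T i j)
    have : (Matrix.of T').map (E.toResidue d) = T := Matrix.ext hT'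
    exact ⟨Matrix.of T', fun _ _ => by rw [this]; exact hT⟩
  choose T hT using hex
  obtain ⟨X, hX⟩ := exists_frequently_dvd_sub E.irreducible_π fun d
    (ij : Module.Free.ChooseBasisIndex (padicIntegers p F) L ×
      Module.Free.ChooseBasisIndex (padicIntegers p F) M) => T d ij.1 ij.2
  have hXS : ∀ i j, ∑ k, ∑ l, X (i, k) * G k l * E.conjInt (X (j, l)) = S i j := by
    intro i j
    -- A nonzero discrepancy divides some π^e. For some large d, the solution modulo π^{2d} is
    -- congruent to X modulo π^{2(e+1)}, so this power divides the discrepancy and hence π^e, which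
    -- is absurd.
    by_contra hne'
    obtain ⟨e, he⟩ := exists_dvd_irreducible_pow E.irreducible_π (sub_ne_zero.mpr hne')
    obtain ⟨d, hdX, hd1, hde, hdc⟩ := ((hX (2 * (e + 1))).and_eventually
      ((eventually_ge_atTop 1).and ((eventually_ge_atTop (e + 1)).and hne))).exists
    have hmap : (Matrix.of fun i k => X (i, k)).map (E.toResidue (e + 1)) =
        (T d).map (E.toResidue (e + 1)) := by
      ext i k
      rw [Matrix.map_apply, Matrix.map_apply, ← sub_eq_zero, ← map_sub, toResidue_eq_zero_iff,
        dvd_sub_comm]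
      exact hdX (i, k)
    have hentry : ∀ (d : ℕ) (T : Matrix (Module.Free.ChooseBasisIndex (padicIntegers p F) L)
      (Module.Free.ChooseBasisIndex (padicIntegers p F) M) (padicIntegers p F)),
      (T.map (E.toResidue d) * G.map (E.toResidue d) *
        (T.map (E.toResidue d)).conjTranspose) i j =
      E.toResidue d (∑ k, ∑ l, T i k * G k l * E.conjInt (T j l)) := by
      intro d T
      simp only [Matrix.mul_apply, Matrix.conjTranspose_apply, Matrix.map_apply, star_toResidue,
        map_sum, map_mul, Finset.sum_mul]
      exact Finset.sum_comm
    have h1 := hentry d (T d)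
    rw [hT d hd1 hdc, Matrix.map_apply, ← sub_eq_zero, ← map_sub, toResidue_eq_zero_iff] at h1
    have h2 := hentry (e + 1) (T d)
    rw [← hmap, hentry, ← sub_eq_zero, ← map_sub, toResidue_eq_zero_iff] at h2
    have h3 := dvd_sub h2 ((pow_dvd_pow E.π (by omega : 2 * (e + 1) ≤ 2 * d)).trans h1)
    have h4 : E.π ^ (2 * (e + 1)) ∣
        ∑ k, ∑ l, X (i, k) * G k l * E.conjInt (X (j, l)) - S i j := by
      simpa using h3
    have h5 := (pow_dvd_pow_iff E.irreducible_π.ne_zero E.irreducible_π.not_isUnit).mp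
      (h4.trans he)
    omega
  let φ : L →ₗ[padicIntegers p F] M := b.constr (padicIntegers p F) fun i => ∑ k, X (i, k) • b' k
  have hφ : ∀ i, φ (b i) = ∑ k, X (i, k) • b' k := fun i => b.constr_basis _ _ _
  have hbase : ∀ i j, h'.form (φ (b i)) (φ (b j)) = h.form (b i) (b j) := by
    intro i j
    refine mul_left_cancel₀ E.π_ne_zero ?_
    rw [hS i j, hG.form_eq_sum, hφ, hφ, ← hXS]
    congr 1
    refine Finset.sum_congr rfl fun k _ => Finset.sum_congr rfl fun l _ => ?_
    rw [b'.repr_sum_self, b'.repr_sum_self]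
  refine ⟨φ, fun x y => ?_⟩
  rw [← b.sum_repr x, ← b.sum_repr y, map_sum, map_sum]
  simp only [map_smul]
  rw [sum_smul_left, sum_smul_left]
  refine Finset.sum_congr rfl fun i _ => ?_
  rw [sum_smul_right, sum_smul_right]
  exact congrArg _ (Finset.sum_congr rfl fun j _ => by rw [hbase])

theorem isSplit_of_eventually_card_ne_zero {h : HermForm E L}
    (hnd : h.Nondegenerate) (hh : h.IsIntegral) {N : ℕ} (hN : Even N)
    (hrank : Module.finrank (padicIntegers p F) L = N)
    (hne : ∀ᶠ d in atTop, Nat.card (hermHoms ((E.stdLattice N).orthSum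
      (E.hyperbolic.orthPow 0)) h d) ≠ 0) : h.IsSplit := by
  have := E.finiteDimensional
  obtain ⟨T, hT⟩ := exists_isometric_linearMap hh
    ((isIntegral_stdLattice N).orthSum_hyperbolic 0) hne
  obtain ⟨c, hc⟩ := E.exists_linearMap_stdLattice hN
  exact isSplit_of_linearMap hnd hrank (c ∘ₗ T) fun x y => by
    rw [← hT, hc]
    rfl

end HermForm

end RamifiedQuadratic

/-! ### Passage to the limit and the main theorem -/

namespace RamifiedQuadratic

variable {p : ℕ} [Fact p.Prime] {F₀ F : Type*} [Field F₀] [Field F]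
  [Algebra ℚ_[p] F₀] [Algebra ℚ_[p] F] [Algebra F₀ F]
  [FiniteDimensional ℚ_[p] F₀] {E : RamifiedQuadratic p F₀ F}

theorem one_sub_inv_q_pow_pos (E : RamifiedQuadratic p F₀ F) (k : ℕ) :
    (0 : ℝ) < 1 - ((E.q : ℝ) ^ (k + 1))⁻¹ := by
  have hq : (1 : ℝ) < E.q := by exact_mod_cast E.one_lt_q
  exact sub_pos.mpr (inv_lt_one_of_one_lt₀ (one_lt_pow₀ hq (by omega)))

theorem prod_one_sub_inv_q_pow_pos (E : RamifiedQuadratic p F₀ F) (m : ℕ) :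
    (0 : ℝ) < ∏ i ∈ Finset.range m, (1 - ((E.q : ℝ) ^ (2 * (i + 1)))⁻¹) :=
  Finset.prod_pos fun i _ => E.one_sub_inv_q_pow_pos (2 * i + 1)

variable [IsScalarTower ℚ_[p] F₀ F]

theorem tendsto_densitySeq_stdLattice_self (hp : p ≠ 2) (n : ℕ) :
    Tendsto (HermForm.densitySeq (E.stdLattice n) (E.stdLattice n)) atTop
      (𝓝 (((n % 2 : ℕ) + 1) * ∏ i ∈ Finset.range (n / 2), (1 - ((E.q : ℝ) ^ (2 * (i + 1)))⁻¹))) :=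
  tendsto_const_nhds.congr' (eventually_atTop.mpr ⟨1, fun _ hd =>
    (densitySeq_stdLattice_self hp n hd).symm⟩)

theorem density_stdLattice_self (hp : p ≠ 2) (n : ℕ) :
    HermForm.density (E.stdLattice n) (E.stdLattice n) =
      ((n % 2 : ℕ) + 1) * ∏ i ∈ Finset.range (n / 2), (1 - ((E.q : ℝ) ^ (2 * (i + 1)))⁻¹) :=
  (tendsto_densitySeq_stdLattice_self hp n).limUnder_eq

namespace HermForm

variable {L : Type*} [AddCommGroup L] [Module (padicIntegers p F) L]
  [Module.Free (padicIntegers p F) L] [Module.Finite (padicIntegers p F) L]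

theorem IsDensityPoly.orthSum_rankOne (hp : p ≠ 2) {n : ℕ} (hn : Even (n + 1))
    (hrank : Module.finrank (padicIntegers p F) L = n) {h : HermForm E L} {P : ℚ[X]}
    (hP : IsDensityPoly (E.stdLattice n) h P) :
    IsDensityPoly (E.stdLattice (n + 1)) (h.orthSum (E.rankOne (-1)))
      (P * (1 - C (((E.q : ℚ) ^ (n + 1))⁻¹) * X)) := by
  intro k
  have hval : (((P * (1 - C (((E.q : ℚ) ^ (n + 1))⁻¹) * X)).eval (((E.q : ℚ) ^ (2 * k))⁻¹) : ℚ) : ℝ)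
      = ((P.eval (((E.q : ℚ) ^ (2 * k))⁻¹) : ℚ) : ℝ) *
        (1 - ((E.q : ℝ) ^ (n + 1 + 2 * k))⁻¹) := by
    rw [eval_mul, eval_sub, eval_one, eval_mul, eval_C, eval_X, ← mul_inv, ← pow_add]
    push_cast
    rfl
  rw [hval]
  refine ((hP k).mul_const _).congr' (eventually_atTop.mpr ⟨1, fun d hd => ?_⟩)
  by_cases hh : h.IsIntegral
  · exact (densitySeq_orthSum_rankOne hp hn hrank hh hd k).symm
  -- If L is not integral, neither is L^#, and both sequences vanish for d ≥ 1.
  · rw [densitySeq, densitySeq,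
      card_hermHoms_eq_zero hd hh ((isIntegral_stdLattice n).orthSum_hyperbolic k),
      card_hermHoms_eq_zero hd (not_isIntegral_orthSum hh)
        ((isIntegral_stdLattice (n + 1)).orthSum_hyperbolic k)]
    simp only [Nat.cast_zero, zero_div, zero_mul]

/-- The density polynomial of a nonsplit lattice of even rank vanishes at `1`. -/
theorem IsDensityPoly.eval_one_eq_zero {h : HermForm E L} (hnd : h.Nondegenerate)
    (hns : ¬ h.IsSplit) {N : ℕ} (hN : Even N)
    (hrank : Module.finrank (padicIntegers p F) L = N) {P : ℚ[X]}
    (hP : IsDensityPoly (E.stdLattice N) h P) : P.eval 1 = 0 := by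
  by_contra hne
  have h0 := hP 0
  rw [mul_zero, pow_zero, inv_one] at h0
  have hev : ∀ᶠ d in atTop, Nat.card (hermHoms ((E.stdLattice N).orthSum
      (E.hyperbolic.orthPow 0)) h d) ≠ 0 := by
    filter_upwards [h0.eventually_ne (Rat.cast_ne_zero.mpr hne)] with d hd hc
    exact hd (by rw [densitySeq, hc, Nat.cast_zero, zero_div])
  by_cases hh : h.IsIntegral
  · exact hns (isSplit_of_eventually_card_ne_zero hnd hh hN hrank hev)
  · obtain ⟨d, hd, h1⟩ := (hev.and (eventually_ge_atTop 1)).exists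
    exact hd (card_hermHoms_eq_zero h1 hh ((isIntegral_stdLattice N).orthSum_hyperbolic 0))

end HermForm

end RamifiedQuadratic

open RamifiedQuadratic HermForm in
theorem mainTheorem4 (p : ℕ) [Fact p.Prime] (hp : p ≠ 2)
    {F₀ F : Type*} [Field F₀] [Field F] [Algebra ℚ_[p] F₀] [FiniteDimensional ℚ_[p] F₀]
    [Algebra ℚ_[p] F] [Algebra F₀ F] [IsScalarTower ℚ_[p] F₀ F]
    (E : RamifiedQuadratic p F₀ F) (n : ℕ) (hn : Even (n + 1))
    {L : Type*} [AddCommGroup L] [Module (padicIntegers p F) L]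
    [Module.Free (padicIntegers p F) L] [Module.Finite (padicIntegers p F) L]
    (hrank : Module.finrank (padicIntegers p F) L = n)
    (hL : HermForm E L) (hnondeg : hL.Nondegenerate)
    (hnonsplit : ¬ (hL.orthSum (E.rankOne (-1))).IsSplit) :
    (∃! P, IsDensityPoly (E.stdLattice n) hL P) ∧
    (∃! P, IsDensityPoly (E.stdLattice (n + 1)) (hL.orthSum (E.rankOne (-1))) P) ∧
    (∃ δ : ℝ, 0 < δ ∧
      Tendsto (densitySeq (E.stdLattice n) (E.stdLattice n)) atTop (𝓝 δ)) ∧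
    (∃ δ : ℝ, 0 < δ ∧
      Tendsto (densitySeq (E.stdLattice (n + 1)) (E.stdLattice (n + 1))) atTop (𝓝 δ)) ∧
    densityPoly (E.stdLattice (n + 1)) (hL.orthSum (E.rankOne (-1))) =
      densityPoly (E.stdLattice n) hL * (1 - C (((E.q : ℚ) ^ (n + 1))⁻¹) * X) ∧
    hL.derivedDensity = 1 / 2 * (hL.orthSum (E.rankOne (-1))).derivedDensity := by
  subst hrank
  set n := Module.finrank (padicIntegers p F) L with hndef
  have hrank' : Module.finrank (padicIntegers p F) (L × padicIntegers p F) = n + 1 := by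
    rw [Module.finrank_prod, Module.finrank_self]
  obtain ⟨P, hP⟩ := exists_isDensityPoly hp hnondeg (isIntegral_stdLattice (E := E) n)
    (by rw [finrank_stdLattice_carrier]; omega)
  have hP' := hP.orthSum_rankOne hp hn rfl
  have h1 := hP'.eval_one_eq_zero (hnondeg.orthSum_rankOne (neg_ne_zero.mpr one_ne_zero))
    hnonsplit hn hrank'
  have hpos : ∀ m : ℕ, (0 : ℝ) < ((m % 2 : ℕ) + 1) *
      ∏ i ∈ Finset.range (m / 2), (1 - ((E.q : ℝ) ^ (2 * (i + 1)))⁻¹) := fun m =>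
    mul_pos (by positivity) (E.prod_one_sub_inv_q_pow_pos _)
  refine ⟨⟨P, hP, fun Q hQ => hQ.eq hP⟩, ⟨_, hP', fun Q hQ => hQ.eq hP'⟩,
    ⟨_, hpos n, tendsto_densitySeq_stdLattice_self hp n⟩,
    ⟨_, hpos (n + 1), tendsto_densitySeq_stdLattice_self hp (n + 1)⟩, ?_, ?_⟩
  · rw [hP.densityPoly_eq, hP'.densityPoly_eq]
  have hc := E.one_sub_inv_q_pow_pos n
  have hcq : (1 - ((E.q : ℚ) ^ (n + 1))⁻¹) ≠ 0 := fun h0 => hc.ne' (by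
    have := congrArg (Rat.cast : ℚ → ℝ) h0
    push_cast at this
    exact this)
  rw [eval_mul, eval_sub, eval_one, eval_mul, eval_C, eval_X, mul_one] at h1
  -- The vanishing for L^# descends to L, since 1 - q^{-(n+1)} is not zero. The product rule at 1
  -- then retains only the term with the derivative of P.
  have hP1 : P.eval 1 = 0 := (mul_eq_zero.mp h1).resolve_right hcq
  rw [derivedDensity, derivedDensity, hrank', ← hndef, hP.densityPoly_eq, hP'.densityPoly_eq,
    density_stdLattice_self hp, density_stdLattice_self hp, derivative_mul, eval_add, eval_mul,
    eval_mul, hP1, zero_mul, add_zero, eval_sub, eval_one, eval_mul, eval_C, eval_X, mul_one]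
  obtain ⟨a, ha⟩ := hn
  have e1 : n % 2 = 1 := by omega
  have e2 : (n + 1) % 2 = 0 := by omega
  have e3 : (n + 1) / 2 = n / 2 + 1 := by omega
  have e4 : 2 * (n / 2 + 1) = n + 1 := by omega
  -- Since n is odd, the density of M_n has the factor 2 of its line, and that of M_{n+1} the extra
  -- factor 1 - q^{-(n+1)}, which cancels the one from the derivative.
  rw [e1, e2, e3, Finset.prod_range_succ, e4]
  have hprod := E.prod_one_sub_inv_q_pow_pos (n / 2)
  generalize ∏ i ∈ Finset.range (n / 2), (1 - ((E.q : ℝ) ^ (2 * (i + 1)))⁻¹) = D at *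
  push_cast
  generalize (1 - ((E.q : ℝ) ^ (n + 1))⁻¹) = c at *
  have := hc.ne'
  have := hprod.ne'
  field_simp
  ring
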